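/- Let $P$ be a right Ore monoid: (O1) for all $x_1,x_2\in P$ there are $y_1,y_2\in P$ with $x_1y_1=x_2y_2$; (O2) if $xy_1=xy_2$, then $y_1z=y_2z$ for some $z\in P$. Let $G$ be its group of fractions $pq^{-1}$, where $p_1q_1^{-1}=p_2q_2^{-1}$ if and only if $p_1t_1=p_2t_2$ and $q_1t_1=q_2t_2$ for some $t_1,t_2\in P$. Let $X$ be a locally compact Hausdorff space with an action of $P$ by proper topological correspondences. That is, there are locally compact Hausdorff spaces $M_p$ for $p\in P$ with proper continuous maps $r_p\colon M_p\to X$ and local homeomorphisms $s_p\colon M_p\to X$, and homeomorphisms $\sigma_{p,q}=(r_{p,q},s_{p,q})\colon M_{pq}\to M_p\times_{s_p,X,r_q}M_q$ with $r_p\circ r_{p,q}=r_{pq}$, $s_q\circ s_{p,q}=s_{pq}$, which are associative: $r_{p,q}r_{pq,t}=r_{p,qt}$, $s_{p,q}r_{pq,t}=r_{q,t}s_{p,qt}$, $s_{q,t}s_{p,qt}=s_{pq,t}$ for all $p,q,t\in P$. Here $M_1=X$ with $r_1=s_1=\mathrm{id}_X$ (up to a homeomorphism $M_1\cong X$), and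 $r_{p,1}=\mathrm{id}_{M_p}$, $s_{1,q}=\mathrm{id}_{M_q}$. *The groupoid.* Let $H^0=\{(m_p)_{p\in P}\in\prod_p M_p : r_{p,q}(m_{pq})=m_p \text{ for all } p,q\in P\}$ with the subspace topology, let $\pi_p\colon H^0\to M_p$ be the projections, and let $\tilde s_t\colon H^0\to H^0$, $\tilde s_t(m)_p=s_{t,p}(m_{tp})$ for $t\in P$. Let $H=P^{\mathrm{op}}\ltimes H^0$ be the groupoid with objects $H^0$ and arrows $$H^1=\{(x,g,y)\in H^0\times G\times H^0 : \exists\, p_1,p_2\in P,\ g=p_1p_2^{-1},\ \tilde s_{p_1}(x)=\tilde s_{p_2}(y)\},$$ with range $x$, source $y$ and product $(x,g,y)(y,h,z)=(x,gh,z)$. Its topology is the quotient topology from the disjoint union over $p_1,p_2\in P$ of the spaces $\{(x,y)\in H^0\times H^0:\tilde s_{p_1}(x)=\tilde s_{p_2}(y)\}$ along the maps $(x,y)\mapsto(x,p_1p_2^{-1},y)$. Then $H$ is an étale, locally compact, Hausdorff groupoid. Let $\mathrm C^*(H)$ be its full groupoid $\mathrm C^*$-algebra, the completion of the convolution $*$-algebra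 $\mathrm C_c(H^1)$ in the largest $\mathrm C^*$-seminorm. *The Cuntz–Pimsner algebra.* For $p\in P$ let $\mathcal H_p$ be the completion of $\mathrm C_c(M_p)$ for the $\mathrm C_0(X)$-valued inner product $\langle\xi,\eta\rangle(x)=\sum_{s_p(m)=x}\overline{\xi(m)}\eta(m)$, with the left action $(\varphi_p(f)\xi)(m)=f(r_p(m))\xi(m)$ and the right action $(\xi f)(m)=\xi(m)f(s_p(m))$ of $\mathrm C_0(X)$, and let $(\xi\cdot\eta)(m)=\xi(r_{p,q}(m))\,\eta(s_{p,q}(m))$ for $\xi\in\mathcal H_p$, $\eta\in\mathcal H_q$, $m\in M_{pq}$; here $\mathcal H_1=\mathrm C_0(X)$. The Cuntz–Pimsner algebra $\mathcal O$ of this product system is the universal $\mathrm C^*$-algebra generated by linear maps $S_p\colon\mathcal H_p\to\mathcal O$, $p\in P$, such that $S_1$ is a $*$-homomorphism on $\mathrm C_0(X)$; $S_p(\xi)^*S_p(\eta)=S_1(\langle\xi,\eta\rangle)$ for $\xi,\eta\in\mathcal H_p$; $S_p(\xi)S_q(\eta)=S_{pq}(\xi\cdot\eta)$ for $\xi\in\mathcal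 H_p$, $\eta\in\mathcal H_q$; and, for each $p$, the continuous linear map $\vartheta_p\colon\mathbb K(\mathcal H_p)\to\mathcal O$, $|\xi\rangle\langle\eta|\mapsto S_p(\xi)S_p(\eta)^*$, satisfies $\vartheta_p(\varphi_p(f))=S_1(f)$ for all $f\in\mathrm C_0(X)$ with $\varphi_p(f)\in\mathbb K(\mathcal H_p)$. **Theorem.** The groupoid $\mathrm C^*$-algebra $\mathrm C^*(H)$ is canonically isomorphic to the Cuntz–Pimsner algebra $\mathcal O$ of the product system $(\mathcal H_p)_{p\in P}$: there is a unique $*$-isomorphism $\Phi\colon\mathcal O\to\mathrm C^*(H)$ such that, for all $p\in P$ and $\xi\in\mathrm C_c(M_p)$, $\Phi(S_p(\xi))$ is the class of the function in $\mathrm C_c(H^1)$ that maps $(x,p,\tilde s_p(x))$ to $\xi(\pi_p(x))$ for $x\in H^0$ and vanishes at all other arrows. -/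

import Mathlib

open Topology Filter Set
open scoped CompactlySupported ZeroAtInfty ENNReal ComplexConjugate

set_option linter.unusedSectionVars false
set_option linter.unusedVariables false
set_option linter.checkUnivs false

/-! ## Completions of star-algebras in C⋆-seminorms -/

noncomputable section CStarCompletion

variable {A : Type*} [NonUnitalRing A] [StarRing A] [Module ℂ A] [IsScalarTower ℂ A A]
  [SMulCommClass ℂ A A] [StarModule ℂ A]

/-- A C⋆-seminorm on a complex star-algebra (not necessarily unital). -/
structure CStarSeminorm (A : Type*) [NonUnitalRing A] [StarRing A] [Module ℂ A] extends
    Seminorm ℂ A where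
  mul_le' : ∀ a b : A, toFun (a * b) ≤ toFun a * toFun b
  star_mul_self' : ∀ a : A, toFun (star a * a) = toFun a * toFun a

namespace CStarSeminorm

instance : CoeFun (CStarSeminorm A) (fun _ => A → ℝ) := ⟨fun N => N.toSeminorm⟩

variable (N : CStarSeminorm A)

theorem mul_le (a b : A) : N (a * b) ≤ N a * N b := N.mul_le' a b

theorem star_mul_self (a : A) : N (star a * a) = N a * N a := N.star_mul_self' a

theorem le_star (a : A) : N a ≤ N (star a) := by
  by_cases h : N a = 0
  · rw [h]; exact apply_nonneg N.toSeminorm _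
  · have hpos : 0 < N a := lt_of_le_of_ne (apply_nonneg N.toSeminorm _) (Ne.symm h)
    have := (N.star_mul_self a).symm.le.trans (N.mul_le (star a) a)
    exact le_of_mul_le_mul_right this hpos

theorem star_eq (a : A) : N (star a) = N a :=
  le_antisymm (by simpa using N.le_star (star a)) (N.le_star a)

/-- The zero seminorm. -/
instance : Zero (CStarSeminorm A) :=
  ⟨{ toSeminorm := 0
     mul_le' := fun a b => by
       change (0 : ℝ) ≤ 0 * 0
       simp
     star_mul_self' := fun a => by
       change (0 : ℝ) = 0 * 0
       simp }⟩

instance : Inhabited (CStarSeminorm A) := ⟨0⟩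

/-- The algebra `A`, equipped with the seminorm `N`. -/
@[nolint unusedArguments]
def Pre (_N : CStarSeminorm A) : Type _ := A

namespace Pre

instance : NonUnitalSeminormedRing N.Pre :=
  letI R : NonUnitalRing N.Pre := inferInstanceAs (NonUnitalRing A)
  letI G : SeminormedAddCommGroup N.Pre :=
    N.toSeminorm.toAddGroupSeminorm.toSeminormedAddCommGroup
  { R with
    norm := G.norm
    toPseudoMetricSpace := G.toPseudoMetricSpace
    dist_eq := G.dist_eq
    norm_mul_le := N.mul_le }

theorem norm_def (a : A) : ‖(show N.Pre from a)‖ = N a := rfl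

instance : StarRing N.Pre := inferInstanceAs (StarRing A)

instance : NormedSpace ℂ N.Pre :=
  letI M : Module ℂ N.Pre := inferInstanceAs (Module ℂ A)
  { M with
    norm_smul_le := fun c a => (map_smul_eq_mul N.toSeminorm c a).le }

instance : IsScalarTower ℂ N.Pre N.Pre := inferInstanceAs (IsScalarTower ℂ A A)
instance : SMulCommClass ℂ N.Pre N.Pre := inferInstanceAs (SMulCommClass ℂ A A)
instance : StarModule ℂ N.Pre := inferInstanceAs (StarModule ℂ A)

instance : NormedStarGroup N.Pre where
  norm_star_le a := (N.star_eq a).le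

end Pre

/-- The C⋆-algebra obtained from `A` by Hausdorff completion in the C⋆-seminorm `N`. -/
abbrev Completion : Type _ := UniformSpace.Completion N.Pre

namespace Completion

open UniformSpace

/-- The canonical map from the algebra to its completion, as a plain function. -/
def mk (a : A) : N.Completion := ((show N.Pre from a : N.Pre) : UniformSpace.Completion N.Pre)

variable {N}

theorem isDenseInducing_mk : IsDenseInducing (fun a : N.Pre => mk N a) :=
  UniformSpace.Completion.isDenseInducing_coe

theorem continuous_mk : Continuous (fun a : N.Pre => mk N a) := isDenseInducing_mk.continuous

theorem denseRange_mk : DenseRange (mk N) := (isDenseInducing_mk (N := N)).dense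

theorem mk_add (a b : A) : mk N (a + b) = mk N a + mk N b :=
  UniformSpace.Completion.coe_add (α := N.Pre) a b

theorem mk_zero : mk N (0 : A) = 0 := UniformSpace.Completion.coe_zero (α := N.Pre)

theorem mk_smul (c : ℂ) (a : A) : mk N (c • a) = c • mk N a :=
  UniformSpace.Completion.coe_smul (X := N.Pre) c a

theorem norm_mk (a : A) : ‖mk N a‖ = N a := UniformSpace.Completion.norm_coe (E := N.Pre) a

instance : Mul N.Completion :=
  ⟨fun x y => ((isDenseInducing_mk (N := N)).prodMap (isDenseInducing_mk (N := N))).extend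
    (fun p : N.Pre × N.Pre => mk N (p.1 * p.2)) (x, y)⟩

theorem mk_mul (a b : A) : mk N (a * b) = mk N a * mk N b :=
  (((isDenseInducing_mk (N := N)).prodMap (isDenseInducing_mk (N := N))).extend_eq
    (f := fun p : N.Pre × N.Pre => mk N (p.1 * p.2))
    (continuous_mk.comp continuous_mul) ((a, b) : N.Pre × N.Pre)).symm

instance : ContinuousMul N.Completion where
  continuous_mul := by
    let c : N.Pre →+ UniformSpace.Completion N.Pre := UniformSpace.Completion.toCompl
    let m : N.Pre →+ N.Pre →+ UniformSpace.Completion N.Pre :=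
      (AddMonoidHom.mul : N.Pre →+ N.Pre →+ N.Pre).compr₂ c
    have hm : Continuous fun p : N.Pre × N.Pre => m p.1 p.2 :=
      (UniformSpace.Completion.continuous_coe _).comp continuous_mul
    have di : IsDenseInducing (c : N.Pre → UniformSpace.Completion N.Pre) :=
      UniformSpace.Completion.isDenseInducing_coe
    exact di.extend_Z_bilin di hm

@[elab_as_elim]
theorem induction_on {p : N.Completion → Prop} (x : N.Completion) (hp : IsClosed {x | p x})
    (ih : ∀ a : A, p (mk N a)) : p x :=
  denseRange_mk.induction_on x hp ih

theorem mul_assoc_aux (x y z : N.Completion) : x * y * z = x * (y * z) := by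
  refine induction_on x (isClosed_eq ((continuous_id.mul continuous_const).mul continuous_const)
    (continuous_id.mul continuous_const)) fun a => ?_
  refine induction_on y (isClosed_eq ((continuous_const.mul continuous_id).mul continuous_const)
    (continuous_const.mul (continuous_id.mul continuous_const))) fun b => ?_
  refine induction_on z (isClosed_eq (continuous_const.mul continuous_id)
    (continuous_const.mul (continuous_const.mul continuous_id))) fun c => ?_
  rw [← mk_mul, ← mk_mul, ← mk_mul, ← mk_mul, mul_assoc]

theorem mul_add_aux (x y z : N.Completion) : x * (y + z) = x * y + x * z := by
  refine induction_on x (isClosed_eq (by fun_prop) (by fun_prop)) fun a => ?_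
  refine induction_on y (isClosed_eq (by fun_prop) (by fun_prop)) fun b => ?_
  refine induction_on z (isClosed_eq (by fun_prop) (by fun_prop)) fun c => ?_
  simp only [← mk_mul, ← mk_add, mul_add]

theorem add_mul_aux (x y z : N.Completion) : (x + y) * z = x * z + y * z := by
  refine induction_on x (isClosed_eq (by fun_prop) (by fun_prop)) fun a => ?_
  refine induction_on y (isClosed_eq (by fun_prop) (by fun_prop)) fun b => ?_
  refine induction_on z (isClosed_eq (by fun_prop) (by fun_prop)) fun c => ?_
  simp only [← mk_mul, ← mk_add, add_mul]

theorem zero_mul_aux (x : N.Completion) : 0 * x = 0 := by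
  refine induction_on x (isClosed_eq (by fun_prop) continuous_const) fun a => ?_
  rw [← mk_zero, ← mk_mul, zero_mul]

theorem mul_zero_aux (x : N.Completion) : x * 0 = 0 := by
  refine induction_on x (isClosed_eq (by fun_prop) continuous_const) fun a => ?_
  rw [← mk_zero, ← mk_mul, mul_zero]

theorem norm_mul_aux (x y : N.Completion) : ‖x * y‖ ≤ ‖x‖ * ‖y‖ := by
  refine induction_on x (isClosed_le (by fun_prop) (by fun_prop)) fun a => ?_
  refine induction_on y (isClosed_le (by fun_prop) (by fun_prop)) fun b => ?_
  simpa only [← mk_mul, norm_mk] using N.mul_le a b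

instance : NonUnitalRing N.Completion :=
  { (inferInstance : AddCommGroup N.Completion),
    (inferInstance : Mul N.Completion) with
    zero_mul := zero_mul_aux
    mul_zero := mul_zero_aux
    left_distrib := mul_add_aux
    right_distrib := add_mul_aux
    mul_assoc := mul_assoc_aux }

instance : NonUnitalNormedRing N.Completion :=
  { (inferInstance : NormedAddCommGroup N.Completion),
    (inferInstance : NonUnitalRing N.Completion) with
    norm_mul_le := norm_mul_aux }

instance : Star N.Completion :=
  ⟨fun x => UniformSpace.Completion.map (star : N.Pre → N.Pre) x⟩

theorem uniformContinuous_star_pre : UniformContinuous (star : N.Pre → N.Pre) :=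
  (AddMonoidHomClass.isometry_of_norm (starAddEquiv (R := N.Pre)) fun x => norm_star x).uniformContinuous

theorem mk_star (a : A) : mk N (star a) = star (mk N a) :=
  (UniformSpace.Completion.map_coe (uniformContinuous_star_pre (N := N)) a).symm

instance : ContinuousStar N.Completion where
  continuous_star := UniformSpace.Completion.continuous_map

instance : StarRing N.Completion where
  star_involutive x := by
    refine induction_on x (isClosed_eq (by fun_prop) (by fun_prop)) fun a => ?_
    rw [← mk_star, ← mk_star, star_star]
  star_mul x y := by
    refine induction_on x (isClosed_eq (by fun_prop) (by fun_prop)) fun a => ?_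
    refine induction_on y (isClosed_eq (by fun_prop) (by fun_prop)) fun b => ?_
    simp only [← mk_mul, ← mk_star, star_mul]
  star_add x y := by
    refine induction_on x (isClosed_eq (by fun_prop) (by fun_prop)) fun a => ?_
    refine induction_on y (isClosed_eq (by fun_prop) (by fun_prop)) fun b => ?_
    simp only [← mk_add, ← mk_star, star_add]

theorem smul_mul_aux (c : ℂ) (x y : N.Completion) : (c • x) * y = c • (x * y) := by
  refine induction_on x (isClosed_eq ((continuous_id.const_smul c).mul continuous_const)
    ((continuous_id.mul continuous_const).const_smul c)) fun a => ?_
  refine induction_on y (isClosed_eq (continuous_const.mul continuous_id)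
    ((continuous_const.mul continuous_id).const_smul c)) fun b => ?_
  rw [← mk_smul, ← mk_mul, ← mk_mul, ← mk_smul, smul_mul_assoc]

theorem mul_smul_aux (c : ℂ) (x y : N.Completion) : x * (c • y) = c • (x * y) := by
  refine induction_on x (isClosed_eq (continuous_id.mul continuous_const)
    ((continuous_id.mul continuous_const).const_smul c)) fun a => ?_
  refine induction_on y (isClosed_eq (continuous_const.mul (continuous_id.const_smul c))
    ((continuous_const.mul continuous_id).const_smul c)) fun b => ?_
  rw [← mk_smul, ← mk_mul, ← mk_mul, ← mk_smul, mul_smul_comm]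

theorem star_smul_aux (c : ℂ) (x : N.Completion) : star (c • x) = star c • star x := by
  refine induction_on x (isClosed_eq (continuous_id.const_smul c).star
    (continuous_id.star.const_smul (star c))) fun a => ?_
  rw [← mk_smul, ← mk_star, ← mk_star, ← mk_smul, star_smul]

theorem norm_star_mul_aux (x : N.Completion) : ‖x‖ * ‖x‖ ≤ ‖star x * x‖ := by
  refine induction_on x (isClosed_le (by fun_prop) (by fun_prop)) fun a => ?_
  simpa only [← mk_mul, ← mk_star, norm_mk] using (N.star_mul_self a).symm.le

instance : NonUnitalCStarAlgebra N.Completion :=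
  { (inferInstance : NonUnitalNormedRing N.Completion),
    (inferInstance : StarRing N.Completion),
    (inferInstance : NormedSpace ℂ N.Completion),
    (inferInstance : CompleteSpace N.Completion) with
    norm_mul_self_le := norm_star_mul_aux
    smul_assoc := smul_mul_aux
    smul_comm := fun c x y => (mul_smul_aux c x y).symm
    star_smul := star_smul_aux }

end Completion

/-- The canonical star-homomorphism from `A` to its completion in `N`; it has dense range. -/
def toCompletion : A →⋆ₙₐ[ℂ] N.Completion where
  toFun := Completion.mk N
  map_smul' := Completion.mk_smul
  map_zero' := Completion.mk_zero
  map_add' := Completion.mk_add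
  map_mul' := Completion.mk_mul
  map_star' := Completion.mk_star

open Classical in
/-- The pointwise supremum of a nonempty set of C⋆-seminorms that is pointwise bounded.
(By convention, the result is the zero seminorm if the set is empty or not pointwise bounded.) -/
def sup (𝒩 : Set (CStarSeminorm A)) : CStarSeminorm A :=
  if h : 𝒩.Nonempty ∧ ∀ a, BddAbove (range fun N : 𝒩 => N.1 a) then
    { toFun := fun a => ⨆ N : 𝒩, N.1 a
      map_zero' := by simp
      add_le' := fun a b => by
        have := h.1.to_subtype
        exact ciSup_le fun N => (map_add_le_add N.1.toSeminorm a b).trans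
          (add_le_add (le_ciSup (h.2 a) N) (le_ciSup (h.2 b) N))
      neg' := fun a => by simp
      smul' := fun c a => by
        simp only [map_smul_eq_mul]
        exact (Real.mul_iSup_of_nonneg (norm_nonneg c) _).symm
      mul_le' := fun a b => by
        have := h.1.to_subtype
        exact ciSup_le fun N => (N.1.mul_le a b).trans
          (mul_le_mul (le_ciSup (h.2 a) N) (le_ciSup (h.2 b) N)
            (apply_nonneg N.1.toSeminorm _)
            (Real.iSup_nonneg fun N => apply_nonneg N.1.toSeminorm _))
      star_mul_self' := fun a => by
        have := h.1.to_subtype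
        have h0 : 0 ≤ ⨆ N : 𝒩, N.1 a := Real.iSup_nonneg fun N => apply_nonneg N.1.toSeminorm _
        apply le_antisymm
        · refine ciSup_le fun N => ?_
          rw [N.1.star_mul_self]
          exact mul_le_mul (le_ciSup (h.2 a) N) (le_ciSup (h.2 a) N)
            (apply_nonneg N.1.toSeminorm _) h0
        · have h1 : ⨆ N : 𝒩, N.1 a ≤ Real.sqrt (⨆ N : 𝒩, N.1 (star a * a)) := by
            refine ciSup_le fun N => Real.le_sqrt_of_sq_le ?_
            rw [sq, ← N.1.star_mul_self]
            exact le_ciSup (h.2 (star a * a)) N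
          calc _ ≤ Real.sqrt (⨆ N : 𝒩, N.1 (star a * a)) * Real.sqrt _ :=
                mul_le_mul h1 h1 h0 (Real.sqrt_nonneg _)
            _ = _ := Real.mul_self_sqrt
                (Real.iSup_nonneg fun N => apply_nonneg N.1.toSeminorm _) }
  else 0

end CStarSeminorm

end CStarCompletion

/-! ## The free non-unital star-algebra -/

noncomputable section FreeStarAlgebra

/-- The free non-unital complex star-algebra on a type of generators: linear combinations of
nonempty words in letters `(x, true)`, standing for `x`, and `(x, false)`, standing for `x⋆`. -/
abbrev FreeStarAlgebra (Gen : Type*) : Type _ := MonoidAlgebra ℂ (FreeSemigroup (Gen × Bool))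

namespace FreeStarAlgebra

variable {Gen : Type*}

/-- Reverse a word and exchange each letter with its adjoint. -/
def rev : FreeSemigroup (Gen × Bool) →ₙ* (FreeSemigroup (Gen × Bool))ᵐᵒᵖ :=
  FreeSemigroup.lift fun x => MulOpposite.op (FreeSemigroup.of (x.1, !x.2))

theorem rev_rev (w : FreeSemigroup (Gen × Bool)) : (rev (rev w).unop).unop = w := by
  induction w using FreeSemigroup.recOnMul with
  | ih1 x => simp [rev]
  | ih2 x y hx hy => rw [map_mul, MulOpposite.unop_mul, map_mul, MulOpposite.unop_mul, hx, hy]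

/-- The conjugate-linear extension of `rev`. -/
def starHom : FreeStarAlgebra Gen →+ FreeStarAlgebra Gen where
  toFun f := f.coeff.sum fun w c => MonoidAlgebra.single (rev w).unop (conj c)
  map_zero' := by simp
  map_add' f g := by
    rw [MonoidAlgebra.coeff_add, Finsupp.sum_add_index'] <;> simp

theorem starHom_single (w : FreeSemigroup (Gen × Bool)) (c : ℂ) :
    starHom (MonoidAlgebra.single w c) = MonoidAlgebra.single (rev w).unop (conj c) := by
  exact Finsupp.sum_single_index
    (h := fun w c => MonoidAlgebra.single (rev w).unop (conj c)) (by simp)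

instance : StarRing (FreeStarAlgebra Gen) where
  star := starHom
  star_involutive f := by
    induction f using MonoidAlgebra.induction_linear with
    | zero => simp [map_zero]
    | add f g hf hg => rw [map_add, map_add, hf, hg]
    | single w c => rw [starHom_single, starHom_single, rev_rev, Complex.conj_conj]
  star_add f g := map_add starHom f g
  star_mul f g := by
    change starHom (f * g) = starHom g * starHom f
    induction f using MonoidAlgebra.induction_linear with
    | zero => simp [map_zero]
    | add f g hf hg => rw [add_mul, map_add, hf, hg, map_add, mul_add]
    | single w c =>
      induction g using MonoidAlgebra.induction_linear with
      | zero => simp [map_zero]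
      | add f g hf hg => rw [mul_add, map_add, hf, hg, map_add, add_mul]
      | single v d =>
        simp only [MonoidAlgebra.single_mul_single, starHom_single, map_mul,
          MulOpposite.unop_mul, mul_comm]

instance : StarModule ℂ (FreeStarAlgebra Gen) where
  star_smul c f := by
    change starHom (c • f) = conj c • starHom f
    induction f using MonoidAlgebra.induction_linear with
    | zero => simp [map_zero]
    | add f g hf hg => rw [smul_add, map_add, hf, hg, map_add, smul_add]
    | single w d => simp [MonoidAlgebra.smul_single, starHom_single]

/-- The generators of the free star-algebra. -/
def gen (x : Gen) : FreeStarAlgebra Gen := MonoidAlgebra.single (FreeSemigroup.of (x, true)) 1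

end FreeStarAlgebra

end FreeStarAlgebra

/-! ## Summation over the fibres of a local homeomorphism -/

section FibreSum

variable {Y Z : Type*} [TopologicalSpace Y] [TopologicalSpace Z] [T2Space Y] [T2Space Z]
  {q : Y → Z}

theorem IsLocalHomeomorph.finite_fibre_inter (hq : IsLocalHomeomorph q) {K : Set Y}
    (hK : IsCompact K) (z : Z) : (K ∩ q ⁻¹' {z}).Finite := by
  refine (hK.inter_right (isClosed_singleton.preimage hq.continuous)).finite ?_
  rw [isDiscrete_iff_forall_mem_exists_isOpen]
  rintro y ⟨hyK, hy⟩
  obtain ⟨U, hU, hyU, hinj⟩ := hq.isLocallyInjective y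
  refine ⟨U, hU, Subset.antisymm ?_ (singleton_subset_iff.2 ⟨hyU, hyK, hy⟩)⟩
  rintro y' ⟨hy'U, _, hy'⟩
  exact hinj hy'U hyU ((mem_singleton_iff.1 hy').trans (mem_singleton_iff.1 hy).symm)

theorem IsLocalHomeomorph.finite_support_fibre (hq : IsLocalHomeomorph q) {f : Y → ℂ}
    (hf : HasCompactSupport f) (z : Z) :
    (Function.support fun y : q ⁻¹' {z} => f y).Finite := by
  refine ((hq.finite_fibre_inter hf z).preimage Subtype.val_injective.injOn).subset ?_
  intro y hy
  exact ⟨subset_tsupport f hy, y.2⟩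

theorem IsLocalHomeomorph.summable_fibre (hq : IsLocalHomeomorph q) {f : Y → ℂ}
    (hf : HasCompactSupport f) (z : Z) : Summable fun y : q ⁻¹' {z} => f y :=
  summable_of_hasFiniteSupport (hq.finite_support_fibre hf z)

/-- The sum of a function over the fibres of a map. -/
noncomputable def fibreSum (q : Y → Z) (f : Y → ℂ) (z : Z) : ℂ := ∑' y : q ⁻¹' {z}, f y

theorem fibreSum_hasCompactSupport (hq : Continuous q) {f : Y → ℂ} (hf : HasCompactSupport f) :
    HasCompactSupport (fibreSum q f) := by
  refine HasCompactSupport.intro (hf.image hq) fun z hz => ?_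
  unfold fibreSum
  convert tsum_zero with y
  by_contra h
  exact hz ⟨y, subset_tsupport f h, y.2⟩

theorem fibreSum_continuous_of_chart (e : OpenPartialHomeomorph Y Z) (he : EqOn q e e.source)
    {f : Y → ℂ} (hfc : Continuous f) (hf : HasCompactSupport f) (hs : tsupport f ⊆ e.source) :
    Continuous (fibreSum q f) := by
  have hzero : ∀ y, y ∉ e.source → f y = 0 := fun y hy => by
    by_contra h
    exact hy (hs (subset_tsupport f h))
  have h1 : ∀ z ∈ e.target, fibreSum q f z = f (e.symm z) := by
    intro z hz
    have hmem : e.symm z ∈ q ⁻¹' {z} := by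
      simp [he (e.map_target hz), e.right_inv hz]
    unfold fibreSum
    rw [tsum_eq_single (⟨e.symm z, hmem⟩ : q ⁻¹' {z})]
    rintro ⟨y, hy⟩ hne
    by_contra h
    have hy' : y ∈ e.source := by
      by_contra h'
      exact h (hzero y h')
    refine hne (Subtype.ext ?_)
    have : e y = z := by rw [← he hy']; exact hy
    change y = e.symm z
    rw [← this, e.left_inv hy']
  have h2 : ∀ z ∉ e '' tsupport f, fibreSum q f z = 0 := by
    intro z hz
    unfold fibreSum
    convert tsum_zero with y
    by_contra h
    have hy := subset_tsupport f h
    refine hz ⟨y, hy, ?_⟩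
    rw [← he (hs hy)]
    exact y.2
  have hcl : IsClosed (e '' tsupport f) :=
    (hf.isCompact.image_of_continuousOn (e.continuousOn.mono hs)).isClosed
  rw [continuous_iff_continuousAt]
  intro z
  by_cases hz : z ∈ e.target
  · have : ContinuousAt (f ∘ e.symm) z :=
      hfc.continuousAt.comp (e.continuousAt_symm hz)
    refine this.congr ?_
    filter_upwards [e.open_target.mem_nhds hz] with w hw
    exact (h1 w hw).symm
  · have hz' : z ∈ (e '' tsupport f)ᶜ := by
      rintro ⟨y, hy, rfl⟩
      exact hz (e.map_source (hs hy))
    refine (continuousAt_const (y := (0 : ℂ))).congr ?_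
    filter_upwards [hcl.isOpen_compl.mem_nhds hz'] with w hw
    exact (h2 w hw).symm

theorem fibreSum_continuous [LocallyCompactSpace Y] (hq : IsLocalHomeomorph q) {f : Y → ℂ}
    (hfc : Continuous f) (hf : HasCompactSupport f) : Continuous (fibreSum q f) := by
  choose e he1 he2 using hq
  obtain ⟨t, ht⟩ := hf.isCompact.elim_finite_subcover (fun y => (e y).source)
    (fun y => (e y).open_source) (fun y _ => mem_iUnion.2 ⟨y, he1 y⟩)
  have ht' : tsupport f ⊆ ⋃ i : Fin t.card, (e (t.equivFin.symm i)).source := by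
    intro y hy
    obtain ⟨y', hy't, hy'⟩ := mem_iUnion₂.1 (ht hy)
    exact mem_iUnion.2 ⟨t.equivFin ⟨y', hy't⟩, by simpa using hy'⟩
  obtain ⟨φ, hφ1, hφ2, -, -⟩ := exists_continuous_sum_one_of_isOpen_isCompact
    (fun i : Fin t.card => (e (t.equivFin.symm i)).open_source) hf.isCompact ht'
  have hq : IsLocalHomeomorph q := fun y => ⟨e y, he1 y, he2 y⟩
  have hfi : ∀ i, HasCompactSupport fun y => (φ i y : ℂ) * f y := fun i => hf.mul_left
  have hsum : fibreSum q f = fun z => ∑ i, fibreSum q (fun y => (φ i y : ℂ) * f y) z := by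
    funext z
    unfold fibreSum
    rw [← Summable.tsum_finsetSum fun i _ => hq.summable_fibre (hfi i) z]
    refine tsum_congr fun y => ?_
    by_cases hy : f y = 0
    · simp [hy]
    · have := hφ2 (subset_tsupport f hy)
      rw [← Finset.sum_mul, ← Complex.ofReal_sum]
      have h1 : ∑ i, φ i (y : Y) = 1 := by simpa using this
      rw [h1]; simp
  rw [hsum]
  refine continuous_finsetSum _ fun i _ => ?_
  refine fibreSum_continuous_of_chart (e (t.equivFin.symm i)) ?_ ?_ (hfi i) ?_
  · rw [he2]; exact fun _ _ => rfl
  · exact (Complex.continuous_ofReal.comp (φ i).continuous).mul hfc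
  · refine Subset.trans ?_ (hφ1 i)
    refine closure_mono fun y hy => ?_
    simp only [Function.mem_support, ne_eq, mul_eq_zero, not_or] at hy ⊢
    exact_mod_cast hy.1

end FibreSum

/-! ## Étale groupoids and their C⋆-algebras -/

noncomputable section Groupoid

theorem finite_sigma_of_finite {ι : Type*} {α : ι → Type*} {S : Set ι} (hS : S.Finite)
    {T : ∀ i, Set (α i)} (hT : ∀ i, (T i).Finite) :
    {x : Σ i, α i | x.1 ∈ S ∧ x.2 ∈ T x.1}.Finite := by
  refine (hS.biUnion fun i _ => (hT i).image (Sigma.mk i)).subset ?_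
  rintro ⟨i, a⟩ ⟨hi, ha⟩
  exact mem_biUnion hi ⟨a, ha, rfl⟩

section LocalHomeomorph

theorem isLocalHomeomorph_of_isOpenMap {Y Z : Type*} [TopologicalSpace Y] [TopologicalSpace Z]
    {q : Y → Z} (hc : Continuous q) (ho : IsOpenMap q) (hi : IsLocallyInjective q) :
    IsLocalHomeomorph q := by
  rw [isLocalHomeomorph_iff_isOpenEmbedding_restrict]
  intro y
  obtain ⟨U, hU, hyU, hinj⟩ := hi y
  refine ⟨U, hU.mem_nhds hyU, ?_⟩
  exact IsOpenEmbedding.of_continuous_injective_isOpenMap (hc.comp continuous_subtype_val)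
    (injOn_iff_injective.1 hinj) (ho.domRestrict hU)

/-- The fibre product of two maps, as a subspace of the product. -/
abbrev FibreProd {Y W Z : Type*} (q : Y → Z) (f : W → Z) : Type _ :=
  {p : Y × W // q p.1 = f p.2}

theorem IsLocalHomeomorph.snd_fibreProd {Y W Z : Type*} [TopologicalSpace Y] [TopologicalSpace Z]
    [TopologicalSpace W] {q : Y → Z} (hq : IsLocalHomeomorph q) {f : W → Z} (hf : Continuous f) :
    IsLocalHomeomorph fun p : FibreProd q f => p.1.2 := by
  refine isLocalHomeomorph_of_isOpenMap (continuous_snd.comp continuous_subtype_val) ?_ ?_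
  · intro S hS
    obtain ⟨T, hT, rfl⟩ := isOpen_induced_iff.1 hS
    rw [isOpen_iff_mem_nhds]
    rintro _ ⟨⟨⟨y, w⟩, hyw⟩, hp, rfl⟩
    obtain ⟨U, V, hU, hV, hyU, hwV, hUV⟩ := isOpen_prod_iff.1 hT y w hp
    have h1 : f ⁻¹' (q '' U) ∈ 𝓝 w :=
      hf.continuousAt ((hq.isOpenMap U hU).mem_nhds ⟨y, hyU, hyw⟩)
    filter_upwards [h1, hV.mem_nhds hwV] with w' hw1 hw2
    obtain ⟨y', hy', hq'⟩ := hw1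
    exact ⟨⟨(y', w'), hq'⟩, hUV ⟨hy', hw2⟩, rfl⟩
  · rintro ⟨⟨y, w⟩, hyw⟩
    obtain ⟨U, hU, hyU, hinj⟩ := hq.isLocallyInjective y
    refine ⟨(fun p : FibreProd q f => p.1.1) ⁻¹' U,
      hU.preimage (continuous_fst.comp continuous_subtype_val), hyU, ?_⟩
    rintro ⟨⟨y1, w1⟩, h1⟩ hp1 ⟨⟨y2, w2⟩, h2⟩ hp2 (rfl : w1 = w2)
    have : y1 = y2 := hinj hp1 hp2 (h1.trans h2.symm)
    subst this
    rfl

end LocalHomeomorph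

universe u v

/-- An étale, locally compact, Hausdorff groupoid: a small category with inverses with
topologies on its spaces of objects and arrows for which all structure maps are continuous and
the range map is a local homeomorphism.  The product `mul g h` is defined if the source of `g`
is the range of `h`. -/
structure EtaleGroupoid where
  Obj : Type u
  Arr : Type v
  [topObj : TopologicalSpace Obj]
  [topArr : TopologicalSpace Arr]
  [t2Obj : T2Space Obj]
  [t2Arr : T2Space Arr]
  [lcObj : LocallyCompactSpace Obj]
  [lcArr : LocallyCompactSpace Arr]
  r : Arr → Obj
  s : Arr → Obj
  one : Obj → Arr
  inv : Arr → Arr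
  mul : ∀ g h : Arr, s g = r h → Arr
  r_one : ∀ x, r (one x) = x
  s_one : ∀ x, s (one x) = x
  r_inv : ∀ g, r (inv g) = s g
  s_inv : ∀ g, s (inv g) = r g
  r_mul : ∀ g h e, r (mul g h e) = r g
  s_mul : ∀ g h e, s (mul g h e) = s h
  one_mul : ∀ g, mul (one (r g)) g (s_one _) = g
  mul_one : ∀ g, mul g (one (s g)) (r_one _).symm = g
  inv_mul : ∀ g, mul (inv g) g (s_inv g) = one (s g)
  mul_inv : ∀ g, mul g (inv g) (r_inv g).symm = one (r g)
  mul_assoc : ∀ (g h k : Arr) (e₁ : s g = r h) (e₂ : s h = r k),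
    mul (mul g h e₁) k ((s_mul g h e₁).trans e₂) = mul g (mul h k e₂) (e₁.trans (r_mul h k e₂).symm)
  continuous_s : Continuous s
  continuous_one : Continuous one
  continuous_inv : Continuous inv
  continuous_mul : Continuous fun p : FibreProd s r => mul p.1.1 p.1.2 p.2
  isLocalHomeomorph_r : IsLocalHomeomorph r

attribute [instance] EtaleGroupoid.topObj EtaleGroupoid.topArr EtaleGroupoid.t2Obj
  EtaleGroupoid.t2Arr EtaleGroupoid.lcObj EtaleGroupoid.lcArr

namespace EtaleGroupoid

variable (G : EtaleGroupoid.{u, v})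

/-- The space of composable pairs of arrows. -/
abbrev Comp : Type v := FibreProd G.s G.r

/-- The multiplication map on the space of composable pairs. -/
def comp (p : G.Comp) : G.Arr := G.mul p.1.1 p.1.2 p.2

variable {G}

theorem mul_congr {g g' h h' : G.Arr} (hg : g = g') (hh : h = h') (e : G.s g = G.r h)
    (e' : G.s g' = G.r h') : G.mul g h e = G.mul g' h' e' := by
  subst hg hh; rfl

theorem inv_mul_cancel_left (g h : G.Arr) (e : G.s g = G.r h) (e') :
    G.mul (G.inv g) (G.mul g h e) e' = h := by
  rw [← G.mul_assoc (G.inv g) g h (G.s_inv g) e]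
  rw [mul_congr ((G.inv_mul g).trans (congrArg G.one e)) rfl _ (G.s_one _), G.one_mul]

theorem mul_inv_cancel_left (g h : G.Arr) (e : G.r g = G.r h) (e') (e'') :
    G.mul g (G.mul (G.inv g) h e') e'' = h := by
  rw [← G.mul_assoc g (G.inv g) h (G.r_inv g).symm e']
  rw [mul_congr ((G.mul_inv g).trans (congrArg G.one e)) rfl _ (G.s_one _), G.one_mul]

theorem mul_inv_cancel_right (g h : G.Arr) (e : G.s g = G.r h) (e') :
    G.mul (G.mul g h e) (G.inv h) e' = g := by
  rw [G.mul_assoc g h (G.inv h) e (G.r_inv h).symm]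
  rw [mul_congr rfl ((G.mul_inv h).trans (congrArg G.one e.symm)) _ (G.r_one _).symm, G.mul_one]

theorem mul_right_cancel {g g' h : G.Arr} (e : G.s g = G.r h) (e' : G.s g' = G.r h)
    (H : G.mul g h e = G.mul g' h e') : g = g' := by
  have h1 := mul_inv_cancel_right g h e ((G.s_mul _ _ _).trans (G.r_inv h).symm)
  have h2 := mul_inv_cancel_right g' h e' ((G.s_mul _ _ _).trans (G.r_inv h).symm)
  rw [← h1, ← h2]
  exact mul_congr H rfl _ _

theorem mul_left_cancel {g h h' : G.Arr} (e : G.s g = G.r h) (e' : G.s g = G.r h')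
    (H : G.mul g h e = G.mul g h' e') : h = h' := by
  have h1 := inv_mul_cancel_left g h e ((G.s_inv g).trans (G.r_mul _ _ _).symm)
  have h2 := inv_mul_cancel_left g h' e' ((G.s_inv g).trans (G.r_mul _ _ _).symm)
  rw [← h1, ← h2]
  exact mul_congr rfl H _ _

theorem inv_inv (g : G.Arr) : G.inv (G.inv g) = g := by
  refine mul_right_cancel (h := G.inv g) (G.s_inv _) (G.r_inv g).symm ?_
  rw [G.inv_mul, G.mul_inv, G.s_inv]

theorem mul_inv_rev (g h : G.Arr) (e : G.s g = G.r h) :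
    G.inv (G.mul g h e) =
      G.mul (G.inv h) (G.inv g) ((G.s_inv h).trans (e.symm.trans (G.r_inv g).symm)) := by
  refine mul_right_cancel (h := G.mul g h e) (G.s_inv _)
    ((G.s_mul _ _ _).trans ((G.s_inv g).trans (G.r_mul _ _ _).symm)) ?_
  rw [G.inv_mul, G.mul_assoc _ _ _ _ ((G.s_inv g).trans (G.r_mul _ _ _).symm)]
  rw [mul_congr rfl (inv_mul_cancel_left g h e _) _ (G.s_inv h), G.inv_mul, G.s_mul]

theorem continuous_r : Continuous G.r := G.isLocalHomeomorph_r.continuous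

theorem continuous_comp : Continuous G.comp := G.continuous_mul

/-- The inversion homeomorphism. -/
def invHomeo : G.Arr ≃ₜ G.Arr where
  toFun := G.inv
  invFun := G.inv
  left_inv := inv_inv
  right_inv := inv_inv
  continuous_toFun := G.continuous_inv
  continuous_invFun := G.continuous_inv

theorem isLocalHomeomorph_s : IsLocalHomeomorph G.s := by
  have : G.s = G.r ∘ invHomeo := funext fun g => (G.r_inv g).symm
  rw [this]
  exact G.isLocalHomeomorph_r.comp invHomeo.isLocalHomeomorph

/-- Composable pairs correspond to pairs of arrows with the same range. -/
def compHomeo : G.Comp ≃ₜ FibreProd G.r G.r where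
  toFun p := ⟨(p.1.1, G.comp p), (G.r_mul _ _ _).symm⟩
  invFun p := ⟨(p.1.1, G.mul (G.inv p.1.1) p.1.2 ((G.s_inv _).trans p.2)),
    ((G.r_mul _ _ _).trans (G.r_inv _)).symm⟩
  left_inv := by
    rintro ⟨⟨g, h⟩, e⟩
    refine Subtype.ext (Prod.ext rfl ?_)
    exact inv_mul_cancel_left g h e _
  right_inv := by
    rintro ⟨⟨g, h⟩, e⟩
    refine Subtype.ext (Prod.ext rfl ?_)
    exact mul_inv_cancel_left g h e _ _
  continuous_toFun :=
    ((continuous_fst.comp continuous_subtype_val).prodMk continuous_comp).subtype_mk _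
  continuous_invFun := by
    refine ((continuous_fst.comp continuous_subtype_val).prodMk ?_).subtype_mk _
    have : Continuous fun p : FibreProd G.r G.r =>
        (⟨(G.inv p.1.1, p.1.2), (G.s_inv _).trans p.2⟩ : G.Comp) :=
      ((G.continuous_inv.comp (continuous_fst.comp continuous_subtype_val)).prodMk
        (continuous_snd.comp continuous_subtype_val)).subtype_mk _
    exact continuous_comp.comp this

theorem isLocalHomeomorph_comp : IsLocalHomeomorph G.comp :=
  (G.isLocalHomeomorph_r.snd_fibreProd continuous_r).comp compHomeo.isLocalHomeomorph

theorem isClosed_comp : IsClosed {p : G.Arr × G.Arr | G.s p.1 = G.r p.2} :=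
  isClosed_eq (G.continuous_s.comp continuous_fst) (continuous_r.comp continuous_snd)

instance : LocallyCompactSpace G.Comp := isClosed_comp.isClosedEmbedding_subtypeVal.locallyCompactSpace

/-- The function `(g, h) ↦ f₁ g * f₂ h` on composable pairs. -/
def tensor (f₁ f₂ : G.Arr → ℂ) (p : G.Comp) : ℂ := f₁ p.1.1 * f₂ p.1.2

theorem tensor_continuous {f₁ f₂ : G.Arr → ℂ} (h₁ : Continuous f₁) (h₂ : Continuous f₂) :
    Continuous (tensor f₁ f₂) :=
  (h₁.comp (continuous_fst.comp continuous_subtype_val)).mul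
    (h₂.comp (continuous_snd.comp continuous_subtype_val))

theorem tensor_hasCompactSupport {f₁ f₂ : G.Arr → ℂ} (h₁ : HasCompactSupport f₁)
    (h₂ : HasCompactSupport f₂) : HasCompactSupport (tensor f₁ f₂) := by
  refine HasCompactSupport.intro
    (isClosed_comp.isClosedEmbedding_subtypeVal.isCompact_preimage (h₁.isCompact.prod h₂)) ?_
  intro p hp
  by_contra h
  refine hp ⟨subset_tsupport _ ?_, subset_tsupport _ ?_⟩
  · exact left_ne_zero_of_mul h
  · exact right_ne_zero_of_mul h

variable (G)

/-- The space of compactly supported continuous functions on the space of arrows; it is a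
star-algebra under convolution. -/
structure ConvAlg where
  toFun : C_c(G.Arr, ℂ)

variable {G}

namespace ConvAlg

instance : CoeFun G.ConvAlg (fun _ => G.Arr → ℂ) := ⟨fun f => f.toFun⟩

@[ext]
theorem ext {f g : G.ConvAlg} (h : ∀ x, f x = g x) : f = g := by
  cases f; cases g
  congr 1
  exact CompactlySupportedContinuousMap.ext h

theorem toFun_injective : Function.Injective (ConvAlg.toFun : G.ConvAlg → C_c(G.Arr, ℂ)) := by
  rintro ⟨f⟩ ⟨g⟩ h
  exact congrArg _ h

theorem continuous (f : G.ConvAlg) : Continuous (f : G.Arr → ℂ) := f.toFun.continuous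

theorem hasCompactSupport (f : G.ConvAlg) : HasCompactSupport (f : G.Arr → ℂ) :=
  f.toFun.hasCompactSupport

instance : Zero G.ConvAlg := ⟨⟨0⟩⟩
instance : Add G.ConvAlg := ⟨fun f g => ⟨f.toFun + g.toFun⟩⟩
instance : Neg G.ConvAlg := ⟨fun f => ⟨-f.toFun⟩⟩
instance : Sub G.ConvAlg := ⟨fun f g => ⟨f.toFun - g.toFun⟩⟩
instance {R : Type*} [SMulZeroClass R ℂ] [ContinuousConstSMul R ℂ] : SMul R G.ConvAlg :=
  ⟨fun c f => ⟨c • f.toFun⟩⟩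

instance : AddCommGroup G.ConvAlg :=
  toFun_injective.addCommGroup _ rfl (fun _ _ => rfl) (fun _ => rfl) (fun _ _ => rfl)
    (fun _ _ => rfl) (fun _ _ => rfl)

instance : Module ℂ G.ConvAlg :=
  toFun_injective.module ℂ ⟨⟨ConvAlg.toFun, rfl⟩, fun _ _ => rfl⟩ (fun _ _ => rfl)

@[simp] theorem zero_apply (x : G.Arr) : (0 : G.ConvAlg) x = 0 := rfl
@[simp] theorem add_apply (f g : G.ConvAlg) (x : G.Arr) : (f + g) x = f x + g x := rfl
@[simp] theorem smul_apply (c : ℂ) (f : G.ConvAlg) (x : G.Arr) : (c • f) x = c * f x := rfl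

/-- The convolution `(f₁ * f₂)(g) = ∑_{g₁ g₂ = g} f₁(g₁) f₂(g₂)`. -/
instance : Mul G.ConvAlg :=
  ⟨fun f₁ f₂ => ⟨⟨⟨fibreSum G.comp (tensor f₁ f₂),
      fibreSum_continuous isLocalHomeomorph_comp (tensor_continuous f₁.continuous f₂.continuous)
        (tensor_hasCompactSupport f₁.hasCompactSupport f₂.hasCompactSupport)⟩,
      fibreSum_hasCompactSupport continuous_comp
        (tensor_hasCompactSupport f₁.hasCompactSupport f₂.hasCompactSupport)⟩⟩⟩

theorem mul_apply (f₁ f₂ : G.ConvAlg) (g : G.Arr) :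
    (f₁ * f₂) g = ∑' p : G.comp ⁻¹' {g}, f₁ p.1.1.1 * f₂ p.1.1.2 := rfl

/-- The involution `f⋆(g) = conj f(g⁻¹)`. -/
instance : Star G.ConvAlg :=
  ⟨fun f => ⟨⟨⟨fun g => conj (f (G.inv g)),
      Complex.continuous_conj.comp (f.continuous.comp G.continuous_inv)⟩,
      (f.hasCompactSupport.comp_homeomorph invHomeo).comp_left (g := conj) (map_zero _)⟩⟩⟩

@[simp] theorem star_apply (f : G.ConvAlg) (g : G.Arr) : (star f) g = conj (f (G.inv g)) := rfl

theorem summable_tensor (f₁ f₂ : G.ConvAlg) (g : G.Arr) :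
    Summable fun p : G.comp ⁻¹' {g} => f₁ p.1.1.1 * f₂ p.1.1.2 :=
  isLocalHomeomorph_comp.summable_fibre
    (tensor_hasCompactSupport f₁.hasCompactSupport f₂.hasCompactSupport) g

theorem add_mul' (f₁ f₂ f₃ : G.ConvAlg) : (f₁ + f₂) * f₃ = f₁ * f₃ + f₂ * f₃ := by
  ext g
  simp only [add_apply, mul_apply, add_mul]
  exact (summable_tensor f₁ f₃ g).tsum_add (summable_tensor f₂ f₃ g)

theorem mul_add' (f₁ f₂ f₃ : G.ConvAlg) : f₁ * (f₂ + f₃) = f₁ * f₂ + f₁ * f₃ := by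
  ext g
  simp only [add_apply, mul_apply, mul_add]
  exact (summable_tensor f₁ f₂ g).tsum_add (summable_tensor f₁ f₃ g)

theorem smul_mul' (c : ℂ) (f₁ f₂ : G.ConvAlg) : (c • f₁) * f₂ = c • (f₁ * f₂) := by
  ext g
  simp only [smul_apply, mul_apply, _root_.mul_assoc]
  exact tsum_mul_left

theorem mul_smul' (c : ℂ) (f₁ f₂ : G.ConvAlg) : f₁ * (c • f₂) = c • (f₁ * f₂) := by
  ext g
  simp only [smul_apply, mul_apply, mul_left_comm _ c]
  exact tsum_mul_left

theorem star_mul' (f₁ f₂ : G.ConvAlg) : star (f₁ * f₂) = star f₂ * star f₁ := by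
  ext g
  simp only [star_apply, mul_apply]
  rw [Complex.conj_tsum]
  let e : G.comp ⁻¹' {G.inv g} ≃ G.comp ⁻¹' {g} :=
    { toFun := fun p => ⟨⟨(G.inv p.1.1.2, G.inv p.1.1.1),
        (G.s_inv _).trans (p.1.2.symm.trans (G.r_inv _).symm)⟩, by
          have h : G.mul p.1.1.1 p.1.1.2 p.1.2 = G.inv g := p.2
          change G.mul _ _ _ = g
          rw [← mul_inv_rev _ _ p.1.2, h, inv_inv]⟩
      invFun := fun p => ⟨⟨(G.inv p.1.1.2, G.inv p.1.1.1),
        (G.s_inv _).trans (p.1.2.symm.trans (G.r_inv _).symm)⟩, by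
          have h : G.mul p.1.1.1 p.1.1.2 p.1.2 = g := p.2
          change G.mul _ _ _ = G.inv g
          rw [← mul_inv_rev _ _ p.1.2, h]⟩
      left_inv := fun p => Subtype.ext (Subtype.ext (Prod.ext (inv_inv _) (inv_inv _)))
      right_inv := fun p => Subtype.ext (Subtype.ext (Prod.ext (inv_inv _) (inv_inv _))) }
  rw [← e.tsum_eq]
  refine tsum_congr fun p => ?_
  simp [e, inv_inv, mul_comm]

theorem finite_fibre_right (f : G.ConvAlg) (g : G.Arr) :
    {p : G.comp ⁻¹' {g} | f p.1.1.2 ≠ 0}.Finite := by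
  have h := (G.isLocalHomeomorph_s).finite_fibre_inter f.hasCompactSupport.isCompact (G.s g)
  refine Set.Finite.of_finite_image (f := fun p : G.comp ⁻¹' {g} => p.1.1.2) (h.subset ?_) ?_
  · rintro _ ⟨p, hp, rfl⟩
    refine ⟨subset_tsupport _ hp, ?_⟩
    have h2 : G.mul p.1.1.1 p.1.1.2 p.1.2 = g := p.2
    exact (G.s_mul _ _ _).symm.trans (congrArg G.s h2)
  · rintro ⟨⟨⟨a, b⟩, e⟩, h⟩ - ⟨⟨⟨a', b'⟩, e'⟩, h'⟩ - (hb : b = b')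
    subst hb
    have : a = a' := mul_right_cancel e e' (Eq.trans (b := g) h (Eq.symm h'))
    subst this
    rfl

theorem finite_fibre_left (f : G.ConvAlg) (g : G.Arr) :
    {p : G.comp ⁻¹' {g} | f p.1.1.1 ≠ 0}.Finite := by
  have h := (G.isLocalHomeomorph_r).finite_fibre_inter f.hasCompactSupport.isCompact (G.r g)
  refine Set.Finite.of_finite_image (f := fun p : G.comp ⁻¹' {g} => p.1.1.1) (h.subset ?_) ?_
  · rintro _ ⟨p, hp, rfl⟩
    refine ⟨subset_tsupport _ hp, ?_⟩
    have h2 : G.mul p.1.1.1 p.1.1.2 p.1.2 = g := p.2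
    exact (G.r_mul _ _ _).symm.trans (congrArg G.r h2)
  · rintro ⟨⟨⟨a, b⟩, e⟩, h⟩ - ⟨⟨⟨a', b'⟩, e'⟩, h'⟩ - (hb : a = a')
    subst hb
    have : b = b' := mul_left_cancel e e' (Eq.trans (b := g) h (Eq.symm h'))
    subst this
    rfl

/-- The two ways of describing factorisations of an arrow into three factors. -/
def tripleEquiv (g : G.Arr) :
    (Σ p : G.comp ⁻¹' {g}, G.comp ⁻¹' {p.1.1.1}) ≃ (Σ p : G.comp ⁻¹' {g}, G.comp ⁻¹' {p.1.1.2}) where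
  toFun x :=
    have h1 : G.mul x.2.1.1.1 x.2.1.1.2 x.2.1.2 = x.1.1.1.1 := x.2.2
    have h2 : G.mul x.1.1.1.1 x.1.1.1.2 x.1.1.2 = g := x.1.2
    have e2 : G.s x.2.1.1.2 = G.r x.1.1.1.2 := ((G.s_mul _ _ _).symm.trans (congrArg G.s h1)).trans x.1.1.2
    ⟨⟨⟨(x.2.1.1.1, G.mul x.2.1.1.2 x.1.1.1.2 e2), x.2.1.2.trans (G.r_mul _ _ _).symm⟩, ((G.mul_assoc _ _ _ x.2.1.2 e2).symm.trans (mul_congr h1 rfl _ x.1.1.2)).trans h2⟩,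
      ⟨⟨(x.2.1.1.2, x.1.1.1.2), e2⟩, rfl⟩⟩
  invFun x :=
    have h1 : G.mul x.2.1.1.1 x.2.1.1.2 x.2.1.2 = x.1.1.1.2 := x.2.2
    have h2 : G.mul x.1.1.1.1 x.1.1.1.2 x.1.1.2 = g := x.1.2
    have e2 : G.s x.1.1.1.1 = G.r x.2.1.1.1 := x.1.1.2.trans ((congrArg G.r h1).symm.trans (G.r_mul _ _ _))
    ⟨⟨⟨(G.mul x.1.1.1.1 x.2.1.1.1 e2, x.2.1.1.2), (G.s_mul _ _ _).trans x.2.1.2⟩, ((G.mul_assoc _ _ _ e2 x.2.1.2).trans (mul_congr rfl h1 _ x.1.1.2)).trans h2⟩,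
      ⟨⟨(x.1.1.1.1, x.2.1.1.1), e2⟩, rfl⟩⟩
  left_inv := by
    rintro ⟨⟨⟨⟨a, b⟩, e⟩, h⟩, ⟨⟨⟨c, d⟩, e'⟩, h'⟩⟩
    obtain rfl : G.mul c d e' = a := h'
    rfl
  right_inv := by
    rintro ⟨⟨⟨⟨a, b⟩, e⟩, h⟩, ⟨⟨⟨c, d⟩, e'⟩, h'⟩⟩
    obtain rfl : G.mul c d e' = b := h'
    rfl

theorem mul_mul_left (f₁ f₂ f₃ : G.ConvAlg) (g : G.Arr) :
    (f₁ * f₂ * f₃) g = ∑' x : Σ p : G.comp ⁻¹' {g}, G.comp ⁻¹' {p.1.1.1},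
      f₁ x.2.1.1.1 * f₂ x.2.1.1.2 * f₃ x.1.1.1.2 := by
  have hfin : ∀ p : G.comp ⁻¹' {g}, Summable fun y : G.comp ⁻¹' {p.1.1.1} =>
      f₁ y.1.1.1 * f₂ y.1.1.2 * f₃ p.1.1.2 :=
    fun p => (summable_tensor f₁ f₂ _).mul_right _
  have hsum : Summable fun x : Σ p : G.comp ⁻¹' {g}, G.comp ⁻¹' {p.1.1.1} =>
      f₁ x.2.1.1.1 * f₂ x.2.1.1.2 * f₃ x.1.1.1.2 := by
    refine summable_of_hasFiniteSupport (Set.Finite.subset (finite_sigma_of_finite (finite_fibre_right f₃ g) fun p =>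
        isLocalHomeomorph_comp.finite_support_fibre
          (tensor_hasCompactSupport f₁.hasCompactSupport f₂.hasCompactSupport) p.1.1.1) ?_)
    intro x hx
    exact ⟨right_ne_zero_of_mul hx, left_ne_zero_of_mul hx⟩
  refine Eq.trans ?_ (hsum.tsum_sigma' hfin).symm
  refine (mul_apply _ _ g).trans (tsum_congr fun p => ?_)
  exact (congrArg (· * f₃ p.1.1.2) (mul_apply f₁ f₂ p.1.1.1)).trans tsum_mul_right.symm

theorem mul_mul_right (f₁ f₂ f₃ : G.ConvAlg) (g : G.Arr) :
    (f₁ * (f₂ * f₃)) g = ∑' x : Σ p : G.comp ⁻¹' {g}, G.comp ⁻¹' {p.1.1.2},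
      f₁ x.1.1.1.1 * (f₂ x.2.1.1.1 * f₃ x.2.1.1.2) := by
  have hfin : ∀ p : G.comp ⁻¹' {g}, Summable fun y : G.comp ⁻¹' {p.1.1.2} =>
      f₁ p.1.1.1 * (f₂ y.1.1.1 * f₃ y.1.1.2) :=
    fun p => (summable_tensor f₂ f₃ _).mul_left _
  have hsum : Summable fun x : Σ p : G.comp ⁻¹' {g}, G.comp ⁻¹' {p.1.1.2} =>
      f₁ x.1.1.1.1 * (f₂ x.2.1.1.1 * f₃ x.2.1.1.2) := by
    refine summable_of_hasFiniteSupport (Set.Finite.subset (finite_sigma_of_finite (finite_fibre_left f₁ g) fun p =>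
        isLocalHomeomorph_comp.finite_support_fibre
          (tensor_hasCompactSupport f₂.hasCompactSupport f₃.hasCompactSupport) p.1.1.2) ?_)
    intro x hx
    exact ⟨left_ne_zero_of_mul hx, right_ne_zero_of_mul hx⟩
  refine Eq.trans ?_ (hsum.tsum_sigma' hfin).symm
  refine (mul_apply _ _ g).trans (tsum_congr fun p => ?_)
  exact (congrArg (f₁ p.1.1.1 * ·) (mul_apply f₂ f₃ p.1.1.2)).trans tsum_mul_left.symm

theorem mul_assoc' (f₁ f₂ f₃ : G.ConvAlg) : f₁ * f₂ * f₃ = f₁ * (f₂ * f₃) := by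
  ext g
  rw [mul_mul_left, mul_mul_right, ← (tripleEquiv g).tsum_eq]
  exact tsum_congr fun x => _root_.mul_assoc _ _ _

instance : NonUnitalRing G.ConvAlg where
  left_distrib := mul_add'
  right_distrib := add_mul'
  zero_mul f := by ext g; simp [mul_apply]
  mul_zero f := by ext g; simp [mul_apply]
  mul_assoc := mul_assoc'

instance : StarRing G.ConvAlg where
  star_involutive f := by ext g; simp [inv_inv]
  star_mul := star_mul'
  star_add f g := ConvAlg.ext fun x => map_add (starRingEnd ℂ) (f (G.inv x)) (g (G.inv x))

instance : IsScalarTower ℂ G.ConvAlg G.ConvAlg := ⟨smul_mul'⟩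
instance : SMulCommClass ℂ G.ConvAlg G.ConvAlg := ⟨fun c f g => (mul_smul' c f g).symm⟩
instance : StarModule ℂ G.ConvAlg := ⟨fun c f => by ext x; simp⟩

end ConvAlg

variable (G)

/-- The (full) groupoid C⋆-algebra: the completion of the star-algebra of compactly supported
continuous functions on the space of arrows in the largest C⋆-seminorm. -/
abbrev CStar : Type v := (CStarSeminorm.sup (univ : Set (CStarSeminorm G.ConvAlg))).Completion

/-- The canonical map from the convolution algebra to the groupoid C⋆-algebra. -/
def toCStar : G.ConvAlg →⋆ₙₐ[ℂ] G.CStar :=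
  (CStarSeminorm.sup (univ : Set (CStarSeminorm G.ConvAlg))).toCompletion

end EtaleGroupoid

end Groupoid

/-! ## Right Ore monoids and their groups of fractions -/

noncomputable section OreMonoid

/-- The right Ore conditions for a monoid. -/
class RightOre (P : Type*) [Monoid P] : Prop where
  exists_mul_eq_mul : ∀ x₁ x₂ : P, ∃ y₁ y₂ : P, x₁ * y₁ = x₂ * y₂
  exists_mul_eq_mul_of_mul_eq_mul : ∀ x y₁ y₂ : P, x * y₁ = x * y₂ → ∃ z : P, y₁ * z = y₂ * z

variable (P : Type*) [Monoid P] [RightOre P]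

/-- The opposite of a right Ore monoid satisfies the left Ore conditions. -/
instance RightOre.oreSet : OreLocalization.OreSet (⊤ : Submonoid Pᵐᵒᵖ) where
  ore_right_cancel := by
    rintro r₁ r₂ ⟨s, _⟩ h
    obtain ⟨z, hz⟩ := RightOre.exists_mul_eq_mul_of_mul_eq_mul s.unop r₁.unop r₂.unop
      (congrArg MulOpposite.unop h)
    exact ⟨⟨MulOpposite.op z, trivial⟩, MulOpposite.unop_injective hz⟩
  oreNum r s := MulOpposite.op
    (RightOre.exists_mul_eq_mul r.unop s.1.unop).choose_spec.choose
  oreDenom r s := ⟨MulOpposite.op (RightOre.exists_mul_eq_mul r.unop s.1.unop).choose, trivial⟩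
  ore_eq r s := MulOpposite.unop_injective
    (RightOre.exists_mul_eq_mul r.unop s.1.unop).choose_spec.choose_spec

/-- The group of fractions of a right Ore monoid: it consists of the formal fractions
`p q⁻¹`. -/
def FracGroup : Type _ := (OreLocalization (⊤ : Submonoid Pᵐᵒᵖ) Pᵐᵒᵖ)ᵐᵒᵖ

namespace FracGroup

instance : Monoid (FracGroup P) :=
  inferInstanceAs (Monoid (OreLocalization (⊤ : Submonoid Pᵐᵒᵖ) Pᵐᵒᵖ)ᵐᵒᵖ)

variable {P}

/-- The canonical homomorphism to the group of fractions. -/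
def ι : P →* FracGroup P where
  toFun p := MulOpposite.op (OreLocalization.numeratorHom (MulOpposite.op p))
  map_one' := by
    rw [MulOpposite.op_one, map_one]
    rfl
  map_mul' p q := by
    rw [MulOpposite.op_mul, map_mul]
    rfl

/-- The formal fraction `p q⁻¹`. -/
def frac (p q : P) : FracGroup P :=
  MulOpposite.op (MulOpposite.op p /ₒ (⟨MulOpposite.op q, trivial⟩ : (⊤ : Submonoid Pᵐᵒᵖ)))

theorem exists_eq_frac (g : FracGroup P) : ∃ p q, g = frac p q := by
  obtain ⟨x, rfl⟩ := MulOpposite.op_surjective g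
  induction x using OreLocalization.ind with
  | c r s => exact ⟨r.unop, s.1.unop, rfl⟩

theorem frac_mul_ι (p q : P) : frac p q * ι q = ι p := by
  refine MulOpposite.unop_injective ?_
  change (MulOpposite.op q /ₒ 1) * (MulOpposite.op p /ₒ
    (⟨MulOpposite.op q, trivial⟩ : (⊤ : Submonoid Pᵐᵒᵖ))) = MulOpposite.op p /ₒ 1
  exact OreLocalization.mul_cancel (s := (⟨MulOpposite.op q, trivial⟩ : (⊤ : Submonoid Pᵐᵒᵖ)))

theorem frac_mul_frac_swap (p q : P) : frac p q * frac q p = 1 := by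
  refine MulOpposite.unop_injective ?_
  change (MulOpposite.op q /ₒ (⟨MulOpposite.op p, trivial⟩ : (⊤ : Submonoid Pᵐᵒᵖ))) *
    (MulOpposite.op p /ₒ (⟨MulOpposite.op q, trivial⟩ : (⊤ : Submonoid Pᵐᵒᵖ))) = 1
  exact OreLocalization.mul_inv (⟨MulOpposite.op q, trivial⟩ : (⊤ : Submonoid Pᵐᵒᵖ)) _

instance : Group (FracGroup P) :=
  groupOfIsUnit fun g => by
    obtain ⟨p, q, rfl⟩ := exists_eq_frac g
    exact ⟨⟨frac p q, frac q p, frac_mul_frac_swap p q, frac_mul_frac_swap q p⟩, rfl⟩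

theorem frac_eq (p q : P) : frac p q = ι p * (ι q)⁻¹ :=
  eq_mul_inv_of_mul_eq (frac_mul_ι p q)

theorem frac_inv (p q : P) : (frac p q)⁻¹ = frac q p := by
  rw [frac_eq, frac_eq, mul_inv_rev, inv_inv]

theorem frac_mul_right (p q t : P) : frac (p * t) (q * t) = frac p q := by
  simp [frac_eq, mul_assoc]

theorem frac_eq_frac_iff {p q p' q' : P} :
    frac p q = frac p' q' ↔ ∃ t t', p * t = p' * t' ∧ q * t = q' * t' := by
  constructor
  · intro h
    obtain ⟨u, v, h1, h2⟩ := OreLocalization.oreDiv_eq_iff.1 (MulOpposite.op_injective h)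
    exact ⟨v.unop, u.1.unop, (congrArg MulOpposite.unop h1).symm,
      (congrArg MulOpposite.unop h2).symm⟩
  · rintro ⟨t, t', h1, h2⟩
    rw [← frac_mul_right p q t, h1, h2, frac_mul_right]

end FracGroup

end OreMonoid

/-! ## Actions by proper topological correspondences and complete histories -/

noncomputable section CorrespondenceAction

/-- An action of a monoid `P` on a locally compact Hausdorff space `X` by proper topological
correspondences.

* For each `p`, the space `M p` is locally compact and Hausdorff, `r p : M p → X` is a proper
  continuous map and `s p : M p → X` is a local homeomorphism.
* For `p * q = w`, the map `m ↦ (cutL m, cutR m)` is a homeomorphism from `M w` onto the fibre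
  product of `M p` and `M q` over `s p` and `r q`, which is compatible with the range and source
  maps to `X`.  These homeomorphisms are associative.
* `M 1` is the identity correspondence: it is identified with `X` by the homeomorphism
  `r 1 = s 1`, and the maps `M p → M p ×_X X` and `M q → X ×_X M q` are the canonical ones.

The product `p * q` is called `w` with a proof of `p * q = w` in order to
state the associativity without transports between `M (p * q * t)` and `M (p * (q * t))`. -/
structure CorrespondenceAction (P : Type*) [Monoid P] (X : Type*) [TopologicalSpace X] where
  M : P → Type*
  [topM : ∀ p, TopologicalSpace (M p)]
  [t2M : ∀ p, T2Space (M p)]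
  [lcM : ∀ p, LocallyCompactSpace (M p)]
  r : ∀ p, M p → X
  s : ∀ p, M p → X
  isProperMap_r : ∀ p, IsProperMap (r p)
  isLocalHomeomorph_s : ∀ p, IsLocalHomeomorph (s p)
  cutL : ∀ {p q w : P}, p * q = w → M w → M p
  cutR : ∀ {p q w : P}, p * q = w → M w → M q
  s_cutL : ∀ {p q w : P} (h : p * q = w) (m : M w), s p (cutL h m) = r q (cutR h m)
  isHomeomorph_cut : ∀ {p q w : P} (h : p * q = w),
    IsHomeomorph fun m : M w => (⟨(cutL h m, cutR h m), s_cutL h m⟩ : FibreProd (s p) (r q))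
  r_cutL : ∀ {p q w : P} (h : p * q = w) (m : M w), r p (cutL h m) = r w m
  s_cutR : ∀ {p q w : P} (h : p * q = w) (m : M w), s q (cutR h m) = s w m
  cutL_cutL : ∀ {p q t a b w : P} (hpq : p * q = a) (hqt : q * t = b) (hat : a * t = w)
    (hpb : p * b = w) (m : M w), cutL hpq (cutL hat m) = cutL hpb m
  cutR_cutL : ∀ {p q t a b w : P} (hpq : p * q = a) (hqt : q * t = b) (hat : a * t = w)
    (hpb : p * b = w) (m : M w), cutR hpq (cutL hat m) = cutL hqt (cutR hpb m)
  cutR_cutR : ∀ {p q t a b w : P} (hpq : p * q = a) (hqt : q * t = b) (hat : a * t = w)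
    (hpb : p * b = w) (m : M w), cutR hqt (cutR hpb m) = cutR hat m
  r_one_eq_s_one : r 1 = s 1
  isHomeomorph_r_one : IsHomeomorph (r 1)
  cutL_one : ∀ (p : P) (m : M p), cutL (mul_one p) m = m
  cutR_one : ∀ (q : P) (m : M q), cutR (one_mul q) m = m

attribute [instance] CorrespondenceAction.topM CorrespondenceAction.t2M CorrespondenceAction.lcM

namespace CorrespondenceAction

variable {P : Type*} [Monoid P] {X : Type*} [TopologicalSpace X] (𝓐 : CorrespondenceAction P X)

theorem continuous_r (p : P) : Continuous (𝓐.r p) := (𝓐.isProperMap_r p).continuous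

theorem continuous_s (p : P) : Continuous (𝓐.s p) := (𝓐.isLocalHomeomorph_s p).continuous

theorem continuous_cutL {p q w : P} (h : p * q = w) : Continuous (𝓐.cutL h) :=
  (continuous_fst.comp continuous_subtype_val).comp (𝓐.isHomeomorph_cut h).continuous

theorem continuous_cutR {p q w : P} (h : p * q = w) : Continuous (𝓐.cutR h) :=
  (continuous_snd.comp continuous_subtype_val).comp (𝓐.isHomeomorph_cut h).continuous

/-- Concatenation, the inverse of the cutting homeomorphism. -/
def glue {p q w : P} (h : p * q = w) : FibreProd (𝓐.s p) (𝓐.r q) ≃ₜ 𝓐.M w :=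
  (IsHomeomorph.homeomorph _ (𝓐.isHomeomorph_cut h)).symm

theorem cutL_glue {p q w : P} (h : p * q = w) (x : FibreProd (𝓐.s p) (𝓐.r q)) :
    𝓐.cutL h (𝓐.glue h x) = x.1.1 :=
  congrArg (fun y : FibreProd (𝓐.s p) (𝓐.r q) => y.1.1)
    ((IsHomeomorph.homeomorph _ (𝓐.isHomeomorph_cut h)).apply_symm_apply x)

theorem cutR_glue {p q w : P} (h : p * q = w) (x : FibreProd (𝓐.s p) (𝓐.r q)) :
    𝓐.cutR h (𝓐.glue h x) = x.1.2 :=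
  congrArg (fun y : FibreProd (𝓐.s p) (𝓐.r q) => y.1.2)
    ((IsHomeomorph.homeomorph _ (𝓐.isHomeomorph_cut h)).apply_symm_apply x)

theorem cut_ext {p q w : P} (h : p * q = w) {m m' : 𝓐.M w} (hL : 𝓐.cutL h m = 𝓐.cutL h m')
    (hR : 𝓐.cutR h m = 𝓐.cutR h m') : m = m' :=
  (𝓐.isHomeomorph_cut h).injective (Subtype.ext (Prod.ext hL hR))

/-- The space of complete histories: the projective limit of the spaces `M p` along the
maps `cutL`, as a subspace of their product. -/
def History : Type _ :=
  {m : ∀ p, 𝓐.M p // ∀ {p q w : P} (h : p * q = w), 𝓐.cutL h (m w) = m p}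

namespace History

instance : TopologicalSpace 𝓐.History :=
  inferInstanceAs (TopologicalSpace
    {m : ∀ p, 𝓐.M p // ∀ {p q w : P} (h : p * q = w), 𝓐.cutL h (m w) = m p})

instance : T2Space 𝓐.History :=
  inferInstanceAs (T2Space
    {m : ∀ p, 𝓐.M p // ∀ {p q w : P} (h : p * q = w), 𝓐.cutL h (m w) = m p})

variable {𝓐}

/-- The projection from the space of complete histories to `M p`. -/
def proj (p : P) (m : 𝓐.History) : 𝓐.M p := m.1 p

theorem continuous_proj (p : P) : Continuous (proj (𝓐 := 𝓐) p) :=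
  (continuous_apply p).comp continuous_subtype_val

@[ext]
theorem ext {m m' : 𝓐.History} (h : ∀ p, m.proj p = m'.proj p) : m = m' :=
  Subtype.ext (funext h)

theorem cutL_proj (m : 𝓐.History) {p q w : P} (h : p * q = w) :
    𝓐.cutL h (m.proj w) = m.proj p := m.2 h

/-- The present situation of a complete history. -/
def base (m : 𝓐.History) : X := 𝓐.r 1 (m.proj 1)

theorem continuous_base : Continuous (base (𝓐 := 𝓐)) :=
  (𝓐.continuous_r 1).comp (continuous_proj 1)

theorem r_proj (m : 𝓐.History) (p : P) : 𝓐.r p (m.proj p) = m.base := by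
  rw [base, ← m.cutL_proj (one_mul p), 𝓐.r_cutL]

theorem isClosed_range :
    IsClosed {m : ∀ p, 𝓐.M p | ∀ {p q w : P} (h : p * q = w), 𝓐.cutL h (m w) = m p} := by
  simp only [Set.ofPred_forall]
  exact isClosed_iInter fun p => isClosed_iInter fun q => isClosed_iInter fun w =>
    isClosed_iInter fun h => isClosed_eq ((𝓐.continuous_cutL h).comp (continuous_apply w))
      (continuous_apply p)

theorem isCompact_preimage_base {K : Set X} (hK : IsCompact K) :
    IsCompact (base (𝓐 := 𝓐) ⁻¹' K) := by
  have h1 : IsCompact (Set.univ.pi fun p => 𝓐.r p ⁻¹' K) :=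
    isCompact_univ_pi fun p => (𝓐.isProperMap_r p).isCompact_preimage hK
  have h2 : IsClosedEmbedding (Subtype.val : 𝓐.History → ∀ p, 𝓐.M p) :=
    isClosed_range.isClosedEmbedding_subtypeVal
  have h3 : base (𝓐 := 𝓐) ⁻¹' K =
      (Subtype.val : 𝓐.History → ∀ p, 𝓐.M p) ⁻¹' (Set.univ.pi fun p => 𝓐.r p ⁻¹' K) := by
    ext m
    constructor
    · intro hm p _
      have : 𝓐.r p (m.proj p) ∈ K := by rw [m.r_proj]; exact hm
      exact this
    · intro hm
      exact hm 1 trivial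
  rw [h3]
  exact h2.isCompact_preimage h1

instance [LocallyCompactSpace X] : LocallyCompactSpace 𝓐.History := by
  have : WeaklyLocallyCompactSpace 𝓐.History := ⟨fun m => by
    obtain ⟨K, hK, hm⟩ := exists_compact_mem_nhds m.base
    exact ⟨_, isCompact_preimage_base hK, continuous_base.continuousAt.preimage_mem_nhds hm⟩⟩
  infer_instance

theorem isCompact_preimage_proj {p : P} {K : Set (𝓐.M p)} (hK : IsCompact K) :
    IsCompact (proj (𝓐 := 𝓐) p ⁻¹' K) := by
  refine (isCompact_preimage_base (hK.image (𝓐.continuous_r p))).of_isClosed_subset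
    (hK.isClosed.preimage (continuous_proj p)) ?_
  intro m hm
  exact ⟨_, hm, m.r_proj p⟩

/-- Forget what happened in the last time period of length `t`. -/
def shift (t : P) (m : 𝓐.History) : 𝓐.History :=
  ⟨fun p => 𝓐.cutR rfl (m.proj (t * p)), fun {p q w} h => by
    subst h
    rw [← 𝓐.cutR_cutL rfl rfl (mul_assoc t p q) rfl, m.cutL_proj]⟩

theorem proj_shift (m : 𝓐.History) {t p w : P} (h : t * p = w) :
    (m.shift t).proj p = 𝓐.cutR h (m.proj w) := by
  subst h; rfl

theorem continuous_shift (t : P) : Continuous (shift (𝓐 := 𝓐) t) :=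
  Continuous.subtype_mk (continuous_pi fun p =>
    (𝓐.continuous_cutR rfl).comp (continuous_proj (t * p))) _

theorem shift_shift (m : 𝓐.History) (t u : P) : (m.shift t).shift u = m.shift (t * u) := by
  ext p
  rw [proj_shift _ rfl, proj_shift _ rfl, proj_shift _ (mul_assoc t u p)]
  exact 𝓐.cutR_cutR rfl rfl _ _ _

theorem shift_one (m : 𝓐.History) : m.shift 1 = m := by
  ext p
  rw [proj_shift _ (one_mul p), 𝓐.cutR_one]

theorem base_shift (m : 𝓐.History) (t : P) : (m.shift t).base = 𝓐.s t (m.proj t) := by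
  rw [base, proj_shift _ (mul_one t), ← 𝓐.s_cutL, 𝓐.cutL_one]

/-- The map from complete histories to pairs consisting of what happened in the last time period
of length `t` and what happened before. -/
def split (t : P) (m : 𝓐.History) : FibreProd (𝓐.s t) (base (𝓐 := 𝓐)) :=
  ⟨(m.proj t, m.shift t), (m.base_shift t).symm⟩

theorem continuous_split (t : P) : Continuous (split (𝓐 := 𝓐) t) :=
  ((continuous_proj t).prodMk (continuous_shift t)).subtype_mk _

section Extend

variable {t : P} (x : FibreProd (𝓐.s t) (base (𝓐 := 𝓐)))

/-- The concatenation of `x.1.1` with the component of `x.1.2` at `p`. -/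
def extendAt {p w : P} (h : t * p = w) : 𝓐.M w :=
  𝓐.glue h ⟨(x.1.1, x.1.2.proj p), x.2.trans (x.1.2.r_proj p).symm⟩

theorem cutL_extendAt {p w : P} (h : t * p = w) : 𝓐.cutL h (extendAt x h) = x.1.1 :=
  𝓐.cutL_glue _ _

theorem cutR_extendAt {p w : P} (h : t * p = w) : 𝓐.cutR h (extendAt x h) = x.1.2.proj p :=
  𝓐.cutR_glue _ _

theorem cutL_extendAt_mul {p c w w' p' : P} (h : t * p = w) (hc : w * c = w') (hp : p * c = p')
    (h' : t * p' = w') : 𝓐.cutL hc (extendAt x h') = extendAt x h := by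
  refine 𝓐.cut_ext h ?_ ?_
  · rw [𝓐.cutL_cutL h hp hc h', cutL_extendAt, cutL_extendAt]
  · rw [𝓐.cutR_cutL h hp hc h', cutR_extendAt, cutR_extendAt, cutL_proj]

theorem cutL_extendAt_eq [RightOre P] {q u p w u' p' w' : P} (hu : q * u = w) (hp : t * p = w)
    (hu' : q * u' = w') (hp' : t * p' = w') :
    𝓐.cutL hu (extendAt x hp) = 𝓐.cutL hu' (extendAt x hp') := by
  obtain ⟨c, c', hc⟩ := RightOre.exists_mul_eq_mul u u'
  have h1 : t * (p * c) = t * (p' * c') := by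
    rw [← mul_assoc, ← mul_assoc, hp, hp', ← hu, ← hu', mul_assoc, mul_assoc, hc]
  obtain ⟨z, hz⟩ := RightOre.exists_mul_eq_mul_of_mul_eq_mul _ _ _ h1
  have e1 : w * (c * z) = w' * (c' * z) := by
    rw [← hu, ← hu', mul_assoc, mul_assoc, ← mul_assoc u, ← mul_assoc u', hc]
  have e2 : p * (c * z) = p' * (c' * z) := by rw [← mul_assoc, hz, mul_assoc]
  have e3 : u * (c * z) = u' * (c' * z) := by rw [← mul_assoc, hc, mul_assoc]
  have e4 : t * (p * (c * z)) = w * (c * z) := by rw [← mul_assoc, hp]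
  have e5 : q * (u * (c * z)) = w * (c * z) := by rw [← mul_assoc, hu]
  rw [← cutL_extendAt_mul x hp rfl rfl e4, ← cutL_extendAt_mul x hp' e1.symm e2.symm e4,
    𝓐.cutL_cutL hu rfl rfl e5, 𝓐.cutL_cutL hu' e3.symm e1.symm e5]

theorem exists_ore [RightOre P] (t q : P) : ∃ u p, q * u = t * p :=
  RightOre.exists_mul_eq_mul q t

/-- Extend a complete history by what happened afterwards in a time period of length `t`. -/
def extend [RightOre P] : 𝓐.History :=
  ⟨fun q => 𝓐.cutL (exists_ore t q).choose_spec.choose_spec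
    (extendAt x (rfl : t * (exists_ore t q).choose_spec.choose = _)), fun {p q w} h => by
    subst h
    rw [𝓐.cutL_cutL rfl rfl _ (by rw [← mul_assoc]; exact (exists_ore t _).choose_spec.choose_spec)]
    exact cutL_extendAt_eq x _ _ _ _⟩

theorem proj_extend [RightOre P] {q u p w : P} (hu : q * u = w) (hp : t * p = w) :
    (extend x).proj q = 𝓐.cutL hu (extendAt x hp) :=
  cutL_extendAt_eq x _ _ _ _

theorem split_extend [RightOre P] : split t (extend x) = x := by
  refine Subtype.ext (Prod.ext ?_ (History.ext fun p => ?_))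
  · change (extend x).proj t = x.1.1
    rw [proj_extend x (mul_one t) (mul_one t), cutL_extendAt]
  · change ((extend x).shift t).proj p = x.1.2.proj p
    rw [proj_shift _ rfl, proj_extend x (mul_one (t * p)) rfl, 𝓐.cutL_one, cutR_extendAt]

end Extend

theorem extend_split [RightOre P] (t : P) (m : 𝓐.History) : extend (split t m) = m := by
  ext q
  obtain ⟨u, p, h⟩ := exists_ore t q
  rw [proj_extend _ h rfl, ← m.cutL_proj h]
  congr 1
  refine 𝓐.cut_ext rfl ?_ ?_
  · rw [cutL_extendAt, cutL_proj]
    rfl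
  · rw [cutR_extendAt, ← proj_shift]
    rfl

theorem continuous_extend [RightOre P] (t : P) :
    Continuous fun x : FibreProd (𝓐.s t) (base (𝓐 := 𝓐)) => extend x := by
  refine Continuous.subtype_mk (continuous_pi fun q => (𝓐.continuous_cutL _).comp
    ((𝓐.glue _).continuous.comp (Continuous.subtype_mk ?_ _))) _
  exact (continuous_fst.comp continuous_subtype_val).prodMk
    ((continuous_proj _).comp (continuous_snd.comp continuous_subtype_val))

/-- The splitting homeomorphism. -/
def splitHomeo [RightOre P] (t : P) : 𝓐.History ≃ₜ FibreProd (𝓐.s t) (base (𝓐 := 𝓐)) where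
  toFun := split t
  invFun x := extend x
  left_inv m := extend_split t m
  right_inv x := split_extend x
  continuous_toFun := continuous_split t
  continuous_invFun := continuous_extend t

theorem isLocalHomeomorph_shift [RightOre P] (t : P) : IsLocalHomeomorph (shift (𝓐 := 𝓐) t) :=
  ((𝓐.isLocalHomeomorph_s t).snd_fibreProd continuous_base).comp
    (splitHomeo t).isLocalHomeomorph

end History

end CorrespondenceAction

end CorrespondenceAction

/-! ## The transformation groupoid of the shifts on complete histories -/

noncomputable section TransformationGroupoid

namespace CorrespondenceAction

open FracGroup

variable {P : Type*} [Monoid P] [RightOre P] {X : Type*} [TopologicalSpace X]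
  (𝓐 : CorrespondenceAction P X)

/-- The arrows of the transformation groupoid: triples `(x, g, y)` such that there are `p, q` with
`g = p q⁻¹` and `shift p x = shift q y`. -/
@[ext]
structure Arrow where
  rng : 𝓐.History
  frc : FracGroup P
  src : 𝓐.History
  exists_frac : ∃ p q, frc = frac p q ∧ rng.shift p = src.shift q

namespace Arrow

/-- The pairs `(x, y)` with `shift p x = shift q y`, as a subspace of the product. -/
abbrev Piece (p q : P) : Type _ :=
  FibreProd (History.shift (𝓐 := 𝓐) p) (History.shift (𝓐 := 𝓐) q)

variable {𝓐}

/-- The map `(x, y) ↦ (x, p q⁻¹, y)`. -/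
def ofPiece (p q : P) (a : Piece 𝓐 p q) : 𝓐.Arrow := ⟨a.1.1, frac p q, a.1.2, p, q, rfl, a.2⟩

/-- The space of arrows carries the quotient topology of the topology on the disjoint union of
the spaces `Piece p q`. -/
instance : TopologicalSpace 𝓐.Arrow :=
  TopologicalSpace.coinduced
    (fun a : Σ pq : P × P, Piece 𝓐 pq.1 pq.2 => ofPiece a.1.1 a.1.2 a.2) inferInstance

theorem isOpen_iff' {U : Set 𝓐.Arrow} : IsOpen U ↔ ∀ p q, IsOpen (ofPiece p q ⁻¹' U) := by
  rw [isOpen_coinduced, isOpen_sigma_iff]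
  exact ⟨fun h p q => h (p, q), fun h pq => h pq.1 pq.2⟩

theorem continuous_ofPiece (p q : P) : Continuous (ofPiece (𝓐 := 𝓐) p q) :=
  ⟨fun _ hU => isOpen_iff'.1 hU p q⟩

theorem continuous_of_ofPiece {Z : Type*} [TopologicalSpace Z] {f : 𝓐.Arrow → Z}
    (h : ∀ p q, Continuous (f ∘ ofPiece p q)) : Continuous f :=
  ⟨fun U hU => isOpen_iff'.2 fun p q => hU.preimage (h p q)⟩

theorem continuous_rng : Continuous (rng : 𝓐.Arrow → 𝓐.History) :=
  continuous_of_ofPiece fun _ _ => continuous_fst.comp continuous_subtype_val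

theorem continuous_src : Continuous (src : 𝓐.Arrow → 𝓐.History) :=
  continuous_of_ofPiece fun _ _ => continuous_snd.comp continuous_subtype_val

theorem ofPiece_injective (p q : P) : Function.Injective (ofPiece (𝓐 := 𝓐) p q) := fun _ _ h =>
  Subtype.ext (Prod.ext (congrArg rng h) (congrArg src h))

theorem exists_ofPiece (a : 𝓐.Arrow) : ∃ p q, a ∈ range (ofPiece (𝓐 := 𝓐) p q) := by
  obtain ⟨x, g, y, p, q, rfl, h⟩ := a
  exact ⟨p, q, ⟨(x, y), h⟩, rfl⟩

theorem isOpenMap_ofPiece (p q : P) : IsOpenMap (ofPiece (𝓐 := 𝓐) p q) := by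
  intro U hU
  rw [isOpen_iff']
  intro p' q'
  obtain ⟨V, hV, rfl⟩ := isOpen_induced_iff.1 hU
  rw [isOpen_iff_mem_nhds]
  rintro ⟨⟨x, y⟩, h'⟩ ⟨⟨⟨x', y'⟩, h⟩, hmem, he⟩
  obtain rfl : x' = x := congrArg rng he
  obtain rfl : y' = y := congrArg src he
  have hf : frac p q = frac p' q' := congrArg frc he
  obtain ⟨t, t', h1, h2⟩ := frac_eq_frac_iff.1 hf
  obtain ⟨W, hW, hxW, hinj⟩ :=
    (History.isLocalHomeomorph_shift (𝓐 := 𝓐) t).isLocallyInjective (x'.shift p)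
  have c1 : Continuous fun a : Piece 𝓐 p' q' => a.1.1.shift p :=
    (History.continuous_shift p).comp (continuous_fst.comp continuous_subtype_val)
  have c2 : Continuous fun a : Piece 𝓐 p' q' => a.1.2.shift q :=
    (History.continuous_shift q).comp (continuous_snd.comp continuous_subtype_val)
  have hy : y'.shift q ∈ W := by
    have : x'.shift p = y'.shift q := h
    rwa [← this]
  filter_upwards [c1.continuousAt.preimage_mem_nhds (hW.mem_nhds hxW),
    c2.continuousAt.preimage_mem_nhds (hW.mem_nhds hy),
    (hV.preimage continuous_subtype_val).mem_nhds hmem]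
  rintro ⟨⟨x, y⟩, h3⟩ h4 h5 h6
  have h3 : x.shift p' = y.shift q' := h3
  have h7 : x.shift p = y.shift q := by
    refine hinj h4 h5 ?_
    rw [History.shift_shift, History.shift_shift, h1, h2, ← History.shift_shift, h3,
      History.shift_shift]
  exact ⟨⟨(x, y), h7⟩, h6, Arrow.ext rfl hf rfl⟩

theorem isOpenEmbedding_ofPiece (p q : P) : IsOpenEmbedding (ofPiece (𝓐 := 𝓐) p q) :=
  IsOpenEmbedding.of_continuous_injective_isOpenMap (continuous_ofPiece p q)
    (ofPiece_injective p q) (isOpenMap_ofPiece p q)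

theorem isOpen_range_ofPiece (p q : P) : IsOpen (range (ofPiece (𝓐 := 𝓐) p q)) :=
  (isOpenEmbedding_ofPiece p q).isOpen_range

instance : T2Space 𝓐.Arrow := by
  refine ⟨fun a b hab => ?_⟩
  by_cases h1 : a.rng = b.rng
  · by_cases h2 : a.src = b.src
    · have h3 : a.frc ≠ b.frc := fun h3 => hab (Arrow.ext h1 h3 h2)
      obtain ⟨p, q, ha⟩ := exists_ofPiece a
      obtain ⟨p', q', hb⟩ := exists_ofPiece b
      refine ⟨_, _, isOpen_range_ofPiece p q, isOpen_range_ofPiece p' q', ha, hb, ?_⟩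
      rw [Set.disjoint_left]
      rintro _ ⟨c, rfl⟩ ⟨d, hd⟩
      obtain ⟨a, rfl⟩ := ha
      obtain ⟨b, rfl⟩ := hb
      exact h3 (congrArg frc hd).symm
    · obtain ⟨U, V, hU, hV, ha, hb, hUV⟩ := t2_separation h2
      exact ⟨_, _, hU.preimage continuous_src, hV.preimage continuous_src, ha, hb,
        hUV.preimage src⟩
  · obtain ⟨U, V, hU, hV, ha, hb, hUV⟩ := t2_separation h1
    exact ⟨_, _, hU.preimage continuous_rng, hV.preimage continuous_rng, ha, hb,
      hUV.preimage rng⟩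

instance [LocallyCompactSpace X] (p q : P) : LocallyCompactSpace (Piece 𝓐 p q) := by
  have : IsClosed {a : 𝓐.History × 𝓐.History | a.1.shift p = a.2.shift q} :=
    isClosed_eq ((History.continuous_shift p).comp continuous_fst)
      ((History.continuous_shift q).comp continuous_snd)
  exact this.isClosedEmbedding_subtypeVal.locallyCompactSpace

instance [LocallyCompactSpace X] : LocallyCompactSpace 𝓐.Arrow := by
  have : WeaklyLocallyCompactSpace 𝓐.Arrow := ⟨fun a => by
    obtain ⟨p, q, a, rfl⟩ := exists_ofPiece a
    obtain ⟨K, hK, ha⟩ := exists_compact_mem_nhds a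
    exact ⟨_, hK.image (continuous_ofPiece p q), (isOpenMap_ofPiece p q).image_mem_nhds ha⟩⟩
  infer_instance

theorem isLocalHomeomorph_rng : IsLocalHomeomorph (rng : 𝓐.Arrow → 𝓐.History) := by
  have h0 : ∀ p q, IsLocalHomeomorph fun a : Piece 𝓐 p q => a.1.1 := by
    intro p q
    let e : Piece 𝓐 p q ≃ₜ Piece 𝓐 q p :=
      { toFun := fun a => ⟨(a.1.2, a.1.1), Eq.symm a.2⟩
        invFun := fun a => ⟨(a.1.2, a.1.1), Eq.symm a.2⟩
        left_inv := fun _ => rfl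
        right_inv := fun _ => rfl
        continuous_toFun := (continuous_swap.comp continuous_subtype_val).subtype_mk _
        continuous_invFun := (continuous_swap.comp continuous_subtype_val).subtype_mk _ }
    exact ((History.isLocalHomeomorph_shift q).snd_fibreProd (History.continuous_shift p)).comp
      e.isLocalHomeomorph
  refine isLocalHomeomorph_of_isOpenMap continuous_rng ?_ ?_
  · intro U hU
    have : rng '' U = ⋃ (p : P) (q : P), (fun a : Piece 𝓐 p q => a.1.1) '' (ofPiece p q ⁻¹' U) := by
      ext x
      simp only [mem_iUnion]
      constructor
      · rintro ⟨a, ha, rfl⟩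
        obtain ⟨p, q, a, rfl⟩ := exists_ofPiece a
        exact ⟨p, q, a, ha, rfl⟩
      · rintro ⟨p, q, a, ha, rfl⟩
        exact ⟨_, ha, rfl⟩
    rw [this]
    exact isOpen_iUnion fun p => isOpen_iUnion fun q =>
      (h0 p q).isOpenMap _ (isOpen_iff'.1 hU p q)
  · intro a
    obtain ⟨p, q, a, rfl⟩ := exists_ofPiece a
    obtain ⟨U, hU, haU, hinj⟩ := (h0 p q).isLocallyInjective a
    refine ⟨_, isOpenMap_ofPiece p q U hU, mem_image_of_mem _ haU, ?_⟩
    rintro _ ⟨b, hb, rfl⟩ _ ⟨c, hc, rfl⟩ h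
    rw [hinj hb hc h]

theorem continuousAt_of_eq {Z : Type*} [TopologicalSpace Z] {f : Z → 𝓐.Arrow}
    (hr : Continuous fun z => (f z).rng) (hs : Continuous fun z => (f z).src) {U : Set Z}
    (hU : IsOpen U) (p q : P) (h1 : ∀ z ∈ U, (f z).frc = frac p q)
    (h2 : ∀ z ∈ U, (f z).rng.shift p = (f z).src.shift q) {z : Z} (hz : z ∈ U) :
    ContinuousAt f z := by
  have : ContinuousOn f U := by
    rw [continuousOn_iff_continuous_domRestrict]
    have : U.domRestrict f =
        fun z : U => ofPiece p q ⟨((f z).rng, (f z).src), h2 z z.2⟩ := by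
      funext z
      exact Arrow.ext rfl (h1 z z.2) rfl
    rw [this]
    exact (continuous_ofPiece p q).comp
      (((hr.comp continuous_subtype_val).prodMk (hs.comp continuous_subtype_val)).subtype_mk _)
  exact this.continuousAt (hU.mem_nhds hz)

/-- The unit arrow at a complete history. -/
def one (x : 𝓐.History) : 𝓐.Arrow := ⟨x, 1, x, 1, 1, by simp [frac_eq], rfl⟩

/-- The inverse `(y, g⁻¹, x)` of `(x, g, y)`. -/
def inv (a : 𝓐.Arrow) : 𝓐.Arrow := ⟨a.src, a.frc⁻¹, a.rng, by
  obtain ⟨p, q, h1, h2⟩ := a.exists_frac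
  exact ⟨q, p, by rw [h1, frac_inv], h2.symm⟩⟩

theorem frac_mul_frac {p q p' q' u u' : P} (h : q * u = p' * u') :
    frac p q * frac p' q' = frac (p * u) (q' * u') := by
  rw [← frac_mul_right p q u, ← frac_mul_right p' q' u', h, frac_eq, frac_eq, frac_eq]
  group

theorem shift_mul_eq {x y z : 𝓐.History} {p q p' q' u u' : P} (h : q * u = p' * u')
    (h1 : x.shift p = y.shift q) (h2 : y.shift p' = z.shift q') :
    x.shift (p * u) = z.shift (q' * u') := by
  rw [← History.shift_shift, h1, History.shift_shift, h, ← History.shift_shift, h2,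
    History.shift_shift]

/-- The product `(x, g * h, z)` of `(x, g, y)` and `(y, h, z)`. -/
def mul (a b : 𝓐.Arrow) (e : a.src = b.rng) : 𝓐.Arrow := ⟨a.rng, a.frc * b.frc, b.src, by
  obtain ⟨p, q, h1, h2⟩ := a.exists_frac
  obtain ⟨p', q', h1', h2'⟩ := b.exists_frac
  obtain ⟨u, u', hu⟩ := RightOre.exists_mul_eq_mul q p'
  exact ⟨p * u, q' * u', by rw [h1, h1', frac_mul_frac hu], shift_mul_eq hu h2 (e ▸ h2')⟩⟩

theorem continuous_one : Continuous (one : 𝓐.History → 𝓐.Arrow) :=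
  continuous_iff_continuousAt.2 fun _ =>
    continuousAt_of_eq continuous_id continuous_id isOpen_univ 1 1
      (fun _ _ => by simp [frac_eq, one]) (fun _ _ => rfl) (mem_univ _)

theorem continuous_inv : Continuous (inv : 𝓐.Arrow → 𝓐.Arrow) := by
  refine continuous_iff_continuousAt.2 fun a => ?_
  obtain ⟨p, q, ha⟩ := exists_ofPiece a
  refine continuousAt_of_eq continuous_src continuous_rng (isOpen_range_ofPiece p q) q p ?_ ?_ ha
  · rintro _ ⟨a, rfl⟩
    exact frac_inv p q
  · rintro _ ⟨a, rfl⟩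
    exact Eq.symm a.2

theorem continuous_mul : Continuous fun a : FibreProd (src (𝓐 := 𝓐)) (rng (𝓐 := 𝓐)) =>
    mul a.1.1 a.1.2 a.2 := by
  refine continuous_iff_continuousAt.2 fun a => ?_
  obtain ⟨p, q, ha⟩ := exists_ofPiece a.1.1
  obtain ⟨p', q', hb⟩ := exists_ofPiece a.1.2
  obtain ⟨u, u', hu⟩ := RightOre.exists_mul_eq_mul q p'
  have c1 : Continuous fun a : FibreProd (src (𝓐 := 𝓐)) (rng (𝓐 := 𝓐)) => a.1.1 :=
    continuous_fst.comp continuous_subtype_val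
  have c2 : Continuous fun a : FibreProd (src (𝓐 := 𝓐)) (rng (𝓐 := 𝓐)) => a.1.2 :=
    continuous_snd.comp continuous_subtype_val
  have d1 : Continuous fun a : FibreProd (src (𝓐 := 𝓐)) (rng (𝓐 := 𝓐)) => a.1.1.rng :=
    continuous_rng.comp c1
  have d2 : Continuous fun a : FibreProd (src (𝓐 := 𝓐)) (rng (𝓐 := 𝓐)) => a.1.2.src :=
    continuous_src.comp c2
  refine continuousAt_of_eq (f := fun a : FibreProd (src (𝓐 := 𝓐)) (rng (𝓐 := 𝓐)) =>
      mul a.1.1 a.1.2 a.2) d1 d2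
    (((isOpen_range_ofPiece p q).preimage c1).inter ((isOpen_range_ofPiece p' q').preimage c2))
    (p * u) (q' * u') ?_ ?_ ⟨ha, hb⟩
  · rintro ⟨⟨_, _⟩, e⟩ ⟨⟨a, rfl⟩, ⟨b, rfl⟩⟩
    exact frac_mul_frac hu
  · rintro ⟨⟨_, _⟩, e⟩ ⟨⟨a, rfl⟩, ⟨b, rfl⟩⟩
    refine shift_mul_eq hu a.2 ?_
    have e : a.1.2 = b.1.1 := e
    rw [e]
    exact b.2

end Arrow

/-- The étale groupoid with the complete histories as objects and the arrows `(x, g, y)` with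
`g = p q⁻¹` and `shift p x = shift q y` for some `p, q`. -/
def groupoid [LocallyCompactSpace X] : EtaleGroupoid where
  Obj := 𝓐.History
  Arr := 𝓐.Arrow
  r := Arrow.rng
  s := Arrow.src
  one := Arrow.one
  inv := Arrow.inv
  mul := Arrow.mul
  r_one _ := rfl
  s_one _ := rfl
  r_inv _ := rfl
  s_inv _ := rfl
  r_mul _ _ _ := rfl
  s_mul _ _ _ := rfl
  one_mul g := Arrow.ext rfl (_root_.one_mul _) rfl
  mul_one g := Arrow.ext rfl (_root_.mul_one _) rfl
  inv_mul g := Arrow.ext rfl (inv_mul_cancel _) rfl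
  mul_inv g := Arrow.ext rfl (mul_inv_cancel _) rfl
  mul_assoc g h k _ _ := Arrow.ext rfl (_root_.mul_assoc _ _ _) rfl
  continuous_s := Arrow.continuous_src
  continuous_one := Arrow.continuous_one
  continuous_inv := Arrow.continuous_inv
  continuous_mul := Arrow.continuous_mul
  isLocalHomeomorph_r := Arrow.isLocalHomeomorph_rng

/-! The functions on the groupoid that come from functions on the spaces `M p`. -/

variable {𝓐}

open Classical in
/-- The function on the arrows that is `ξ (proj p x)` at `(x, p, shift p x)` and vanishes at
arrows that are not of this form. -/
def arrowFun {p : P} (ξ : 𝓐.M p → ℂ) (a : 𝓐.Arrow) : ℂ :=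
  if a.frc = ι p ∧ a.src = a.rng.shift p then ξ (a.rng.proj p) else 0

theorem mem_range_ofPiece_iff {p : P} {a : 𝓐.Arrow} :
    a ∈ range (Arrow.ofPiece (𝓐 := 𝓐) p 1) ↔ a.frc = ι p ∧ a.src = a.rng.shift p := by
  constructor
  · rintro ⟨⟨⟨x, y⟩, h⟩, rfl⟩
    have h : x.shift p = y.shift 1 := h
    refine ⟨by simp [Arrow.ofPiece, frac_eq], ?_⟩
    change y = x.shift p
    rw [h, History.shift_one]
  · rintro ⟨h1, h2⟩
    refine ⟨⟨(a.rng, a.src), ?_⟩, Arrow.ext rfl ?_ rfl⟩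
    · rw [h2, History.shift_one]
    · rw [h1]
      simp [Arrow.ofPiece, frac_eq]

/-- The map `x ↦ (x, p, shift p x)`. -/
def arrowSection (p : P) (x : 𝓐.History) : 𝓐.Arrow :=
  Arrow.ofPiece p 1 ⟨(x, x.shift p), (History.shift_one _).symm⟩

theorem continuous_arrowSection (p : P) : Continuous (arrowSection (𝓐 := 𝓐) p) :=
  (Arrow.continuous_ofPiece p 1).comp
    ((continuous_id.prodMk (History.continuous_shift p)).subtype_mk _)

theorem arrowFun_eq_zero {p : P} (ξ : 𝓐.M p → ℂ) {a : 𝓐.Arrow}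
    (ha : a ∉ arrowSection p '' (History.proj p ⁻¹' tsupport ξ)) : arrowFun ξ a = 0 := by
  by_contra h
  unfold arrowFun at h
  split_ifs at h with h1
  · refine ha ⟨a.rng, subset_tsupport ξ h, ?_⟩
    refine Arrow.ext rfl ?_ h1.2.symm
    rw [h1.1]
    simp [arrowSection, Arrow.ofPiece, frac_eq]
  · exact h rfl

theorem hasCompactSupport_arrowFun {p : P} {ξ : 𝓐.M p → ℂ} (hξ : HasCompactSupport ξ) :
    HasCompactSupport (arrowFun ξ) :=
  HasCompactSupport.intro
    ((History.isCompact_preimage_proj hξ.isCompact).image (continuous_arrowSection p))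
    fun _ ha => arrowFun_eq_zero ξ ha

theorem continuous_arrowFun {p : P} {ξ : 𝓐.M p → ℂ} (hc : Continuous ξ)
    (hξ : HasCompactSupport ξ) : Continuous (arrowFun ξ) := by
  have hK : IsClosed (arrowSection p '' (History.proj (𝓐 := 𝓐) p ⁻¹' tsupport ξ)) :=
    ((History.isCompact_preimage_proj hξ.isCompact).image (continuous_arrowSection p)).isClosed
  rw [continuous_iff_continuousAt]
  intro a
  by_cases ha : a ∈ range (Arrow.ofPiece (𝓐 := 𝓐) p 1)
  · have h1 : ContinuousAt (fun a : 𝓐.Arrow => ξ (a.rng.proj p)) a :=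
      (hc.comp ((History.continuous_proj p).comp Arrow.continuous_rng)).continuousAt
    refine h1.congr ?_
    filter_upwards [(Arrow.isOpen_range_ofPiece p 1).mem_nhds ha] with b hb
    exact (if_pos (mem_range_ofPiece_iff.1 hb)).symm
  · have ha' : a ∈ (arrowSection p '' (History.proj (𝓐 := 𝓐) p ⁻¹' tsupport ξ))ᶜ := by
      rintro ⟨x, -, rfl⟩
      exact ha (mem_range_self _)
    refine (continuousAt_const (y := (0 : ℂ))).congr ?_
    filter_upwards [hK.isOpen_compl.mem_nhds ha'] with b hb
    exact (arrowFun_eq_zero ξ hb).symm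

/-- The element of the convolution algebra of the groupoid defined by `arrowFun ξ`. -/
def arrowConv [LocallyCompactSpace X] {p : P} (ξ : C_c(𝓐.M p, ℂ)) : 𝓐.groupoid.ConvAlg :=
  ⟨⟨⟨arrowFun ξ, continuous_arrowFun ξ.continuous ξ.hasCompactSupport⟩,
    hasCompactSupport_arrowFun ξ.hasCompactSupport⟩⟩

end CorrespondenceAction

end TransformationGroupoid

/-! ## The Hilbert module of a local homeomorphism -/

noncomputable section HilbertModule

variable {M N L X : Type*}

/-- The Hilbert space of square-summable functions on a fibre of `s`. -/
abbrev FibreL2 (s : M → X) (x : X) : Type _ := lp (fun _ : s ⁻¹' {x} => ℂ) 2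

/-- The Banach space of all bounded families of square-summable functions on the fibres of `s`
with the supremum norm; such a family is the same as a function on the total space. -/
abbrev FibreFamily (s : M → X) : Type _ := lp (fun x : X => FibreL2 s x) ∞

/-- The ℓ²-norms of the restrictions of `ξ` to the fibres of `s` are at most `C`. -/
def SqBound (s : M → X) (ξ : M → ℂ) (C : ℝ) : Prop :=
  0 ≤ C ∧ ∀ (x : X) (F : Finset (s ⁻¹' {x})), ∑ m ∈ F, ‖ξ m‖ ^ 2 ≤ C ^ 2

theorem two_toReal_pos : 0 < (2 : ℝ≥0∞).toReal := by norm_num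

theorem rpow_two_toReal (x : ℝ) : x ^ (2 : ℝ≥0∞).toReal = x ^ 2 := by
  norm_num

namespace FibreFamily

variable {s : M → X}

/-- A family of functions on the fibres as a function on the total space. -/
def toFun (ξ : FibreFamily s) (m : M) : ℂ := ξ (s m) ⟨m, rfl⟩

theorem toFun_apply (ξ : FibreFamily s) (x : X) (m : s ⁻¹' {x}) : toFun ξ m = ξ x m := by
  obtain ⟨m, hm⟩ := m
  obtain rfl : s m = x := hm
  rfl

theorem ext {ξ η : FibreFamily s} (h : ∀ m, toFun ξ m = toFun η m) : ξ = η := by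
  refine lp.ext (funext fun x => lp.ext (funext fun m => ?_))
  rw [← toFun_apply, ← toFun_apply, h]

theorem toFun_add (ξ η : FibreFamily s) (m : M) : toFun (ξ + η) m = toFun ξ m + toFun η m := rfl

theorem toFun_sub (ξ η : FibreFamily s) (m : M) : toFun (ξ - η) m = toFun ξ m - toFun η m := rfl

theorem toFun_smul (c : ℂ) (ξ : FibreFamily s) (m : M) : toFun (c • ξ) m = c * toFun ξ m := rfl

theorem norm_apply_le (ξ : FibreFamily s) (x : X) : ‖ξ x‖ ≤ ‖ξ‖ :=
  lp.norm_apply_le_norm (by simp) ξ x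

theorem sqBound (ξ : FibreFamily s) : SqBound s (toFun ξ) ‖ξ‖ := by
  refine ⟨norm_nonneg _, fun x F => ?_⟩
  have h := lp.sum_rpow_le_norm_rpow two_toReal_pos (ξ x) F
  simp only [rpow_two_toReal] at h
  simp only [toFun_apply]
  exact h.trans (pow_le_pow_left₀ (norm_nonneg _) (norm_apply_le ξ x) 2)

/-- The bounded family of square-summable functions defined by a function on the total space. -/
def ofFun (ξ : M → ℂ) (h : ∃ C, SqBound s ξ C) : FibreFamily s :=
  ⟨fun x => ⟨fun m => ξ m, memℓp_gen' (C := h.choose ^ 2) fun F => by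
      simp only [rpow_two_toReal]
      exact h.choose_spec.2 x F⟩,
    memℓp_infty ⟨h.choose, by
      rintro _ ⟨x, rfl⟩
      refine lp.norm_le_of_forall_sum_le two_toReal_pos h.choose_spec.1 fun F => ?_
      simp only [rpow_two_toReal]
      exact h.choose_spec.2 x F⟩⟩

theorem toFun_ofFun (ξ : M → ℂ) (h : ∃ C, SqBound s ξ C) (m : M) : toFun (ofFun ξ h) m = ξ m := rfl

theorem norm_le {ξ : FibreFamily s} {C : ℝ} (h : SqBound s (toFun ξ) C) : ‖ξ‖ ≤ C := by
  refine lp.norm_le_of_forall_le h.1 fun x => ?_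
  refine lp.norm_le_of_forall_sum_le two_toReal_pos h.1 fun F => ?_
  simp only [rpow_two_toReal, ← toFun_apply]
  exact h.2 x F

theorem inner_apply (ξ η : FibreFamily s) (x : X) :
    inner ℂ (ξ x) (η x) = ∑' m : s ⁻¹' {x}, conj (toFun ξ m) * toFun η m := by
  rw [lp.inner_eq_tsum]
  simp only [toFun_apply, RCLike.inner_apply, mul_comm]

theorem norm_inner_le (ξ η : FibreFamily s) (x : X) : ‖inner ℂ (ξ x) (η x)‖ ≤ ‖ξ‖ * ‖η‖ :=
  (norm_inner_le_norm _ _).trans (mul_le_mul (norm_apply_le ξ x) (norm_apply_le η x)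
    (norm_nonneg _) (norm_nonneg _))

theorem sqBound_mul {b : M → ℂ} {B : ℝ} (hB : 0 ≤ B) (hb : ∀ m, ‖b m‖ ≤ B) {ξ : M → ℂ} {C : ℝ}
    (hξ : SqBound s ξ C) : SqBound s (fun m => b m * ξ m) (B * C) := by
  refine ⟨mul_nonneg hB hξ.1, fun x F => ?_⟩
  calc ∑ m ∈ F, ‖b m * ξ m‖ ^ 2 ≤ ∑ m ∈ F, B ^ 2 * ‖ξ m‖ ^ 2 := by
        refine Finset.sum_le_sum fun m _ => ?_
        rw [norm_mul, mul_pow]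
        gcongr
        exact hb m
    _ = B ^ 2 * ∑ m ∈ F, ‖ξ m‖ ^ 2 := (Finset.mul_sum _ _ _).symm
    _ ≤ B ^ 2 * C ^ 2 := by
        gcongr
        exact hξ.2 x F
    _ = (B * C) ^ 2 := (mul_pow _ _ _).symm

/-- Pointwise multiplication by a bounded function. -/
def mulOp (b : M → ℂ) (B : ℝ) (hB : 0 ≤ B) (hb : ∀ m, ‖b m‖ ≤ B) :
    FibreFamily s →L[ℂ] FibreFamily s :=
  LinearMap.mkContinuous
    { toFun := fun ξ => ofFun (fun m => b m * toFun ξ m) ⟨_, sqBound_mul hB hb (sqBound ξ)⟩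
      map_add' := fun ξ η => ext fun m => mul_add _ _ _
      map_smul' := fun c ξ => ext fun m => mul_left_comm _ _ _ } B
    fun ξ => norm_le (sqBound_mul hB hb (sqBound ξ))

theorem toFun_mulOp (b : M → ℂ) (B : ℝ) (hB : 0 ≤ B) (hb : ∀ m, ‖b m‖ ≤ B) (ξ : FibreFamily s)
    (m : M) : toFun (mulOp b B hB hb ξ) m = b m * toFun ξ m := rfl

end FibreFamily

open FibreFamily

section Closure

variable [TopologicalSpace M] [T2Space M] [LocallyCompactSpace M] [TopologicalSpace X] [T2Space X]
  {s : M → X}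

theorem exists_sqBound (hs : IsLocalHomeomorph s) (ξ : C_c(M, ℂ)) : ∃ C, SqBound s ξ C := by
  let f : M → ℂ := fun m => ((‖ξ m‖ ^ 2 : ℝ) : ℂ)
  have hf : HasCompactSupport f := ξ.hasCompactSupport.comp_left (g := fun z : ℂ => ((‖z‖ ^ 2 : ℝ) : ℂ))
    (by simp)
  have hfc : Continuous f := by
    have := ξ.continuous
    fun_prop
  obtain ⟨C, hC⟩ := (fibreSum_continuous hs hfc hf).bounded_above_of_compact_support
    (fibreSum_hasCompactSupport hs.continuous hf)
  have hsum : ∀ (x : X) (F : Finset (s ⁻¹' {x})), ∑ m ∈ F, ‖ξ m‖ ^ 2 ≤ max C 0 := by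
    intro x F
    have h1 : Summable fun m : s ⁻¹' {x} => ‖ξ m‖ ^ 2 :=
      Complex.summable_ofReal.1 (hs.summable_fibre hf x)
    refine (h1.sum_le_tsum F fun _ _ => by positivity).trans (le_trans ?_ (le_max_left _ _))
    refine le_trans ?_ (hC x)
    unfold fibreSum
    rw [← Complex.ofReal_tsum, Complex.norm_real]
    exact le_abs_self _
  refine ⟨Real.sqrt (max C 0), Real.sqrt_nonneg _, fun x F => ?_⟩
  rw [Real.sq_sqrt (le_max_right _ _)]
  exact hsum x F

/-- A compactly supported continuous function on the total space as a family of functions on the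
fibres. -/
def ccFamily (hs : IsLocalHomeomorph s) : C_c(M, ℂ) →ₗ[ℂ] FibreFamily s where
  toFun ξ := ofFun ξ (exists_sqBound hs ξ)
  map_add' _ _ := rfl
  map_smul' _ _ := rfl

theorem toFun_ccFamily (hs : IsLocalHomeomorph s) (ξ : C_c(M, ℂ)) (m : M) :
    toFun (ccFamily hs ξ) m = ξ m := rfl

/-- The Hilbert module of a local homeomorphism `s : M → X`: the completion of the space of
compactly supported continuous functions on `M` in the norm of the inner product
`⟨ξ, η⟩(x) = ∑_{s m = x} conj (ξ m) * η m`.  It is realised as a closed subspace of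
the Banach space of bounded families of square-summable functions. -/
def HilbMod (hs : IsLocalHomeomorph s) : Submodule ℂ (FibreFamily s) :=
  (LinearMap.range (ccFamily hs)).topologicalClosure

variable {hs : IsLocalHomeomorph s}

theorem isClosed_hilbMod : IsClosed (HilbMod hs : Set (FibreFamily s)) :=
  Submodule.isClosed_topologicalClosure _

instance : CompleteSpace (HilbMod hs) := isClosed_hilbMod.completeSpace_coe

theorem coe_hilbMod : (HilbMod hs : Set (FibreFamily s)) = closure (range (ccFamily hs)) := rfl

namespace HilbMod

/-- The inclusion of the compactly supported continuous functions. -/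
def ofCc (hs : IsLocalHomeomorph s) : C_c(M, ℂ) →ₗ[ℂ] HilbMod hs :=
  (ccFamily hs).codRestrict (HilbMod hs) fun ξ => subset_closure ⟨ξ, rfl⟩

/-- Elements of the Hilbert module are functions on `M`. -/
instance : CoeFun (HilbMod hs) (fun _ => M → ℂ) := ⟨fun ξ => toFun ξ.1⟩

theorem ofCc_apply (ξ : C_c(M, ℂ)) (m : M) : ofCc hs ξ m = ξ m := rfl

theorem ext {ξ η : HilbMod hs} (h : ∀ m, ξ m = η m) : ξ = η := Subtype.ext (FibreFamily.ext h)

/-- Pointwise multiplication by a bounded continuous function. -/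
def mulOp (b : M → ℂ) (hbc : Continuous b) (B : ℝ) (hB : 0 ≤ B) (hb : ∀ m, ‖b m‖ ≤ B) :
    HilbMod hs →L[ℂ] HilbMod hs :=
  ((FibreFamily.mulOp b B hB hb).comp (HilbMod hs).subtypeL).codRestrict (HilbMod hs) fun ξ => by
    have h : MapsTo (FibreFamily.mulOp (s := s) b B hB hb) (range (ccFamily hs))
        (range (ccFamily hs)) := by
      rintro _ ⟨η, rfl⟩
      exact ⟨⟨⟨fun m => b m * η m, hbc.mul η.continuous⟩, η.hasCompactSupport.mul_left⟩, rfl⟩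
    have h2 := map_mem_closure (FibreFamily.mulOp (s := s) b B hB hb).continuous ξ.2 h
    exact h2

theorem mulOp_apply (b : M → ℂ) (hbc : Continuous b) (B : ℝ) (hB : 0 ≤ B) (hb : ∀ m, ‖b m‖ ≤ B)
    (ξ : HilbMod hs) (m : M) : mulOp b hbc B hB hb ξ m = b m * ξ m := rfl

theorem norm_mulOp_le (b : M → ℂ) (hbc : Continuous b) (B : ℝ) (hB : 0 ≤ B) (hb : ∀ m, ‖b m‖ ≤ B)
    (ξ : HilbMod hs) : ‖mulOp b hbc B hB hb ξ‖ ≤ B * ‖ξ‖ :=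
  norm_le (sqBound_mul hB hb (sqBound ξ.1))

theorem exists_inner_cc (ξ η : C_c(M, ℂ)) :
    ∃ f : C_c(X, ℂ), ∀ x, f x = inner ℂ (ccFamily hs ξ x) (ccFamily hs η x) := by
  have h1 : Continuous fun m => conj (ξ m) * η m :=
    (Complex.continuous_conj.comp ξ.continuous).mul η.continuous
  have h2 : HasCompactSupport fun m => conj (ξ m) * η m := η.hasCompactSupport.mul_left
  refine ⟨⟨⟨_, fibreSum_continuous hs h1 h2⟩, fibreSum_hasCompactSupport hs.continuous h2⟩,
    fun x => ?_⟩
  rw [inner_apply]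
  rfl

theorem exists_inner (ξ η : HilbMod hs) :
    ∃ f : C₀(X, ℂ), ∀ x, f x = inner ℂ (ξ.1 x) (η.1 x) := by
  have happrox : ∀ ε > 0, ∃ f : C_c(X, ℂ), ∀ x, ‖inner ℂ (ξ.1 x) (η.1 x) - f x‖ < ε := by
    intro ε hε
    have hd : 0 < ε / (‖ξ‖ + ‖η‖ + 2) := by positivity
    obtain ⟨δ, hδ, hδ1, hδ2⟩ : ∃ δ > 0, δ ≤ 1 ∧ δ * (‖ξ‖ + ‖η‖ + 2) ≤ ε := by
      refine ⟨min 1 (ε / (‖ξ‖ + ‖η‖ + 2)), lt_min one_pos hd, min_le_left _ _, ?_⟩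
      rw [← le_div_iff₀ (by positivity)]
      exact min_le_right _ _
    obtain ⟨_, ⟨ξ', rfl⟩, hξ⟩ := Metric.mem_closure_iff.1 ξ.2 δ hδ
    obtain ⟨_, ⟨η', rfl⟩, hη⟩ := Metric.mem_closure_iff.1 η.2 δ hδ
    obtain ⟨f, hf⟩ := exists_inner_cc (hs := hs) ξ' η'
    refine ⟨f, fun x => ?_⟩
    rw [hf]
    have e : inner ℂ (ξ.1 x) (η.1 x) - inner ℂ (ccFamily hs ξ' x) (ccFamily hs η' x) =
        inner ℂ ((ξ.1 - ccFamily hs ξ') x) (η.1 x) +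
          inner ℂ (ccFamily hs ξ' x) ((η.1 - ccFamily hs η') x) := by
      change _ = inner ℂ (ξ.1 x - ccFamily hs ξ' x) (η.1 x) +
          inner ℂ (ccFamily hs ξ' x) (η.1 x - ccFamily hs η' x)
      rw [inner_sub_left, inner_sub_right]
      ring
    rw [dist_eq_norm] at hξ hη
    have hξ' : ‖ccFamily hs ξ'‖ ≤ ‖ξ‖ + 1 := by
      have : ccFamily hs ξ' = ξ.1 - (ξ.1 - ccFamily hs ξ') := by abel
      rw [this]
      exact (norm_sub_le _ _).trans (add_le_add le_rfl (hξ.le.trans hδ1))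
    have hη0 : ‖η.1‖ = ‖η‖ := rfl
    rw [e]
    calc _ ≤ ‖inner ℂ ((ξ.1 - ccFamily hs ξ') x) (η.1 x)‖ +
          ‖inner ℂ (ccFamily hs ξ' x) ((η.1 - ccFamily hs η') x)‖ := norm_add_le _ _
      _ ≤ ‖ξ.1 - ccFamily hs ξ'‖ * ‖η.1‖ + ‖ccFamily hs ξ'‖ * ‖η.1 - ccFamily hs η'‖ :=
          add_le_add (norm_inner_le _ _ _) (norm_inner_le _ _ _)
      _ ≤ δ * ‖η‖ + (‖ξ‖ + 1) * δ := by
          rw [hη0]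
          gcongr
      _ < ε := by nlinarith [norm_nonneg ξ, norm_nonneg η]
  have hcont : Continuous fun x => inner ℂ (ξ.1 x) (η.1 x) := by
    refine continuous_of_uniform_approx_of_continuous fun u hu => ?_
    obtain ⟨ε, hε, hu⟩ := Metric.mem_uniformity_dist.1 hu
    obtain ⟨f, hf⟩ := happrox ε hε
    exact ⟨f, f.continuous, fun x => hu (by rw [dist_eq_norm]; exact hf x)⟩
  refine ⟨⟨⟨_, hcont⟩, ?_⟩, fun x => rfl⟩
  rw [Metric.tendsto_nhds]
  intro ε hε
  obtain ⟨f, hf⟩ := happrox ε hε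
  filter_upwards [f.hasCompactSupport.isCompact.compl_mem_cocompact] with x hx
  have h0 : f x = 0 := image_eq_zero_of_notMem_tsupport hx
  have := hf x
  rw [h0] at this
  rw [dist_eq_norm]
  exact this

/-- The inner product with values in `C₀(X, ℂ)`, which is conjugate-linear in the first
variable. -/
def innerC (ξ η : HilbMod hs) : C₀(X, ℂ) := (exists_inner ξ η).choose

theorem innerC_eq (ξ η : HilbMod hs) (x : X) : innerC ξ η x = inner ℂ (ξ.1 x) (η.1 x) :=
  (exists_inner ξ η).choose_spec x

theorem innerC_apply (ξ η : HilbMod hs) (x : X) :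
    innerC ξ η x = ∑' m : s ⁻¹' {x}, conj (ξ m) * η m := by
  rw [innerC_eq, inner_apply]

theorem norm_c0_apply_le (f : C₀(X, ℂ)) (x : X) : ‖f x‖ ≤ ‖f‖ := by
  rw [← ZeroAtInftyContinuousMap.norm_toBCF_eq_norm]
  exact f.toBCF.norm_coe_le_norm x

theorem norm_innerC_le (ξ η : HilbMod hs) : ‖innerC ξ η‖ ≤ ‖ξ‖ * ‖η‖ := by
  rw [← ZeroAtInftyContinuousMap.norm_toBCF_eq_norm]
  refine (BoundedContinuousFunction.norm_le (by positivity)).2 fun x => ?_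
  change ‖innerC ξ η x‖ ≤ _
  rw [innerC_eq]
  exact norm_inner_le _ _ _

/-- Pointwise multiplication by `f ∘ r` for `f` in `C₀(X, ℂ)`; this gives the left action of
`C₀(X, ℂ)` if `r` is the range map, and the right action if `r` is the source map. -/
def act {r : M → X} (hr : Continuous r) (f : C₀(X, ℂ)) : HilbMod hs →L[ℂ] HilbMod hs :=
  mulOp (fun m => f (r m)) (f.continuous.comp hr) ‖f‖ (norm_nonneg f)
    fun m => norm_c0_apply_le f (r m)

theorem act_apply {r : M → X} (hr : Continuous r) (f : C₀(X, ℂ)) (ξ : HilbMod hs) (m : M) :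
    act hr f ξ m = f (r m) * ξ m := rfl

theorem norm_act_le {r : M → X} (hr : Continuous r) (f : C₀(X, ℂ)) (ξ : HilbMod hs) :
    ‖act hr f ξ‖ ≤ ‖f‖ * ‖ξ‖ := norm_mulOp_le _ _ _ _ _ _

/-- The rank-one operator `ζ ↦ ξ ⟨η, ζ⟩`. -/
def rankOne (ξ η : HilbMod hs) : HilbMod hs →L[ℂ] HilbMod hs :=
  LinearMap.mkContinuous
    { toFun := fun ζ => act hs.continuous (innerC η ζ) ξ
      map_add' := fun ζ ζ' => ext fun m => by
        change innerC η (ζ + ζ') (s m) * ξ m =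
          innerC η ζ (s m) * ξ m + innerC η ζ' (s m) * ξ m
        rw [innerC_eq, innerC_eq, innerC_eq, ← add_mul, ← inner_add_right]
        rfl
      map_smul' := fun c ζ => ext fun m => by
        change innerC η (c • ζ) (s m) * ξ m = c * (innerC η ζ (s m) * ξ m)
        rw [innerC_eq, innerC_eq, ← mul_assoc, ← inner_smul_right]
        rfl } (‖ξ‖ * ‖η‖) fun ζ => by
    refine (norm_act_le hs.continuous (innerC η ζ) ξ).trans ?_
    calc ‖innerC η ζ‖ * ‖ξ‖ ≤ ‖η‖ * ‖ζ‖ * ‖ξ‖ := by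
          gcongr
          exact norm_innerC_le η ζ
      _ = ‖ξ‖ * ‖η‖ * ‖ζ‖ := by ring

theorem rankOne_apply (ξ η ζ : HilbMod hs) (m : M) :
    rankOne ξ η ζ m = innerC η ζ (s m) * ξ m := rfl

/-- The compact operators on the Hilbert module: the closed linear span of the rank-one
operators. -/
def compacts (hs : IsLocalHomeomorph s) : Submodule ℂ (HilbMod hs →L[ℂ] HilbMod hs) :=
  (Submodule.span ℂ (range fun a : HilbMod hs × HilbMod hs => rankOne a.1 a.2)).topologicalClosure

/-- A rank-one operator as a compact operator. -/
def compactRankOne (ξ η : HilbMod hs) : compacts hs :=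
  ⟨rankOne ξ η, Submodule.le_topologicalClosure _ (Submodule.subset_span ⟨(ξ, η), rfl⟩)⟩

theorem sqBound_injective {B : ℝ} (hB : 0 ≤ B) {f : M → ℂ} (hinj : Function.Injective s)
    (hf : ∀ m, ‖f m‖ ≤ B) : SqBound s f B := by
  refine ⟨hB, fun x F => ?_⟩
  have : Subsingleton (s ⁻¹' {x}) :=
    ⟨fun a b => Subtype.ext (hinj ((mem_singleton_iff.1 a.2).trans (mem_singleton_iff.1 b.2).symm))⟩
  rcases F.eq_empty_or_nonempty with rfl | ⟨m, hm⟩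
  · simpa using sq_nonneg B
  · have hF : F = {m} := Finset.eq_singleton_iff_unique_mem.2 ⟨hm, fun _ _ => Subsingleton.elim _ _⟩
    rw [hF, Finset.sum_singleton]
    exact pow_le_pow_left₀ (norm_nonneg _) (hf m) 2

theorem sqBound_c0 (hinj : Function.Injective s) (f : C₀(M, ℂ)) : SqBound s f ‖f‖ :=
  sqBound_injective (norm_nonneg f) hinj (norm_c0_apply_le f)

theorem c0_mem (hs : IsLocalHomeomorph s) (hinj : Function.Injective s) (f : C₀(M, ℂ)) :
    ofFun f ⟨_, sqBound_c0 hinj f⟩ ∈ HilbMod hs := by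
  refine Metric.mem_closure_iff.2 fun ε hε => ?_
  obtain ⟨K, hK, hfK⟩ : ∃ K : Set M, IsCompact K ∧ ∀ m ∉ K, ‖f m‖ < ε / 2 := by
    have h := Metric.tendsto_nhds.1 f.zero_at_infty' (ε / 2) (by positivity)
    obtain ⟨K, hK, hKs⟩ := mem_cocompact.1 h
    exact ⟨K, hK, fun m hm => by simpa [dist_eq_norm] using hKs hm⟩
  obtain ⟨g, hg1, -, hgc, hg01⟩ :=
    exists_continuous_one_zero_of_isCompact hK isClosed_empty (disjoint_empty K)
  let h : C_c(M, ℂ) := ⟨⟨fun m => (g m : ℂ) * f m,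
    (Complex.continuous_ofReal.comp g.continuous).mul f.continuous⟩,
    HasCompactSupport.mul_right (hgc.comp_left (g := fun x : ℝ => (x : ℂ)) (by simp))⟩
  refine ⟨ccFamily hs h, ⟨h, rfl⟩, ?_⟩
  rw [dist_eq_norm]
  refine lt_of_le_of_lt (b := ε / 2) (norm_le (sqBound_injective (by positivity) hinj fun m => ?_))
    (by linarith)
  change ‖f m - (g m : ℂ) * f m‖ ≤ ε / 2
  by_cases hm : m ∈ K
  · have : g m = 1 := hg1 hm
    rw [this]
    simpa using (half_pos hε).le
  · have e : f m - (g m : ℂ) * f m = ((1 - g m : ℝ) : ℂ) * f m := by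
      push_cast
      ring
    have h01 := hg01 m
    rw [e, norm_mul, Complex.norm_real, Real.norm_eq_abs, abs_of_nonneg (by linarith [h01.2])]
    nlinarith [hfK m hm, norm_nonneg (f m), h01.1, h01.2]

/-- A continuous function vanishing at infinity defines an element of the Hilbert module
if `s` is injective. -/
def ofC0 (hs : IsLocalHomeomorph s) (hinj : Function.Injective s) :
    C₀(M, ℂ) →ₗ[ℂ] HilbMod hs where
  toFun f := ⟨ofFun f ⟨_, sqBound_c0 hinj f⟩, c0_mem hs hinj f⟩
  map_add' _ _ := rfl
  map_smul' _ _ := rfl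

theorem ofC0_apply (hinj : Function.Injective s) (f : C₀(M, ℂ)) (m : M) :
    ofC0 hs hinj f m = f m := rfl

end HilbMod

end Closure

section Product

variable [TopologicalSpace M] [T2Space M] [LocallyCompactSpace M]
  [TopologicalSpace N] [T2Space N] [LocallyCompactSpace N]
  [TopologicalSpace L] [T2Space L] [LocallyCompactSpace L] [TopologicalSpace X] [T2Space X]
  {s : M → X} {s' r' : N → X} {t : L → X} {l : L → M} {k : L → N}

theorem sqBound_prod (hs : ∀ a, s (l a) = r' (k a)) (ht : ∀ a, s' (k a) = t a)
    (hlk : Function.Injective fun a => (l a, k a)) {ξ : M → ℂ} {η : N → ℂ} {C D : ℝ}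
    (hξ : SqBound s ξ C) (hη : SqBound s' η D) :
    SqBound t (fun a => ξ (l a) * η (k a)) (C * D) := by
  classical
  refine ⟨mul_nonneg hξ.1 hη.1, fun x F => ?_⟩
  let κ : t ⁻¹' {x} → s' ⁻¹' {x} := fun a => ⟨k a, (ht a).trans a.2⟩
  have h1 : ∀ n : s' ⁻¹' {x}, ∑ a ∈ F with κ a = n, ‖ξ (l a)‖ ^ 2 ≤ C ^ 2 := by
    intro n
    let lam : {a : t ⁻¹' {x} // κ a = n} → s ⁻¹' {r' n} := fun a => ⟨l a, by
      have h2 : k a.1 = n := congrArg Subtype.val a.2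
      rw [mem_preimage, hs, h2]
      rfl⟩
    have hinj : Function.Injective lam := by
      intro a b hab
      have h2 : k a.1 = n := congrArg Subtype.val a.2
      have h3 : k b.1 = n := congrArg Subtype.val b.2
      exact Subtype.ext (Subtype.ext (hlk (Prod.ext (congrArg Subtype.val hab) (h2.trans h3.symm))))
    have h2 := hξ.2 (r' n) ((F.subtype fun a => κ a = n).image lam)
    rw [Finset.sum_image fun a _ b _ h => hinj h] at h2
    rwa [← Finset.sum_subtype_eq_sum_filter]
  calc ∑ a ∈ F, ‖ξ (l a) * η (k a)‖ ^ 2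
      = ∑ n ∈ F.image κ, ∑ a ∈ F with κ a = n, ‖ξ (l a) * η (k a)‖ ^ 2 :=
        (Finset.sum_fiberwise_of_maps_to (fun a ha => Finset.mem_image_of_mem κ ha) _).symm
    _ = ∑ n ∈ F.image κ, (∑ a ∈ F with κ a = n, ‖ξ (l a)‖ ^ 2) * ‖η n‖ ^ 2 := by
        refine Finset.sum_congr rfl fun n _ => ?_
        rw [Finset.sum_mul]
        refine Finset.sum_congr rfl fun a ha => ?_
        have h2 : k a = n := congrArg Subtype.val (Finset.mem_filter.1 ha).2
        rw [norm_mul, mul_pow, h2]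
    _ ≤ ∑ n ∈ F.image κ, C ^ 2 * ‖η n‖ ^ 2 := by
        gcongr with n
        exact h1 n
    _ = C ^ 2 * ∑ n ∈ F.image κ, ‖η n‖ ^ 2 := (Finset.mul_sum _ _ _).symm
    _ ≤ C ^ 2 * D ^ 2 := by
        gcongr
        exact hη.2 x _
    _ = (C * D) ^ 2 := (mul_pow _ _ _).symm

/-- The product `(ξ η)(a) = ξ (l a) * η (k a)` as a bounded bilinear map. -/
def FibreFamily.prod (hs : ∀ a, s (l a) = r' (k a)) (ht : ∀ a, s' (k a) = t a)
    (hlk : Function.Injective fun a => (l a, k a)) :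
    FibreFamily s →L[ℂ] FibreFamily s' →L[ℂ] FibreFamily t :=
  LinearMap.mkContinuous₂
    (LinearMap.mk₂ ℂ (fun ξ η => ofFun (fun a => toFun ξ (l a) * toFun η (k a))
      ⟨_, sqBound_prod hs ht hlk (sqBound ξ) (sqBound η)⟩)
      (fun _ _ _ => FibreFamily.ext fun _ => add_mul _ _ _)
      (fun _ _ _ => FibreFamily.ext fun _ => mul_assoc _ _ _)
      (fun _ _ _ => FibreFamily.ext fun _ => mul_add _ _ _)
      (fun _ _ _ => FibreFamily.ext fun _ => mul_left_comm _ _ _)) 1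
    fun ξ η => by
      rw [one_mul]
      exact norm_le (sqBound_prod hs ht hlk (sqBound ξ) (sqBound η))

variable {hs : IsLocalHomeomorph s} {hs' : IsLocalHomeomorph s'} {ht : IsLocalHomeomorph t}

/-- The product `(ξ η)(a) = ξ (l a) * η (k a)` of elements of Hilbert modules. -/
def HilbMod.prod (hsl : ∀ a, s (l a) = r' (k a)) (htk : ∀ a, s' (k a) = t a)
    (hlk : IsClosedEmbedding fun a => (l a, k a)) (ξ : HilbMod hs) (η : HilbMod hs') :
    HilbMod ht :=
  ⟨FibreFamily.prod hsl htk hlk.injective ξ.1 η.1, by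
    have hc : Continuous (Function.uncurry fun (ξ : FibreFamily s) (η : FibreFamily s') =>
        FibreFamily.prod (t := t) hsl htk hlk.injective ξ η) :=
      (FibreFamily.prod hsl htk hlk.injective).continuous₂
    have h : ∀ ξ₀ ∈ range (ccFamily hs), ∀ η₀ ∈ range (ccFamily hs'),
        FibreFamily.prod (t := t) hsl htk hlk.injective ξ₀ η₀ ∈ range (ccFamily ht) := by
      rintro _ ⟨ξ, rfl⟩ _ ⟨η, rfl⟩
      have h1 : Continuous fun a => ξ (l a) * η (k a) :=
        (ξ.continuous.comp (continuous_fst.comp hlk.continuous)).mul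
          (η.continuous.comp (continuous_snd.comp hlk.continuous))
      have h2 : HasCompactSupport fun a => ξ (l a) * η (k a) := by
        refine HasCompactSupport.intro (hlk.isCompact_preimage
          (ξ.hasCompactSupport.isCompact.prod η.hasCompactSupport.isCompact)) fun a ha => ?_
        by_contra h
        exact ha ⟨subset_tsupport _ (left_ne_zero_of_mul h),
          subset_tsupport _ (right_ne_zero_of_mul h)⟩
      exact ⟨⟨⟨_, h1⟩, h2⟩, rfl⟩
    have h3 := map_mem_closure₂ hc ξ.2 η.2 h
    exact h3⟩

theorem HilbMod.prod_apply (hsl : ∀ a, s (l a) = r' (k a)) (htk : ∀ a, s' (k a) = t a)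
    (hlk : IsClosedEmbedding fun a => (l a, k a)) (ξ : HilbMod hs) (η : HilbMod hs') (a : L) :
    (HilbMod.prod hsl htk hlk ξ η : HilbMod ht) a = ξ (l a) * η (k a) := rfl

end Product

end HilbertModule

/-! ## The product system of an action and its Cuntz–Pimsner algebra -/

noncomputable section CuntzPimsner

namespace CorrespondenceAction

variable {P : Type*} [Monoid P] {X : Type*} [TopologicalSpace X] [T2Space X]
  (𝓐 : CorrespondenceAction P X)

/-- The C⋆-correspondence of the topological correspondence `M p`: the completion of the space of
compactly supported continuous functions on `M p`, with the inner product `HilbMod.innerC`. -/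
abbrev Hilb (p : P) : Type _ := HilbMod (𝓐.isLocalHomeomorph_s p)

variable {𝓐}

/-- The image of a compactly supported continuous function on `M p` in `Hilb p`. -/
def ofCc {p : P} (ξ : C_c(𝓐.M p, ℂ)) : 𝓐.Hilb p := HilbMod.ofCc _ ξ

/-- The left action of `C₀(X, ℂ)`, given by `(f ξ)(m) = f (r p m) * ξ m`. -/
def leftAct (p : P) (f : C₀(X, ℂ)) : 𝓐.Hilb p →L[ℂ] 𝓐.Hilb p :=
  HilbMod.act (𝓐.continuous_r p) f

theorem leftAct_apply (p : P) (f : C₀(X, ℂ)) (ξ : 𝓐.Hilb p) (m : 𝓐.M p) :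
    leftAct p f ξ m = f (𝓐.r p m) * ξ m := rfl

theorem isClosedEmbedding_cut {p q w : P} (h : p * q = w) :
    IsClosedEmbedding fun m : 𝓐.M w => (𝓐.cutL h m, 𝓐.cutR h m) := by
  have h1 : IsClosed {x : 𝓐.M p × 𝓐.M q | 𝓐.s p x.1 = 𝓐.r q x.2} :=
    isClosed_eq ((𝓐.continuous_s p).comp continuous_fst) ((𝓐.continuous_r q).comp continuous_snd)
  exact h1.isClosedEmbedding_subtypeVal.comp
    (IsHomeomorph.homeomorph _ (𝓐.isHomeomorph_cut h)).isClosedEmbedding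

/-- The multiplication maps of the product system, `(ξ η)(m) = ξ (cutL m) * η (cutR m)`. -/
def prodHilb {p q w : P} (h : p * q = w) (ξ : 𝓐.Hilb p) (η : 𝓐.Hilb q) : 𝓐.Hilb w :=
  HilbMod.prod (𝓐.s_cutL h) (𝓐.s_cutR h) (isClosedEmbedding_cut h) ξ η

theorem prodHilb_apply {p q w : P} (h : p * q = w) (ξ : 𝓐.Hilb p) (η : 𝓐.Hilb q) (m : 𝓐.M w) :
    prodHilb h ξ η m = ξ (𝓐.cutL h m) * η (𝓐.cutR h m) := rfl

theorem injective_s_one : Function.Injective (𝓐.s 1) := by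
  rw [← 𝓐.r_one_eq_s_one]
  exact 𝓐.isHomeomorph_r_one.injective

/-- The identification of `C₀(X, ℂ)` with the unit fibre `Hilb 1` of the product system. -/
def unitHilb (f : C₀(X, ℂ)) : 𝓐.Hilb 1 :=
  HilbMod.ofC0 _ injective_s_one
    (f.comp ⟨⟨𝓐.r 1, 𝓐.continuous_r 1⟩, (𝓐.isHomeomorph_r_one.homeomorph).isClosedEmbedding.tendsto_cocompact⟩)

theorem unitHilb_apply (f : C₀(X, ℂ)) (m : 𝓐.M 1) : unitHilb f m = f (𝓐.r 1 m) := rfl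

theorem prodHilb_unitHilb {p : P} (f : C₀(X, ℂ)) (ξ : 𝓐.Hilb p) :
    prodHilb (one_mul p) (unitHilb f) ξ = leftAct p f ξ :=
  HilbMod.ext fun m => by
    rw [prodHilb_apply, unitHilb_apply, leftAct_apply, 𝓐.r_cutL, 𝓐.cutR_one]

variable (𝓐)

/-- A Cuntz–Pimsner covariant representation in the C⋆-algebra `B` of the product system formed by
the C⋆-correspondences `Hilb p` and the multiplication maps `prodHilb`.  It consists of a
star-homomorphism `π` on `C₀(X, ℂ)` and linear maps `S p` on `Hilb p`, where `S 1` is `π`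
under the identification of `Hilb 1` with `C₀(X, ℂ)`, which are compatible with the inner
products and the multiplication; the left action is the case `p = 1` of `S_mul_S`.
Covariance says that the map `θ` on the compact operators on `Hilb p` that maps the rank-one
operator of `ξ, η` to `S p ξ * star (S p η)` maps the operator `leftAct p f` to `π f` whenever it
is compact. -/
structure CovariantRep (B : Type*) [NonUnitalCStarAlgebra B] where
  π : C₀(X, ℂ) →⋆ₙₐ[ℂ] B
  S : ∀ p, 𝓐.Hilb p →ₗ[ℂ] B
  S_one : ∀ f, S 1 (unitHilb f) = π f
  star_S_mul_S : ∀ (p : P) (ξ η : 𝓐.Hilb p), star (S p ξ) * S p η = π (HilbMod.innerC ξ η)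
  S_mul_S : ∀ {p q w : P} (h : p * q = w) (ξ : 𝓐.Hilb p) (η : 𝓐.Hilb q),
    S p ξ * S q η = S w (prodHilb h ξ η)
  covariant : ∀ p, ∃ θ : HilbMod.compacts (𝓐.isLocalHomeomorph_s p) →L[ℂ] B,
    (∀ ξ η, θ (HilbMod.compactRankOne ξ η) = S p ξ * star (S p η)) ∧
    ∀ (f : C₀(X, ℂ)) (T : HilbMod.compacts (𝓐.isLocalHomeomorph_s p)),
      T.1 = leftAct p f → θ T = π f

/-- The C⋆-seminorms on the free star-algebra on the elements of the product system for which
the generators give a Cuntz–Pimsner covariant representation in the completion. -/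
def covariantSeminorms : Set (CStarSeminorm (FreeStarAlgebra (Σ p, 𝓐.Hilb p))) :=
  {N | ∃ R : 𝓐.CovariantRep N.Completion,
    ∀ p ξ, R.S p ξ = N.toCompletion (FreeStarAlgebra.gen ⟨p, ξ⟩)}

/-- The Cuntz–Pimsner algebra of the product system: the universal C⋆-algebra for
Cuntz–Pimsner covariant representations.  It is the completion of the free star-algebra on the
elements of the product system in the largest C⋆-seminorm for which the generators give
a covariant representation. -/
abbrev CuntzPimsner : Type _ := (CStarSeminorm.sup 𝓐.covariantSeminorms).Completion

variable {𝓐}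

/-- The canonical map from `Hilb p` to the Cuntz–Pimsner algebra. -/
def toCuntzPimsner (p : P) (ξ : 𝓐.Hilb p) : 𝓐.CuntzPimsner :=
  (CStarSeminorm.sup 𝓐.covariantSeminorms).toCompletion (FreeStarAlgebra.gen ⟨p, ξ⟩)

end CorrespondenceAction

end CuntzPimsner

/-!
# The groupoid C⋆-algebra of an action by proper correspondences

Both algebras are universal, and the isomorphism comes from comparing their representations.
A representation of the product system in a C⋆-algebra `B` and a star-homomorphism from the
convolution algebra `C_c(H¹)` to `B` turn out to be the same thing: the star-homomorphism `j`
corresponds to the representation with `S p ξ = j (arrowConv ξ)`, where `arrowConv ξ` is the function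
with values `ξ (x.proj p)` on the arrows `(x, p, shift p x)`.

That the functions `arrowConv ξ` satisfy the relations of the product system is a computation with
convolutions (`groupoidRep`).  A representation by compactly supported functions in a C⋆-algebra is
contractive and hence extends to the Hilbert modules (`CcRep.toPreRep`).  The covariance condition
is used in an algebraic form, for those operators `leftAct p f` that are sums of rank-one
operators of compactly supported functions; by a norm estimate for operators of finite rank
(`norm_sum_mul_star_le`), this implies the condition on all compact operators
(`PreRep.toCovariantRep`), and it obviously survives suprema of seminorms.

The main step is to extend a representation `R` in `B` to the convolution algebra
(`PreRep.convHom`).  Consider the subalgebra `E` of `C_c(H¹) × B` that is generated by the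
pairs `(arrowConv ξ, S p ξ)`.  By covariance and the right Ore conditions, `E` is graded by the group
of fractions, and its part of degree `g` is the directed union of the spans of the elements
`S p ξ * star (S q η)` with `p q⁻¹ = g`.  It has to be shown that `E` is the graph of a densely
defined map that is bounded on functions with support in a fixed compact set.

* On functions on units: `S 1` kills every function on `X` that vanishes at all points with a
  complete history (`PreRep.S_ccPull_eq_zero`).  Indeed, a projective limit of nonempty compact
  spaces is nonempty, so such a function `f` is uniformly small on the image of `r p` for suitable
  `p`, and covariance gives the norm estimate.  It follows that `E` is a graph on homogeneous
  elements, and truncation of functions on `M p` shows that the map is contractive on functions on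
  units (`PreRep.norm_snd_le_of_units`).
* In general: the C⋆-identity `‖b‖ ^ 2 = ‖star b * b‖` carries the estimate over to functions
  supported on bisections, and a partition of unity gives a bound `C * ‖f‖` for functions
  supported in a compact set, where `C` depends only on this set
  (`IsControlled.exists_norm_snd_le`).  The same estimate, applied to the graph of an arbitrary
  star-homomorphism on `C_c(H¹)`, shows that the full C⋆-norm is finite.
* Density: over a fixed element `g` of the group of fractions, arrows are separated by the functions
  `ξ (x.proj p)` and `ξ (y.proj p)` of their range `x` and source `y`.  These functions act on
  `E` by multiplication, and the Stone–Weierstrass theorem applies (`isApproximable`).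

Passing to limits, `E` extends to a star-homomorphism on `C_c(H¹)`.  The universal properties of
the two completions now give homomorphisms in both directions (`PreRep.cuntzPimsnerHom` and
`fromCStar`).  They are inverse to each other since they match the generators, and a
star-homomorphism on either side is determined by its values on these
(`cuntzPimsner_hom_ext`, `PreRep.eq_convHom`).
-/

/-! ### Completions in C⋆-seminorms and free star-algebras -/

noncomputable section CompletionExtension

namespace CStarSeminorm

variable {A : Type*} [NonUnitalRing A] [StarRing A] [Module ℂ A] [IsScalarTower ℂ A A]
  [SMulCommClass ℂ A A] [StarModule ℂ A] {B : Type*} [NonUnitalCStarAlgebra B]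

/-- The C⋆-seminorm induced by a star-homomorphism to a C⋆-algebra. -/
def pullback (j : A →⋆ₙₐ[ℂ] B) : CStarSeminorm A where
  toFun a := ‖j a‖
  map_zero' := by simp
  add_le' a b := by rw [map_add]; exact norm_add_le _ _
  neg' a := by rw [map_neg, norm_neg]
  smul' c a := by rw [map_smul, norm_smul]
  mul_le' a b := by rw [map_mul]; exact norm_mul_le _ _
  star_mul_self' a := by
    rw [map_mul, map_star, CStarRing.norm_star_mul_self]

theorem pullback_apply (j : A →⋆ₙₐ[ℂ] B) (a : A) : pullback j a = ‖j a‖ := rfl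

variable {N : CStarSeminorm A}

theorem toCompletion_apply (a : A) : N.toCompletion a = Completion.mk N a := rfl

theorem norm_toCompletion (a : A) : ‖N.toCompletion a‖ = N a := Completion.norm_mk a

theorem denseRange_toCompletion : DenseRange N.toCompletion := Completion.denseRange_mk

/-- The underlying continuous linear map of `extend`. -/
def extendL (j : A →⋆ₙₐ[ℂ] B) : N.Completion →L[ℂ] B :=
  LinearMap.extendOfNorm (j : A →ₗ[ℂ] B) (N.toCompletion : A →ₗ[ℂ] N.Completion)

theorem extendL_apply (j : A →⋆ₙₐ[ℂ] B) (hj : ∀ a, ‖j a‖ ≤ N a) (a : A) :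
    extendL (N := N) j (N.toCompletion a) = j a :=
  LinearMap.extendOfNorm_eq (f := (j : A →ₗ[ℂ] B)) (e := (N.toCompletion : A →ₗ[ℂ] N.Completion))
    denseRange_toCompletion ⟨1, fun x => by
      rw [one_mul]
      exact (hj x).trans (norm_toCompletion x).ge⟩ a

/-- The extension to the completion of a star-homomorphism to a C⋆-algebra that is bounded by
the seminorm. -/
def extend (j : A →⋆ₙₐ[ℂ] B) (hj : ∀ a, ‖j a‖ ≤ N a) : N.Completion →⋆ₙₐ[ℂ] B where
  toFun := extendL j
  map_smul' c x := map_smul (extendL j) c x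
  map_zero' := map_zero (extendL j)
  map_add' := map_add (extendL j)
  map_mul' x y := by
    refine Completion.induction_on x (isClosed_eq (by fun_prop) (by fun_prop)) fun a => ?_
    refine Completion.induction_on y (isClosed_eq (by fun_prop) (by fun_prop)) fun b => ?_
    rw [← Completion.mk_mul, ← toCompletion_apply, ← toCompletion_apply, ← toCompletion_apply,
      extendL_apply j hj, extendL_apply j hj, extendL_apply j hj, map_mul]
  map_star' x := by
    refine Completion.induction_on x (isClosed_eq (by fun_prop) (by fun_prop)) fun a => ?_
    rw [← Completion.mk_star, ← toCompletion_apply, ← toCompletion_apply,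
      extendL_apply j hj, extendL_apply j hj, map_star]

theorem extend_toCompletion (j : A →⋆ₙₐ[ℂ] B) (hj : ∀ a, ‖j a‖ ≤ N a) (a : A) :
    extend (N := N) j hj (N.toCompletion a) = j a := extendL_apply j hj a

theorem continuous_extend (j : A →⋆ₙₐ[ℂ] B) (hj : ∀ a, ‖j a‖ ≤ N a) :
    Continuous (extend (N := N) j hj) := (extendL (N := N) j).continuous

variable {𝒩 : Set (CStarSeminorm A)}

theorem sup_apply (hne : 𝒩.Nonempty) (hb : ∀ a, ∃ C, ∀ N ∈ 𝒩, N a ≤ C) (a : A) :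
    sup 𝒩 a = ⨆ N : 𝒩, N.1 a := by
  have h : 𝒩.Nonempty ∧ ∀ a, BddAbove (range fun N : 𝒩 => N.1 a) := by
    refine ⟨hne, fun a => ?_⟩
    obtain ⟨C, hC⟩ := hb a
    exact ⟨C, by rintro _ ⟨N, rfl⟩; exact hC N.1 N.2⟩
  unfold sup
  rw [dif_pos h]
  rfl

theorem le_sup (hb : ∀ a, ∃ C, ∀ N ∈ 𝒩, N a ≤ C) {N : CStarSeminorm A} (hN : N ∈ 𝒩) (a : A) :
    N a ≤ sup 𝒩 a := by
  rw [sup_apply ⟨N, hN⟩ hb]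
  obtain ⟨C, hC⟩ := hb a
  exact le_ciSup (f := fun N : 𝒩 => N.1 a) ⟨C, by rintro _ ⟨N, rfl⟩; exact hC N.1 N.2⟩ ⟨N, hN⟩

theorem sup_le (hne : 𝒩.Nonempty) (hb : ∀ a, ∃ C, ∀ N ∈ 𝒩, N a ≤ C) {a : A} {C : ℝ}
    (h : ∀ N ∈ 𝒩, N a ≤ C) : sup 𝒩 a ≤ C := by
  rw [sup_apply hne hb]
  have := hne.to_subtype
  exact ciSup_le fun N => h N.1 N.2

end CStarSeminorm

namespace FreeStarAlgebra

variable {Gen : Type*} {B : Type*} [NonUnitalRing B] [StarRing B] [Module ℂ B]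
  [IsScalarTower ℂ B B] [SMulCommClass ℂ B B] [StarModule ℂ B]

/-- The multiplicative map on words that extends a map on generators. -/
def liftWord (b : Gen → B) : FreeSemigroup (Gen × Bool) →ₙ* B :=
  FreeSemigroup.lift fun x => if x.2 then b x.1 else star (b x.1)

theorem liftWord_rev (b : Gen → B) (w : FreeSemigroup (Gen × Bool)) :
    liftWord b (rev w).unop = star (liftWord b w) := by
  induction w using FreeSemigroup.recOnMul with
  | ih1 x => obtain ⟨x, _ | _⟩ := x <;> simp [rev, liftWord]
  | ih2 x y hx hy => rw [map_mul, MulOpposite.unop_mul, map_mul, map_mul, hx, hy, star_mul]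

theorem star_single (w : FreeSemigroup (Gen × Bool)) (c : ℂ) :
    star (MonoidAlgebra.single w c : FreeStarAlgebra Gen) =
      MonoidAlgebra.single (rev w).unop (conj c) := starHom_single w c

theorem liftMagma_single (b : Gen → B) (w : FreeSemigroup (Gen × Bool)) (c : ℂ) :
    MonoidAlgebra.liftMagma ℂ (liftWord b) (MonoidAlgebra.single w c) = c • liftWord b w := by
  simp [MonoidAlgebra.liftMagma]

/-- The star-homomorphism on the free star-algebra that extends a map on generators. -/
def lift (b : Gen → B) : FreeStarAlgebra Gen →⋆ₙₐ[ℂ] B :=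
  { MonoidAlgebra.liftMagma ℂ (liftWord b) with
    map_star' := fun f => by
      change MonoidAlgebra.liftMagma ℂ (liftWord b) (star f) =
        star (MonoidAlgebra.liftMagma ℂ (liftWord b) f)
      induction f using MonoidAlgebra.induction_linear with
      | zero => simp
      | add f g hf hg => rw [star_add, map_add, hf, hg, map_add, star_add]
      | single w c =>
        rw [star_single, liftMagma_single, liftMagma_single, star_smul, liftWord_rev]
        rfl }

theorem lift_gen (b : Gen → B) (x : Gen) : lift b (gen x) = b x := by
  refine (liftMagma_single b _ _).trans ?_
  simp [liftWord]

theorem star_gen (x : Gen) :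
    star (gen x) = MonoidAlgebra.single (FreeSemigroup.of (x, false)) 1 := by
  rw [gen, star_single]
  simp [rev]

/-- Induction on elements of the free star-algebra. -/
theorem induction_on {motive : FreeStarAlgebra Gen → Prop} (f : FreeStarAlgebra Gen)
    (gen : ∀ x, motive (gen x)) (star : ∀ f, motive f → motive (star f))
    (zero : motive 0)
    (add : ∀ f g, motive f → motive g → motive (f + g))
    (mul : ∀ f g, motive f → motive g → motive (f * g))
    (smul : ∀ (c : ℂ) f, motive f → motive (c • f)) : motive f := by
  induction f using MonoidAlgebra.induction_linear with
  | zero => exact zero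
  | add f g hf hg => exact add f g hf hg
  | single w c =>
    have h : motive (MonoidAlgebra.single w 1) := by
      induction w using FreeSemigroup.recOnMul with
      | ih1 x =>
        obtain ⟨x, _ | _⟩ := x
        · rw [← star_gen]
          exact star _ (gen x)
        · exact gen x
      | ih2 x y hx hy =>
        have := mul _ _ hx hy
        rwa [MonoidAlgebra.single_mul_single, one_mul] at this
    have := smul c _ h
    rwa [MonoidAlgebra.smul_single, smul_eq_mul, mul_one] at this

/-- Star-homomorphisms on the free star-algebra are determined by their values on generators. -/
theorem hom_ext {F : Type*} [FunLike F (FreeStarAlgebra Gen) B]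
    [NonUnitalAlgHomClass F ℂ (FreeStarAlgebra Gen) B] [StarHomClass F (FreeStarAlgebra Gen) B]
    {F' : Type*} [FunLike F' (FreeStarAlgebra Gen) B]
    [NonUnitalAlgHomClass F' ℂ (FreeStarAlgebra Gen) B] [StarHomClass F' (FreeStarAlgebra Gen) B]
    (φ : F) (ψ : F') (h : ∀ x, φ (gen x) = ψ (gen x)) (f : FreeStarAlgebra Gen) : φ f = ψ f := by
  induction f using induction_on with
  | gen x => exact h x
  | star f hf => rw [map_star, map_star, hf]
  | zero => rw [map_zero, map_zero]
  | add f g hf hg => rw [map_add, map_add, hf, hg]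
  | mul f g hf hg => rw [map_mul, map_mul, hf, hg]
  | smul c f hf => rw [map_smul, map_smul, hf]

end FreeStarAlgebra

end CompletionExtension

/-! ### Norm estimates in C⋆-algebras -/

section CStarEstimates

variable {B : Type*} [NonUnitalCStarAlgebra B]

/-- A geometric bound for the powers of a self-adjoint element bounds its norm. -/
theorem IsSelfAdjoint.norm_le_of_norm_pow_succ_le {U : Type*} [CStarAlgebra U] {c : U}
    (hc : IsSelfAdjoint c) {r K : ℝ} (hr : 0 ≤ r) (h : ∀ n : ℕ, ‖c ^ (n + 1)‖ ≤ r ^ n * K) :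
    ‖c‖ ≤ r := by
  by_contra! hlt
  -- The powers with exponents `2 ^ k` have norm `‖c‖ ^ 2 ^ k`; if `r < ‖c‖`, they grow too fast.
  have hpos : 0 < ‖c‖ := hr.trans_lt hlt
  have h1 : ∀ k : ℕ, ‖c‖ ≤ (r / ‖c‖) ^ (2 ^ k - 1) * K := by
    intro k
    have h2 := h (2 ^ k - 1)
    have h3 : ‖c ^ 2 ^ k‖ = ‖c‖ ^ 2 ^ k := congrArg NNReal.toReal (hc.nnnorm_pow_two_pow k)
    have h4 : 2 ^ k - 1 + 1 = 2 ^ k := Nat.sub_add_cancel Nat.one_le_two_pow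
    rw [h4, h3] at h2
    rw [div_pow, div_mul_eq_mul_div, le_div_iff₀ (by positivity)]
    calc ‖c‖ * ‖c‖ ^ (2 ^ k - 1) = ‖c‖ ^ 2 ^ k := by rw [← pow_succ', h4]
      _ ≤ _ := h2
  have h5 : Tendsto (fun k : ℕ => 2 ^ k - 1) atTop atTop :=
    tendsto_atTop_mono (fun k => Nat.le_sub_one_of_lt Nat.lt_two_pow_self) tendsto_id
  have h6 := ((tendsto_pow_atTop_nhds_zero_of_lt_one (div_nonneg hr hpos.le)
    ((div_lt_one hpos).2 hlt)).comp h5).mul_const K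
  rw [zero_mul] at h6
  exact absurd (ge_of_tendsto' h6 h1) hpos.not_ge

/-- A star-homomorphism from the algebra of compactly supported continuous functions to a
C⋆-algebra is contractive: the functions supported in a fixed compact set form a C⋆-algebra. -/
theorem norm_map_cc_le {Y : Type*} [TopologicalSpace Y] [T2Space Y]
    (ρ : C_c(Y, ℂ) →⋆ₙₐ[ℂ] B) (φ : C_c(Y, ℂ)) {c : ℝ} (hc : 0 ≤ c) (h : ∀ y, ‖φ y‖ ≤ c) :
    ‖ρ φ‖ ≤ c := by
  let D : NonUnitalStarSubalgebra ℂ (BoundedContinuousFunction Y ℂ) :=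
    { carrier := {g | ∀ y ∉ tsupport φ, g y = 0}
      add_mem' := fun {a b} ha hb y hy => by simp [ha y hy, hb y hy]
      zero_mem' := fun y hy => rfl
      mul_mem' := fun {a b} ha hb y hy => by simp [ha y hy]
      smul_mem' := fun c a ha y hy => by simp [ha y hy]
      star_mem' := fun {a} ha y hy => by simp [ha y hy] }
  have hD : IsClosed (D : Set (BoundedContinuousFunction Y ℂ)) := by
    have : (D : Set (BoundedContinuousFunction Y ℂ)) = ⋂ y ∈ (tsupport φ)ᶜ, {g | g y = 0} := by
      ext g
      simp only [mem_iInter]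
      rfl
    rw [this]
    exact isClosed_biInter fun y _ => isClosed_eq
      (BoundedContinuousFunction.evalCLM ℂ y).continuous continuous_const
  have : IsClosed (D : Set (BoundedContinuousFunction Y ℂ)) := hD
  let ι : D →⋆ₙₐ[ℂ] C_c(Y, ℂ) :=
    { toFun := fun g => ⟨⟨g.1, g.1.continuous⟩,
        HasCompactSupport.intro φ.hasCompactSupport.isCompact g.2⟩
      map_smul' := fun _ _ => rfl
      map_zero' := rfl
      map_add' := fun _ _ => rfl
      map_mul' := fun _ _ => rfl
      map_star' := fun _ => rfl }
  let g : D := ⟨BoundedContinuousFunction.ofNormedAddCommGroup φ φ.continuous c h,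
    fun y hy => image_eq_zero_of_notMem_tsupport hy⟩
  have h1 : ι g = φ := rfl
  calc ‖ρ φ‖ = ‖(ρ.comp ι) g‖ := by rw [NonUnitalStarAlgHom.comp_apply, h1]
    _ ≤ ‖g‖ := NonUnitalStarAlgHom.norm_apply_le _ _
    _ ≤ c := BoundedContinuousFunction.norm_ofNormedAddCommGroup_le _ hc h

theorem eq_zero_of_star_mul_mul_star {b : B} (h : star b * b * star b = 0) : b = 0 := by
  have h1 : star (star b * b) * (star b * b) = 0 := by
    rw [star_mul, star_star, ← mul_assoc, h, zero_mul]
  exact (CStarRing.star_mul_self_eq_zero_iff b).1 ((CStarRing.star_mul_self_eq_zero_iff _).1 h1)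

end CStarEstimates

/-! ### Partitions of unity along a local homeomorphism -/

section LocalPartition

/-- A compactly supported continuous function from its components. -/
def CompactlySupportedContinuousMap.ofFun {Y : Type*} [TopologicalSpace Y] (f : Y → ℂ)
    (hc : Continuous f) (hs : HasCompactSupport f) : C_c(Y, ℂ) := ⟨⟨f, hc⟩, hs⟩

theorem CompactlySupportedContinuousMap.ofFun_apply {Y : Type*} [TopologicalSpace Y] (f : Y → ℂ)
    (hc : Continuous f) (hs : HasCompactSupport f) (y : Y) :
    CompactlySupportedContinuousMap.ofFun f hc hs y = f y := rfl

variable {M X : Type*} [TopologicalSpace M] [T2Space M] [LocallyCompactSpace M]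
  [TopologicalSpace X] [T2Space X] {s : M → X}

/-- A cutoff function for a compact set. -/
theorem exists_cc_eq_one {L : Set M} (hL : IsCompact L) :
    ∃ χ : C_c(M, ℂ), (∀ m ∈ L, χ m = 1) ∧ ∀ m, ‖χ m‖ ≤ 1 := by
  obtain ⟨g, hg1, -, hgc, hg01⟩ :=
    exists_continuous_one_zero_of_isCompact hL isClosed_empty (disjoint_empty L)
  refine ⟨.ofFun (fun m => (g m : ℂ)) (Complex.continuous_ofReal.comp g.continuous)
    (hgc.comp_left (g := fun x : ℝ => (x : ℂ)) (by simp)), fun m hm => ?_, fun m => ?_⟩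
  · have : g m = 1 := hg1 hm
    simp [CompactlySupportedContinuousMap.ofFun_apply, this]
  · rw [CompactlySupportedContinuousMap.ofFun_apply, Complex.norm_real, Real.norm_eq_abs,
      abs_of_nonneg (hg01 m).1]
    exact (hg01 m).2

/-- The functions `β i` such that the `‖β i‖ ^ 2` form a partition of unity near a
compact set and `s` is injective on the support of each `β i`. -/
theorem IsLocalHomeomorph.exists_partition (hs : IsLocalHomeomorph s) {L : Set M}
    (hL : IsCompact L) : ∃ (n : ℕ) (β : Fin n → C_c(M, ℂ)),
      (∀ m ∈ L, ∑ i, β i m * conj (β i m) = 1) ∧ (∀ i m, ‖β i m‖ ≤ 1) ∧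
      ∀ i m m', β i m ≠ 0 → β i m' ≠ 0 → s m = s m' → m = m' := by
  choose U hU hmU hinj using hs.isLocallyInjective
  obtain ⟨t, ht⟩ := hL.elim_finite_subcover U hU fun m _ => mem_iUnion.2 ⟨m, hmU m⟩
  have ht' : L ⊆ ⋃ i : Fin t.card, U (t.equivFin.symm i) := by
    intro y hy
    obtain ⟨y', hy't, hy'⟩ := mem_iUnion₂.1 (ht hy)
    exact mem_iUnion.2 ⟨t.equivFin ⟨y', hy't⟩, by simpa using hy'⟩
  obtain ⟨φ, hφ1, hφ2, hφ3, hφ4⟩ := exists_continuous_sum_one_of_isOpen_isCompact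
    (fun i : Fin t.card => hU (t.equivFin.symm i)) hL ht'
  have hne : ∀ i m, ((Real.sqrt (φ i m) : ℝ) : ℂ) ≠ 0 → m ∈ U (t.equivFin.symm i) := by
    intro i m h
    refine hφ1 i (subset_tsupport _ fun h0 => h ?_)
    simp [h0]
  refine ⟨t.card, fun i => .ofFun (fun m => ((Real.sqrt (φ i m) : ℝ) : ℂ))
    (Complex.continuous_ofReal.comp (Real.continuous_sqrt.comp (φ i).continuous))
    ((hφ4 i).comp_left (g := fun x : ℝ => ((Real.sqrt x : ℝ) : ℂ)) (by simp)), ?_, ?_, ?_⟩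
  · intro m hm
    have h1 : ∑ i, φ i m = 1 := by simpa using hφ2 hm
    simp only [CompactlySupportedContinuousMap.ofFun_apply, Complex.conj_ofReal,
      ← Complex.ofReal_mul, Real.mul_self_sqrt (hφ3 _ m).1]
    rw [← Complex.ofReal_sum, h1, Complex.ofReal_one]
  · intro i m
    rw [CompactlySupportedContinuousMap.ofFun_apply, Complex.norm_real, Real.norm_eq_abs,
      abs_of_nonneg (Real.sqrt_nonneg _)]
    exact Real.sqrt_le_one.2 (hφ3 i m).2
  · intro i m m' h h' he
    exact hinj _ (hne i m h) (hne i m' h') he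

end LocalPartition

/-! ### Representations of Hilbert modules -/

noncomputable section HilbertModuleRepresentation

/-- Let `b = ∑ i, S (ξ i) * star (S (η i))` be such that `b` and `star b` act on the
range of `S` as maps that increase norms at most by the factor `t`.  Then `‖b‖ ≤ t`:
the powers of `c = star b * b` satisfy `‖c ^ (n + 1)‖ ≤ K * t ^ (2 * n)` for some constant `K`. -/
theorem norm_sum_mul_star_le {B V : Type*} [NonUnitalCStarAlgebra B] [NormedAddCommGroup V]
    {S : V → B} (hS : ∀ ζ, ‖S ζ‖ ≤ ‖ζ‖) {n : ℕ} {ξ η : Fin n → V} {b : B}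
    (hb : b = ∑ i, S (ξ i) * star (S (η i))) {t : ℝ} (ht0 : 0 ≤ t) {T T' : V → V}
    (hT : ∀ ζ, ‖T ζ‖ ≤ t * ‖ζ‖) (hbS : ∀ ζ, b * S ζ = S (T ζ))
    (hT' : ∀ ζ, ‖T' ζ‖ ≤ t * ‖ζ‖) (hbS' : ∀ ζ, star b * S ζ = S (T' ζ)) : ‖b‖ ≤ t := by
  let c : Unitization ℂ B := (((star b * b : B)) : Unitization ℂ B)
  have hcsa : IsSelfAdjoint c := by
    change star c = c
    rw [← Unitization.inr_star, star_mul, star_star]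
  have hpow : ∀ (k : ℕ) (ζ : V), ∃ ω : V, ‖ω‖ ≤ (t ^ 2) ^ k * ‖ζ‖ ∧
      c ^ k * ((S ζ : B) : Unitization ℂ B) = ((S ω : B) : Unitization ℂ B) := by
    intro k ζ
    induction k with
    | zero => exact ⟨ζ, by simp, by simp⟩
    | succ k ih =>
      obtain ⟨ω, h1, h2⟩ := ih
      refine ⟨T' (T ω), ?_, ?_⟩
      · calc ‖T' (T ω)‖ ≤ t * (t * ‖ω‖) := by
              refine (hT' _).trans ?_
              gcongr
              exact hT _
          _ ≤ t * (t * ((t ^ 2) ^ k * ‖ζ‖)) := by gcongr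
          _ = _ := by ring
      · rw [pow_succ', mul_assoc, h2, ← Unitization.inr_mul, mul_assoc, hbS, hbS']
  have hcS : star b * b = ∑ i, S (T' (ξ i)) * star (S (η i)) := by
    refine (congrArg (star b * ·) hb).trans ?_
    rw [Finset.mul_sum]
    exact Finset.sum_congr rfl fun i _ => by rw [← mul_assoc, hbS']
  have hmain : ∀ k : ℕ, ‖c ^ (k + 1)‖ ≤ (t ^ 2) ^ k * ∑ i, ‖T' (ξ i)‖ * ‖η i‖ := by
    intro k
    have h1 : c ^ (k + 1) = ∑ i, c ^ k * ((S (T' (ξ i)) * star (S (η i)) : B) : Unitization ℂ B) := by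
      rw [pow_succ, ← Finset.mul_sum]
      congr 1
      change ((star b * b : B) : Unitization ℂ B) = _
      rw [hcS]
      exact map_sum (Unitization.inrNonUnitalStarAlgHom ℂ B) _ _
    rw [h1, Finset.mul_sum]
    refine (norm_sum_le _ _).trans (Finset.sum_le_sum fun i _ => ?_)
    obtain ⟨ω, h2, h3⟩ := hpow k (T' (ξ i))
    rw [Unitization.inr_mul, ← mul_assoc, h3, ← Unitization.inr_mul, Unitization.norm_inr]
    calc ‖S ω * star (S (η i))‖ ≤ ‖S ω‖ * ‖S (η i)‖ := by
          rw [← norm_star (S (η i))]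
          exact norm_mul_le _ _
      _ ≤ ((t ^ 2) ^ k * ‖T' (ξ i)‖) * ‖η i‖ := by
          gcongr
          · exact (hS ω).trans h2
          · exact hS _
      _ = _ := by ring
  have h := hcsa.norm_le_of_norm_pow_succ_le (by positivity) hmain
  change ‖((star b * b : B) : Unitization ℂ B)‖ ≤ _ at h
  rw [Unitization.norm_inr, CStarRing.norm_star_mul_self, ← sq] at h
  exact (sq_le_sq₀ (norm_nonneg _) ht0).1 h

namespace HilbMod

variable {M X : Type*} [TopologicalSpace M] [T2Space M] [LocallyCompactSpace M]
  [TopologicalSpace X] [T2Space X] {s : M → X} {hs : IsLocalHomeomorph s}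

/-! Instances that are found by unification here, but only slowly by the general search. -/

instance : AddCommGroup (HilbMod hs) := inferInstance
instance : NormedAddCommGroup (HilbMod hs) := inferInstance
instance : NormedSpace ℂ (HilbMod hs) := inferInstance
instance : Module ℂ (HilbMod hs) := inferInstance
instance : MulAction ℂ (HilbMod hs) := inferInstance
instance : AddCommGroup (HilbMod hs →L[ℂ] HilbMod hs) := inferInstance
instance : NormedAddCommGroup (HilbMod hs →L[ℂ] HilbMod hs) := inferInstance
instance : NormedSpace ℂ (HilbMod hs →L[ℂ] HilbMod hs) := inferInstance
instance : Module ℂ (HilbMod hs →L[ℂ] HilbMod hs) := inferInstance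
instance : AddCommGroup (compacts hs) := inferInstance
instance : NormedAddCommGroup (compacts hs) := Submodule.normedAddCommGroup _
instance : NormedSpace ℂ (compacts hs) := Submodule.normedSpace _
instance : Module ℂ (compacts hs) := inferInstance

theorem norm_le_of_fibre {ξ : HilbMod hs} {C : ℝ} (hC : 0 ≤ C) (h : ∀ x, ‖ξ.1 x‖ ≤ C) : ‖ξ‖ ≤ C :=
  lp.norm_le_of_forall_le hC h

theorem rankOne_fibre (ξ η ζ : HilbMod hs) (x : X) :
    (rankOne ξ η ζ).1 x = innerC η ζ x • ξ.1 x := by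
  refine lp.ext (funext fun m => ?_)
  rw [← FibreFamily.toFun_apply]
  refine (rankOne_apply ξ η ζ m).trans ?_
  have hm : s m = x := m.2
  rw [hm, FibreFamily.toFun_apply]
  rfl

/-- The operator `∑ i, |ξ i⟩⟨η i|`. -/
def finiteRank {n : ℕ} (ξ η : Fin n → HilbMod hs) : HilbMod hs →L[ℂ] HilbMod hs :=
  ∑ i, rankOne (ξ i) (η i)

theorem finiteRank_apply {n : ℕ} (ξ η : Fin n → HilbMod hs) (ζ : HilbMod hs) :
    finiteRank ξ η ζ = ∑ i, rankOne (ξ i) (η i) ζ := by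
  simp [finiteRank]

theorem finiteRank_fibre {n : ℕ} (ξ η : Fin n → HilbMod hs) (ζ : HilbMod hs) (x : X) :
    (finiteRank ξ η ζ).1 x = ∑ i, inner ℂ ((η i).1 x) (ζ.1 x) • (ξ i).1 x := by
  rw [finiteRank_apply, Submodule.coe_sum, lp.coeFn_sum, Finset.sum_apply]
  exact Finset.sum_congr rfl fun i _ => by rw [rankOne_fibre, innerC_eq]

theorem inner_finiteRank {n : ℕ} (ξ η : Fin n → HilbMod hs) (ζ ζ' : HilbMod hs) (x : X) :
    inner ℂ ((finiteRank η ξ ζ).1 x) (ζ'.1 x) = inner ℂ (ζ.1 x) ((finiteRank ξ η ζ').1 x) := by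
  rw [finiteRank_fibre, finiteRank_fibre, sum_inner, inner_sum]
  refine Finset.sum_congr rfl fun i _ => ?_
  rw [inner_smul_left, inner_smul_right, inner_conj_symm, mul_comm]

/-- The adjoint of an operator of finite rank on the Hilbert module is at most as large in norm, by
the Cauchy–Schwarz inequality in each fibre. -/
theorem norm_finiteRank_adjoint_le {n : ℕ} (ξ η : Fin n → HilbMod hs) :
    ‖finiteRank η ξ‖ ≤ ‖finiteRank ξ η‖ := by
  refine ContinuousLinearMap.opNorm_le_bound _ (ContinuousLinearMap.opNorm_nonneg _) fun ζ => ?_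
  obtain ⟨t, ht⟩ : ∃ t, t = ‖finiteRank ξ η‖ := ⟨_, rfl⟩
  have ht0 : 0 ≤ t := ht ▸ ContinuousLinearMap.opNorm_nonneg _
  have hT : ∀ ζ, ‖finiteRank ξ η ζ‖ ≤ t * ‖ζ‖ := ht ▸ (finiteRank ξ η).le_opNorm
  rw [← ht]
  set ω := finiteRank η ξ ζ with hω
  by_cases h0 : ‖ω‖ = 0
  · rw [h0]; positivity
  have h0' : 0 < ‖ω‖ := lt_of_le_of_ne (norm_nonneg _) (Ne.symm h0)
  have h1 : ∀ x, ‖ω.1 x‖ ≤ Real.sqrt (t * ‖ζ‖ * ‖ω‖) := by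
    intro x
    refine Real.le_sqrt_of_sq_le ?_
    have h2 : ((‖ω.1 x‖ ^ 2 : ℝ) : ℂ) = inner ℂ (ζ.1 x) ((finiteRank ξ η ω).1 x) := by
      rw [← inner_finiteRank, ← hω, inner_self_eq_norm_sq_to_K]
      norm_cast
    have h3 : ‖ω.1 x‖ ^ 2 = ‖(inner ℂ (ζ.1 x) ((finiteRank ξ η ω).1 x) : ℂ)‖ := by
      rw [← h2, Complex.norm_real, Real.norm_of_nonneg (by positivity)]
    rw [h3]
    refine (FibreFamily.norm_inner_le ζ.1 (finiteRank ξ η ω).1 x).trans ?_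
    calc ‖ζ‖ * ‖finiteRank ξ η ω‖ ≤ ‖ζ‖ * (t * ‖ω‖) := by gcongr; exact hT ω
      _ = t * ‖ζ‖ * ‖ω‖ := by ring
  have h4 := norm_le_of_fibre (Real.sqrt_nonneg _) h1
  have h5 : ‖ω‖ ^ 2 ≤ t * ‖ζ‖ * ‖ω‖ := (Real.le_sqrt (norm_nonneg _) (by positivity)).1 h4
  rw [sq] at h5
  exact le_of_mul_le_mul_right h5 h0'

section Representation

variable {B : Type*} [NonUnitalCStarAlgebra B] {π : C₀(X, ℂ) →⋆ₙₐ[ℂ] B} {S : HilbMod hs →ₗ[ℂ] B}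

theorem norm_rep_le (hS : ∀ ξ η, star (S ξ) * S η = π (innerC ξ η)) (ξ : HilbMod hs) :
    ‖S ξ‖ ≤ ‖ξ‖ := by
  have h : ‖S ξ‖ * ‖S ξ‖ ≤ ‖ξ‖ * ‖ξ‖ := by
    rw [← CStarRing.norm_star_mul_self, hS]
    exact (NonUnitalStarAlgHom.norm_apply_le π _).trans (norm_innerC_le ξ ξ)
  exact abs_le_of_sq_le_sq' (by nlinarith) (norm_nonneg _) |>.2

theorem sum_rep_mul_rep (hS : ∀ ξ η, star (S ξ) * S η = π (innerC ξ η))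
    (hπ : ∀ ξ f, S ξ * π f = S (act hs.continuous f ξ)) {n : ℕ} (ξ η : Fin n → HilbMod hs)
    (ζ : HilbMod hs) : (∑ i, S (ξ i) * star (S (η i))) * S ζ = S (finiteRank ξ η ζ) := by
  rw [finiteRank_apply, map_sum, Finset.sum_mul]
  exact Finset.sum_congr rfl fun i _ => by rw [mul_assoc, hS, hπ]; rfl

theorem star_sum_rep {n : ℕ} (ξ η : Fin n → HilbMod hs) :
    star (∑ i, S (ξ i) * star (S (η i))) = ∑ i, S (η i) * star (S (ξ i)) := by
  rw [star_sum]
  exact Finset.sum_congr rfl fun i _ => by rw [star_mul, star_star]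

/-- A representation of a Hilbert module induces a contractive map on the operators of finite
rank. -/
theorem norm_sum_rep_le (hS : ∀ ξ η, star (S ξ) * S η = π (innerC ξ η))
    (hπ : ∀ ξ f, S ξ * π f = S (act hs.continuous f ξ)) {n : ℕ} (ξ η : Fin n → HilbMod hs) :
    ‖∑ i, S (ξ i) * star (S (η i))‖ ≤ ‖finiteRank ξ η‖ := by
  refine norm_sum_mul_star_le (norm_rep_le hS) rfl (ContinuousLinearMap.opNorm_nonneg _)
    (finiteRank ξ η).le_opNorm (sum_rep_mul_rep hS hπ ξ η) (T' := finiteRank η ξ)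
    (fun ζ => (finiteRank η ξ).le_of_opNorm_le (norm_finiteRank_adjoint_le ξ η) ζ) fun ζ => ?_
  rw [star_sum_rep]
  exact sum_rep_mul_rep hS hπ η ξ ζ

variable (hs) in
/-- Formal linear combinations of rank-one operators, mapped to compact operators. -/
def formalCompacts : (HilbMod hs × HilbMod hs →₀ ℂ) →ₗ[ℂ] compacts hs :=
  Finsupp.linearCombination ℂ fun a => compactRankOne a.1 a.2

variable (S) in
/-- Formal linear combinations of rank-one operators, mapped to the target of a
representation. -/
def formalTheta : (HilbMod hs × HilbMod hs →₀ ℂ) →ₗ[ℂ] B :=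
  Finsupp.linearCombination ℂ fun a => S a.1 * star (S a.2)

theorem denseRange_formalCompacts : DenseRange (formalCompacts hs) := by
  rw [DenseRange, Topology.IsInducing.subtypeVal.dense_iff]
  rintro ⟨T, hT⟩
  rw [← range_comp]
  refine closure_mono ?_ hT
  intro T hT
  obtain ⟨l, rfl⟩ := (Finsupp.mem_span_range_iff_exists_finsupp).1 hT
  refine ⟨l, ?_⟩
  change ((Finsupp.linearCombination ℂ _ l : compacts hs) : HilbMod hs →L[ℂ] HilbMod hs) = _
  rw [Finsupp.linearCombination_apply, Finsupp.sum, Submodule.coe_sum]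
  rfl

theorem norm_formalTheta_le (hS : ∀ ξ η, star (S ξ) * S η = π (innerC ξ η))
    (hπ : ∀ ξ f, S ξ * π f = S (act hs.continuous f ξ)) (l : HilbMod hs × HilbMod hs →₀ ℂ) :
    ‖formalTheta S l‖ ≤ 1 * ‖formalCompacts hs l‖ := by
  rw [one_mul]
  let e := l.support.equivFin
  let ξ : Fin l.support.card → HilbMod hs := fun i => l (e.symm i) • (e.symm i).1.1
  let η : Fin l.support.card → HilbMod hs := fun i => (e.symm i).1.2
  have h1 : formalTheta S l = ∑ i, S (ξ i) * star (S (η i)) := by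
    rw [formalTheta, Finsupp.linearCombination_apply, Finsupp.sum, ← Finset.sum_coe_sort,
      ← e.symm.sum_comp]
    exact Finset.sum_congr rfl fun i _ => by rw [map_smul, smul_mul_assoc]
  have h2 : (formalCompacts hs l).1 = finiteRank ξ η := by
    change ((Finsupp.linearCombination ℂ _ l : compacts hs) : HilbMod hs →L[ℂ] HilbMod hs) = _
    rw [Finsupp.linearCombination_apply, Finsupp.sum, Submodule.coe_sum, finiteRank,
      ← Finset.sum_coe_sort, ← e.symm.sum_comp]
    refine Finset.sum_congr rfl fun i _ => ContinuousLinearMap.ext fun ζ => HilbMod.ext fun m => ?_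
    change l (e.symm i) * (innerC (η i) ζ (s m) * (e.symm i).1.1 m) =
      innerC (η i) ζ (s m) * (l (e.symm i) * (e.symm i).1.1 m)
    ring
  rw [h1]
  refine (norm_sum_rep_le hS hπ ξ η).trans_eq ?_
  rw [← h2]
  rfl

/-- A map on compact operators that is given by a representation on rank-one operators is given
by it on finite sums of rank-one operators. -/
theorem apply_finiteRank {θ : compacts hs →L[ℂ] B}
    (h : ∀ ξ η, θ (compactRankOne ξ η) = S ξ * star (S η)) {n : ℕ} (ξ η : Fin n → HilbMod hs)
    (T : compacts hs) (hT : T.1 = finiteRank ξ η) : θ T = ∑ i, S (ξ i) * star (S (η i)) := by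
  have h1 : T = ∑ i, compactRankOne (ξ i) (η i) := by
    refine Subtype.ext ?_
    rw [hT, Submodule.coe_sum]
    rfl
  rw [h1, map_sum]
  exact Finset.sum_congr rfl fun i _ => h _ _

/-- A representation of a Hilbert module induces a contractive map on the compact
operators. -/
theorem exists_theta (hS : ∀ ξ η, star (S ξ) * S η = π (innerC ξ η))
    (hπ : ∀ ξ f, S ξ * π f = S (act hs.continuous f ξ)) :
    ∃ θ : compacts hs →L[ℂ] B, (∀ ξ η, θ (compactRankOne ξ η) = S ξ * star (S η)) ∧
      ∀ (T T' : compacts hs) (c : ℝ), 0 ≤ c → (∀ ζ, ‖T.1 ζ - T'.1 ζ‖ ≤ c * ‖ζ‖) →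
        ‖θ T - θ T'‖ ≤ c := by
  refine ⟨(formalTheta S).extendOfNorm (formalCompacts hs), fun ξ η => ?_, fun T T' c hc h => ?_⟩
  · have h := LinearMap.extendOfNorm_eq (denseRange_formalCompacts (hs := hs))
      ⟨1, norm_formalTheta_le hS hπ⟩ (Finsupp.single (ξ, η) 1)
    simpa [formalCompacts, formalTheta] using h
  · rw [← map_sub]
    refine (LinearMap.norm_extendOfNorm_apply_le denseRange_formalCompacts 1
      (norm_formalTheta_le hS hπ) (T - T')).trans ?_
    rw [one_mul]
    exact ContinuousLinearMap.opNorm_le_bound _ hc h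

theorem finiteRank_mem {n : ℕ} (ξ η : Fin n → HilbMod hs) : finiteRank ξ η ∈ compacts hs :=
  Submodule.sum_mem _ fun i _ => (compactRankOne (ξ i) (η i)).2

end Representation

end HilbMod

end HilbertModuleRepresentation

/-! ### Compactly supported functions on the correspondences -/

noncomputable section CompactlySupportedLayer

namespace CorrespondenceAction

variable {P : Type*} [Monoid P] {X : Type*} [TopologicalSpace X] [T2Space X]
  {𝓐 : CorrespondenceAction P X}

/-- The product `(ξ η)(m) = ξ (cutL m) * η (cutR m)` of compactly supported functions. -/
def ccProd {p q w : P} (h : p * q = w) (ξ : C_c(𝓐.M p, ℂ)) (η : C_c(𝓐.M q, ℂ)) : C_c(𝓐.M w, ℂ) :=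
  .ofFun (fun m => ξ (𝓐.cutL h m) * η (𝓐.cutR h m))
    ((ξ.continuous.comp (𝓐.continuous_cutL h)).mul (η.continuous.comp (𝓐.continuous_cutR h)))
    (HasCompactSupport.intro ((isClosedEmbedding_cut h).isCompact_preimage
      (ξ.hasCompactSupport.isCompact.prod η.hasCompactSupport.isCompact)) fun a ha => by
        by_contra h
        exact ha ⟨subset_tsupport _ (left_ne_zero_of_mul h),
          subset_tsupport _ (right_ne_zero_of_mul h)⟩)

theorem ccProd_apply {p q w : P} (h : p * q = w) (ξ : C_c(𝓐.M p, ℂ)) (η : C_c(𝓐.M q, ℂ))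
    (m : 𝓐.M w) : ccProd h ξ η m = ξ (𝓐.cutL h m) * η (𝓐.cutR h m) := rfl

/-- The inner product of compactly supported functions. -/
def ccInner {p : P} (ξ η : C_c(𝓐.M p, ℂ)) : C_c(X, ℂ) :=
  .ofFun (fibreSum (𝓐.s p) fun m => conj (ξ m) * η m)
    (fibreSum_continuous (𝓐.isLocalHomeomorph_s p)
      ((Complex.continuous_conj.comp ξ.continuous).mul η.continuous)
      η.hasCompactSupport.mul_left)
    (fibreSum_hasCompactSupport (𝓐.continuous_s p) η.hasCompactSupport.mul_left)

theorem ccInner_apply {p : P} (ξ η : C_c(𝓐.M p, ℂ)) (x : X) :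
    ccInner ξ η x = ∑' m : 𝓐.s p ⁻¹' {x}, conj (ξ m) * η m := rfl

/-- The function `f ∘ r p` for `f` in `C_c(X, ℂ)`. -/
def ccPull (p : P) (f : C_c(X, ℂ)) : C_c(𝓐.M p, ℂ) :=
  .ofFun (fun m => f (𝓐.r p m)) (f.continuous.comp (𝓐.continuous_r p))
    (HasCompactSupport.intro ((𝓐.isProperMap_r p).isCompact_preimage f.hasCompactSupport.isCompact)
      fun _ hm => image_eq_zero_of_notMem_tsupport hm)

theorem ccPull_apply {p : P} (f : C_c(X, ℂ)) (m : 𝓐.M p) : ccPull p f m = f (𝓐.r p m) := rfl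

/-- A compactly supported function as a function vanishing at infinity. -/
def ccToC0 (f : C_c(X, ℂ)) : C₀(X, ℂ) :=
  ⟨f.toContinuousMap, by
    refine tendsto_nhds_of_eventually_eq ?_
    filter_upwards [f.hasCompactSupport.isCompact.compl_mem_cocompact] with x hx
    exact image_eq_zero_of_notMem_tsupport hx⟩

theorem ccToC0_apply (f : C_c(X, ℂ)) (x : X) : ccToC0 f x = f x := rfl

theorem exists_ccToC0_approx [LocallyCompactSpace X] (f : C₀(X, ℂ)) {ε : ℝ} (hε : 0 < ε) :
    ∃ g : C_c(X, ℂ), ‖ccToC0 g - f‖ ≤ ε := by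
  obtain ⟨K, hK, hfK⟩ : ∃ K : Set X, IsCompact K ∧ ∀ m ∉ K, ‖f m‖ < ε / 2 := by
    have h := Metric.tendsto_nhds.1 f.zero_at_infty' (ε / 2) (by positivity)
    obtain ⟨K, hK, hKs⟩ := mem_cocompact.1 h
    exact ⟨K, hK, fun m hm => by simpa [dist_eq_norm] using hKs hm⟩
  obtain ⟨χ, hχ1, hχ2⟩ := exists_cc_eq_one hK
  refine ⟨.ofFun (fun x => χ x * f x) (χ.continuous.mul f.continuous)
    χ.hasCompactSupport.mul_right, ?_⟩
  rw [← ZeroAtInftyContinuousMap.norm_toBCF_eq_norm]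
  refine (BoundedContinuousFunction.norm_le hε.le).2 fun x => ?_
  change ‖χ x * f x - f x‖ ≤ ε
  by_cases hx : x ∈ K
  · rw [hχ1 x hx, one_mul, sub_self, norm_zero]
    exact hε.le
  · refine (norm_sub_le _ _).trans ?_
    rw [norm_mul]
    nlinarith [hfK x hx, hχ2 x, norm_nonneg (χ x), norm_nonneg (f x)]

theorem ofCc_apply {p : P} (ξ : C_c(𝓐.M p, ℂ)) (m : 𝓐.M p) : ofCc ξ m = ξ m := rfl

theorem prodHilb_ofCc {p q w : P} (h : p * q = w) (ξ : C_c(𝓐.M p, ℂ)) (η : C_c(𝓐.M q, ℂ)) :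
    prodHilb h (ofCc ξ) (ofCc η) = ofCc (ccProd h ξ η) := HilbMod.ext fun _ => rfl

theorem innerC_ofCc {p : P} (ξ η : C_c(𝓐.M p, ℂ)) :
    HilbMod.innerC (ofCc ξ) (ofCc η) = ccToC0 (ccInner ξ η) := by
  ext x
  rw [HilbMod.innerC_apply]
  rfl

theorem unitHilb_ccToC0 (f : C_c(X, ℂ)) :
    (unitHilb (ccToC0 f) : 𝓐.Hilb 1) = ofCc (ccPull 1 f) := HilbMod.ext fun _ => rfl

theorem denseRange_ofCc (p : P) : DenseRange (HilbMod.ofCc (𝓐.isLocalHomeomorph_s p)) := by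
  rw [DenseRange, Topology.IsInducing.subtypeVal.dense_iff]
  rintro ⟨ξ, hξ⟩
  rw [← range_comp]
  exact hξ

theorem r_one_cutR {p : P} (m : 𝓐.M p) : 𝓐.r 1 (𝓐.cutR (mul_one p) m) = 𝓐.s p m := by
  rw [← 𝓐.s_cutL, 𝓐.cutL_one]

theorem prodHilb_unitHilb_right {p : P} (f : C₀(X, ℂ)) (ξ : 𝓐.Hilb p) :
    prodHilb (mul_one p) ξ (unitHilb f) = HilbMod.act (𝓐.continuous_s p) f ξ :=
  HilbMod.ext fun m => by
    rw [prodHilb_apply, unitHilb_apply, HilbMod.act_apply, r_one_cutR, 𝓐.cutL_one, mul_comm]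

/-- The condition that multiplication by `a` is the operator `∑ i, |α i⟩⟨β i|` on the
Hilbert module of `M p`, in terms of integral kernels. -/
def IsKernel {p : P} (a : 𝓐.M p → ℂ) {n : ℕ} (α β : Fin n → C_c(𝓐.M p, ℂ)) : Prop :=
  (∀ m, ∑ i, α i m * conj (β i m) = a m) ∧
    ∀ m m', 𝓐.s p m = 𝓐.s p m' → m ≠ m' → ∑ i, α i m * conj (β i m') = 0

/-- Multiplication by a compactly supported function is an operator of finite rank. -/
theorem exists_isKernel {p : P} (a : C_c(𝓐.M p, ℂ)) :
    ∃ (n : ℕ) (α β : Fin n → C_c(𝓐.M p, ℂ)), IsKernel a α β := by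
  obtain ⟨n, β, h1, -, h3⟩ :=
    (𝓐.isLocalHomeomorph_s p).exists_partition a.hasCompactSupport.isCompact
  refine ⟨n, fun i => a * β i, β, fun m => ?_, fun m m' hs hne => ?_⟩
  · have : ∀ i, (a * β i) m * conj (β i m) = a m * (β i m * conj (β i m)) := fun i => by
      rw [CompactlySupportedContinuousMap.mul_apply, mul_assoc]
    simp only [this, ← Finset.mul_sum]
    by_cases hm : m ∈ tsupport a
    · rw [h1 m hm, mul_one]
    · rw [image_eq_zero_of_notMem_tsupport hm, zero_mul]
  · refine Finset.sum_eq_zero fun i _ => ?_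
    by_contra h
    rw [CompactlySupportedContinuousMap.mul_apply] at h
    refine hne (h3 i m m' (right_ne_zero_of_mul (left_ne_zero_of_mul h)) ?_ hs)
    exact fun h0 => h (by rw [h0, map_zero, mul_zero])

/-- The integral kernel of `∑ i, |α i⟩⟨β i|` is `(m, m') ↦ ∑ i, α i m * conj (β i m')`, so that
`IsKernel` makes this operator the multiplication by `a`. -/
theorem finiteRank_ofCc_apply {p : P} {a : 𝓐.M p → ℂ} {n : ℕ} {α β : Fin n → C_c(𝓐.M p, ℂ)}
    (h : IsKernel a α β) (ζ : 𝓐.Hilb p) (m : 𝓐.M p) :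
    HilbMod.finiteRank (fun i => ofCc (α i)) (fun i => ofCc (β i)) ζ m = a m * ζ m := by
  have h1 : HilbMod.finiteRank (fun i => ofCc (α i)) (fun i => ofCc (β i)) ζ m =
      ∑ i, HilbMod.innerC (ofCc (β i)) ζ (𝓐.s p m) * α i m := by
    rw [FibreFamily.toFun, HilbMod.finiteRank_fibre, lp.coeFn_sum, Finset.sum_apply]
    exact Finset.sum_congr rfl fun i _ => by rw [← HilbMod.innerC_eq]; rfl
  have hsum : ∀ i, Summable fun m' : 𝓐.s p ⁻¹' {𝓐.s p m} =>
      (conj ((ofCc (β i) : 𝓐.Hilb p) m') * ζ m') * α i m := by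
    intro i
    refine Summable.mul_right _ (summable_of_hasFiniteSupport ?_)
    refine ((𝓐.isLocalHomeomorph_s p).finite_support_fibre
      (β i).hasCompactSupport (𝓐.s p m)).subset fun m' hm' => ?_
    intro h0
    replace h0 : β i m' = 0 := h0
    exact hm' (by change conj (β i m') * _ = 0; rw [h0, map_zero, zero_mul])
  rw [h1]
  simp only [HilbMod.innerC_apply, ← tsum_mul_right]
  rw [← Summable.tsum_finsetSum fun i _ => hsum i]
  rw [tsum_eq_single (⟨m, rfl⟩ : 𝓐.s p ⁻¹' {𝓐.s p m})]
  · rw [← h.1 m, Finset.sum_mul]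
    exact Finset.sum_congr rfl fun i _ => by simp only [ofCc_apply]; ring
  · rintro ⟨m', hm'⟩ hne
    have h2 := h.2 m m' (Eq.symm hm') fun h0 => hne (Subtype.ext h0.symm)
    calc _ = (∑ i, α i m * conj (β i m')) * ζ m' := by
          rw [Finset.sum_mul]
          exact Finset.sum_congr rfl fun i _ => by simp only [ofCc_apply]; ring
      _ = 0 := by rw [h2, zero_mul]

theorem norm_finiteRank_ofCc_le {p : P} {a : 𝓐.M p → ℂ} {n : ℕ} {α β : Fin n → C_c(𝓐.M p, ℂ)}
    (h : IsKernel a α β) {c : ℝ} (hc : 0 ≤ c) (ha : ∀ m, ‖a m‖ ≤ c) :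
    ‖HilbMod.finiteRank (fun i => (ofCc (α i) : 𝓐.Hilb p)) (fun i => ofCc (β i))‖ ≤ c := by
  refine ContinuousLinearMap.opNorm_le_bound _ hc fun ζ => ?_
  have h1 := FibreFamily.sqBound_mul hc ha (FibreFamily.sqBound ζ.1)
  refine FibreFamily.norm_le (C := c * ‖ζ‖) ?_
  have h2 : FibreFamily.toFun (HilbMod.finiteRank (fun i => (ofCc (α i) : 𝓐.Hilb p))
      (fun i => ofCc (β i)) ζ).1 = fun m => a m * ζ m := funext fun m => finiteRank_ofCc_apply h ζ m
  exact h2.symm ▸ h1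

theorem ccPull_add (p : P) (f g : C_c(X, ℂ)) :
    (ccPull p (f + g) : C_c(𝓐.M p, ℂ)) = ccPull p f + ccPull p g :=
  CompactlySupportedContinuousMap.ext fun _ => rfl

theorem ccPull_smul (p : P) (c : ℂ) (f : C_c(X, ℂ)) :
    (ccPull p (c • f) : C_c(𝓐.M p, ℂ)) = c • ccPull p f :=
  CompactlySupportedContinuousMap.ext fun _ => rfl

theorem ccPull_zero (p : P) : (ccPull p 0 : C_c(𝓐.M p, ℂ)) = 0 :=
  CompactlySupportedContinuousMap.ext fun _ => rfl

theorem ccProd_ccPull (f g : C_c(X, ℂ)) :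
    (ccProd (mul_one 1) (ccPull 1 f) (ccPull 1 g) : C_c(𝓐.M 1, ℂ)) = ccPull 1 (f * g) :=
  CompactlySupportedContinuousMap.ext fun m => by
    rw [ccProd_apply, ccPull_apply, ccPull_apply, ccPull_apply, r_one_cutR, 𝓐.cutL_one,
      𝓐.r_one_eq_s_one]
    rfl

end CorrespondenceAction

end CompactlySupportedLayer

/-! ### Covariance in algebraic form -/

noncomputable section AlgebraicCovariance

namespace CorrespondenceAction

variable {P : Type*} [Monoid P] {X : Type*} [TopologicalSpace X] [T2Space X]
  (𝓐 : CorrespondenceAction P X)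

/-- A representation of the product system that satisfies the covariance condition for those
compact operators of the form `leftAct p f` that are sums of finitely many rank-one operators of
compactly supported functions.  In contrast to `CovariantRep`, these relations only involve
finite sums and products, so that they pass to suprema of seminorms. -/
structure PreRep (B : Type*) [NonUnitalCStarAlgebra B] where
  π : C₀(X, ℂ) →⋆ₙₐ[ℂ] B
  S : ∀ p, 𝓐.Hilb p →ₗ[ℂ] B
  S_one : ∀ f, S 1 (unitHilb f) = π f
  star_S_mul_S : ∀ (p : P) (ξ η : 𝓐.Hilb p), star (S p ξ) * S p η = π (HilbMod.innerC ξ η)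
  S_mul_S : ∀ {p q w : P} (h : p * q = w) (ξ : 𝓐.Hilb p) (η : 𝓐.Hilb q),
    S p ξ * S q η = S w (prodHilb h ξ η)
  cov : ∀ (p : P) (f : C_c(X, ℂ)) (n : ℕ) (α β : Fin n → C_c(𝓐.M p, ℂ)),
    IsKernel (ccPull p f) α β → π (ccToC0 f) = ∑ i, S p (ofCc (α i)) * star (S p (ofCc (β i)))

variable {𝓐}

namespace PreRep

variable {B : Type*} [NonUnitalCStarAlgebra B] (R : 𝓐.PreRep B)

theorem S_mul_π {p : P} (ξ : 𝓐.Hilb p) (f : C₀(X, ℂ)) :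
    R.S p ξ * R.π f = R.S p (HilbMod.act (𝓐.continuous_s p) f ξ) := by
  rw [← R.S_one, R.S_mul_S (mul_one p), prodHilb_unitHilb_right]

theorem norm_S_le {p : P} (ξ : 𝓐.Hilb p) : ‖R.S p ξ‖ ≤ ‖ξ‖ :=
  HilbMod.norm_rep_le (R.star_S_mul_S p) ξ

theorem continuous_S (p : P) : Continuous (R.S p) :=
  AddMonoidHomClass.continuous_of_bound (R.S p) 1 fun ξ => by
    rw [one_mul]
    exact R.norm_S_le ξ

theorem norm_sum_le {p : P} {n : ℕ} (ξ η : Fin n → 𝓐.Hilb p) :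
    ‖∑ i, R.S p (ξ i) * star (R.S p (η i))‖ ≤ ‖HilbMod.finiteRank ξ η‖ :=
  HilbMod.norm_sum_rep_le (R.star_S_mul_S p) R.S_mul_π ξ η

theorem norm_sum_ofCc_le {p : P} {a : 𝓐.M p → ℂ} {n : ℕ} {α β : Fin n → C_c(𝓐.M p, ℂ)}
    (h : IsKernel a α β) {c : ℝ} (hc : 0 ≤ c) (ha : ∀ m, ‖a m‖ ≤ c) :
    ‖∑ i, R.S p (ofCc (α i)) * star (R.S p (ofCc (β i)))‖ ≤ c :=
  (R.norm_sum_le _ _).trans (norm_finiteRank_ofCc_le h hc ha)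

theorem finiteRank_eq_leftAct {p : P} {f : C_c(X, ℂ)} {n : ℕ} {α β : Fin n → C_c(𝓐.M p, ℂ)}
    (h : IsKernel (ccPull p f) α β) :
    HilbMod.finiteRank (fun i => ofCc (α i)) (fun i => ofCc (β i)) =
      (leftAct p (ccToC0 f) : 𝓐.Hilb p →L[ℂ] 𝓐.Hilb p) := by
  refine ContinuousLinearMap.ext fun ζ => HilbMod.ext fun m => ?_
  rw [finiteRank_ofCc_apply h]
  rfl

theorem leftAct_sub {p : P} (f g : C₀(X, ℂ)) (ζ : 𝓐.Hilb p) :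
    leftAct p f ζ - leftAct p g ζ = leftAct p (f - g) ζ :=
  HilbMod.ext fun m => (sub_mul (f (𝓐.r p m)) (g (𝓐.r p m)) (ζ m)).symm

set_option maxHeartbeats 1000000 in
/-- The full covariance condition: `f` is a limit of compactly supported functions `g`, and
`leftAct p g` is an operator of finite rank. -/
theorem covariant [LocallyCompactSpace X] (p : P) :
    ∃ θ : HilbMod.compacts (𝓐.isLocalHomeomorph_s p) →L[ℂ] B,
    (∀ ξ η, θ (HilbMod.compactRankOne ξ η) = R.S p ξ * star (R.S p η)) ∧
    ∀ (f : C₀(X, ℂ)) (T : HilbMod.compacts (𝓐.isLocalHomeomorph_s p)),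
      T.1 = leftAct p f → θ T = R.π f := by
  obtain ⟨θ, h1, h2⟩ := HilbMod.exists_theta (R.star_S_mul_S p) R.S_mul_π
  refine ⟨θ, h1, fun f T hT => ?_⟩
  rw [← sub_eq_zero, ← norm_le_zero_iff]
  refine le_of_forall_pos_le_add fun ε hε => ?_
  rw [zero_add]
  obtain ⟨δ, hδ, hδε⟩ : ∃ δ > 0, δ + δ ≤ ε := ⟨ε / 2, half_pos hε, (add_halves ε).le⟩
  obtain ⟨g, hg⟩ := exists_ccToC0_approx f hδ
  obtain ⟨n, α, β, h⟩ := exists_isKernel (ccPull (𝓐 := 𝓐) p g)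
  obtain ⟨T', h7⟩ : ∃ T' : HilbMod.compacts (𝓐.isLocalHomeomorph_s p),
      T'.1 = HilbMod.finiteRank (fun i => ofCc (α i)) (fun i => ofCc (β i)) :=
    ⟨⟨_, HilbMod.finiteRank_mem _ _⟩, rfl⟩
  have h3 := HilbMod.apply_finiteRank h1 _ _ T' h7
  rw [← R.cov p g n α β h] at h3
  have h4 := h2 T' T δ hδ.le
    fun ζ => by
      have h6 : ‖leftAct p (ccToC0 g - f) ζ‖ ≤ δ * ‖ζ‖ :=
        (HilbMod.norm_act_le (𝓐.continuous_r p) (ccToC0 g - f) ζ).trans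
          (mul_le_mul_of_nonneg_right hg (norm_nonneg ζ))
      rw [hT, h7, finiteRank_eq_leftAct h, leftAct_sub]
      exact h6
  rw [h3] at h4
  have h5 : ‖R.π (ccToC0 g) - R.π f‖ ≤ δ := by
    rw [← map_sub]
    exact (NonUnitalStarAlgHom.norm_apply_le R.π _).trans hg
  rw [← sub_sub_sub_cancel_left _ _ (R.π (ccToC0 g))]
  exact (norm_sub_le _ _).trans ((add_le_add h5 h4).trans hδε)

/-- The covariance condition in algebraic form implies the covariance condition. -/
def toCovariantRep [LocallyCompactSpace X] : 𝓐.CovariantRep B where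
  π := R.π
  S := R.S
  S_one := R.S_one
  star_S_mul_S := R.star_S_mul_S
  S_mul_S := R.S_mul_S
  covariant := R.covariant

end PreRep

/-- The covariance condition implies its algebraic form. -/
def CovariantRep.toPreRep {B : Type*} [NonUnitalCStarAlgebra B] (R : 𝓐.CovariantRep B) :
    𝓐.PreRep B where
  π := R.π
  S := R.S
  S_one := R.S_one
  star_S_mul_S := R.star_S_mul_S
  S_mul_S := R.S_mul_S
  cov p f n α β h := by
    obtain ⟨θ, h1, h2⟩ := R.covariant p
    rw [← h2 (ccToC0 f) ⟨_, HilbMod.finiteRank_mem (fun i => ofCc (α i)) (fun i => ofCc (β i))⟩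
      (PreRep.finiteRank_eq_leftAct h)]
    exact HilbMod.apply_finiteRank h1 _ _ _ rfl

end CorrespondenceAction

end AlgebraicCovariance

/-! ### Convolution with functions supported on bisections -/

noncomputable section Bisections

theorem continuous_ite_of_isClopen {Y : Type*} [TopologicalSpace Y] {p : Y → Prop}
    [DecidablePred p] (hp : IsClopen {y | p y}) {f : Y → ℂ} (hf : Continuous f) :
    Continuous fun y => if p y then f y else 0 := by
  refine continuous_if (fun a ha => ?_) hf.continuousOn continuousOn_const
  rw [hp.frontier_eq] at ha
  exact ha.elim

namespace EtaleGroupoid.ConvAlg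

universe u v

variable {G : EtaleGroupoid.{u, v}}

/-- Convolution with a function `h` that has at most one arrow `b` with a given range in its support:
the defining sum has a single summand. -/
theorem mul_apply_of_eq_zero {h f : G.ConvAlg} {a b : G.Arr} (e : G.r b = G.r a)
    (hb : ∀ c, G.r c = G.r a → c ≠ b → h c = 0) :
    (h * f) a = h b * f (G.mul (G.inv b) a ((G.s_inv b).trans e)) := by
  rw [mul_apply, tsum_eq_single (⟨⟨(b, G.mul (G.inv b) a ((G.s_inv b).trans e)),
    ((G.r_mul _ _ _).trans (G.r_inv b)).symm⟩, mul_inv_cancel_left b a e _ _⟩ : G.comp ⁻¹' {a})]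
  rintro ⟨⟨⟨c, d⟩, hcd⟩, hc⟩ hne
  have hc' : G.mul c d hcd = a := hc
  have hrc : G.r c = G.r a := by rw [← hc', G.r_mul]
  rw [hb c hrc, zero_mul]
  rintro rfl
  refine hne (Subtype.ext (Subtype.ext (Prod.ext rfl ?_)))
  refine (inv_mul_cancel_left c d hcd ((G.s_inv c).trans (G.r_mul _ _ _).symm)).symm.trans ?_
  exact mul_congr rfl hc' _ _

theorem sum_apply {ι : Type*} (s : Finset ι) (f : ι → G.ConvAlg) (a : G.Arr) :
    (∑ i ∈ s, f i) a = ∑ i ∈ s, f i a :=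
  map_sum (⟨⟨fun f : G.ConvAlg => f a, rfl⟩, fun _ _ => rfl⟩ : G.ConvAlg →+ ℂ) f s

/-- If `f` is supported on a bisection, then `star f * f` is supported on units and its
supremum norm is bounded by that of `f` squared. -/
theorem star_mul_self_of_bisection {f : G.ConvAlg}
    (hr : ∀ a b, f a ≠ 0 → f b ≠ 0 → G.r a = G.r b → a = b)
    (hs : ∀ a b, f a ≠ 0 → f b ≠ 0 → G.s a = G.s b → a = b) {c : ℝ} (hc : ∀ a, ‖f a‖ ≤ c) :
    (∀ a, (star f * f) a ≠ 0 → a = G.one (G.r a)) ∧ ∀ a, ‖(star f * f) a‖ ≤ c ^ 2 := by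
  have key : ∀ a, (star f * f) a ≠ 0 → ∃ b, f b ≠ 0 ∧ a = G.one (G.s b) ∧
      (star f * f) a = conj (f b) * f b := by
    intro a ha
    rw [mul_apply] at ha ⊢
    obtain ⟨⟨⟨⟨b', b⟩, e⟩, h⟩, hp⟩ : ∃ p : G.comp ⁻¹' {a}, star f p.1.1.1 * f p.1.1.2 ≠ 0 := by
      by_contra! h
      exact ha (by simp only [h, tsum_zero])
    have hb : f b ≠ 0 := right_ne_zero_of_mul hp
    have hb' : f (G.inv b') ≠ 0 := by
      intro h0
      refine left_ne_zero_of_mul hp ?_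
      change star f b' = 0
      rw [star_apply, h0, map_zero]
    have h1 : G.inv b' = b := hr _ _ hb' hb ((G.r_inv b').trans e)
    have h2 : b' = G.inv b := by rw [← h1, inv_inv]
    have h3 : G.mul b' b e = a := h
    refine ⟨b, hb, ?_, ?_⟩
    · rw [← h3, mul_congr h2 rfl e (G.s_inv b), G.inv_mul]
    · rw [tsum_eq_single (⟨⟨(b', b), e⟩, h⟩ : G.comp ⁻¹' {a})]
      · change star f b' * f b = _
        rw [star_apply, h1]
      · rintro ⟨⟨⟨d', d⟩, e'⟩, h'⟩ hne
        change star f d' * f d = 0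
        by_contra h0
        have h4 : G.mul d' d e' = a := h'
        have h5 : d = b := hs d b (right_ne_zero_of_mul h0) hb
          ((G.s_mul d' d e').symm.trans ((congrArg G.s (h4.trans h3.symm)).trans (G.s_mul _ _ _)))
        subst h5
        have h6 : d' = b' := mul_right_cancel e' e (h4.trans h3.symm)
        subst h6
        exact hne rfl
  refine ⟨fun a ha => ?_, fun a => ?_⟩
  · obtain ⟨b, -, h, -⟩ := key a ha
    rw [h, G.r_one]
  · by_cases ha : (star f * f) a = 0
    · rw [ha, norm_zero]
      positivity
    · obtain ⟨b, -, -, h⟩ := key a ha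
      rw [h, norm_mul, RCLike.norm_conj, sq]
      exact mul_le_mul (hc b) (hc b) (norm_nonneg _) ((norm_nonneg _).trans (hc b))

end EtaleGroupoid.ConvAlg

namespace CorrespondenceAction

open FracGroup EtaleGroupoid

variable {P : Type*} [Monoid P] [RightOre P] {X : Type*} [TopologicalSpace X] [T2Space X]
  {𝓐 : CorrespondenceAction P X}

theorem frac_one (p : P) : frac p 1 = ι p := by simp [frac_eq]

theorem frac_self (p : P) : frac p p = 1 := by simp [frac_eq]

theorem Arrow.ext_iff_units {a : 𝓐.Arrow} :
    a = Arrow.one a.rng ↔ a.frc = 1 ∧ a.src = a.rng :=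
  ⟨fun h => ⟨congrArg Arrow.frc h, congrArg Arrow.src h⟩, fun h => Arrow.ext rfl h.1 h.2⟩

theorem Arrow.mem_range_ofPiece {p q : P} {a : 𝓐.Arrow} :
    a ∈ range (Arrow.ofPiece (𝓐 := 𝓐) p q) ↔ a.frc = frac p q ∧ a.rng.shift p = a.src.shift q := by
  constructor
  · rintro ⟨b, rfl⟩
    exact ⟨rfl, b.2⟩
  · rintro ⟨h1, h2⟩
    exact ⟨⟨(a.rng, a.src), h2⟩, Arrow.ext rfl h1.symm rfl⟩

/-- The arrows over a fixed element of the group of fractions form an open subset. -/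
theorem Arrow.isOpen_frc (g : FracGroup P) : IsOpen {a : 𝓐.Arrow | a.frc = g} := by
  have : {a : 𝓐.Arrow | a.frc = g} =
      ⋃ pq : {pq : P × P // frac pq.1 pq.2 = g}, range (Arrow.ofPiece pq.1.1 pq.1.2) := by
    ext a
    simp only [mem_ofPred_eq, mem_iUnion, Arrow.mem_range_ofPiece]
    constructor
    · intro h
      obtain ⟨p, q, h1, h2⟩ := a.exists_frac
      exact ⟨⟨(p, q), h1.symm.trans h⟩, h1, h2⟩
    · rintro ⟨pq, h1, -⟩
      exact h1.trans pq.2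
  rw [this]
  exact isOpen_iUnion fun pq => Arrow.isOpen_range_ofPiece _ _

theorem Arrow.isClosed_frc (g : FracGroup P) : IsClosed {a : 𝓐.Arrow | a.frc = g} := by
  have : {a : 𝓐.Arrow | a.frc = g}ᶜ = ⋃ h : {h : FracGroup P // h ≠ g}, {a | a.frc = h.1} := by
    ext a
    simp
  rw [← isOpen_compl_iff, this]
  exact isOpen_iUnion fun h => Arrow.isOpen_frc _

variable [LocallyCompactSpace X]

open Classical in
/-- The restriction of a function to the arrows over `g`. -/
def restrictFrc (g : FracGroup P) (f : 𝓐.groupoid.ConvAlg) : 𝓐.groupoid.ConvAlg :=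
  ⟨.ofFun (fun a : 𝓐.Arrow => if a.frc = g then f a else 0)
    (continuous_ite_of_isClopen ⟨Arrow.isClosed_frc g, Arrow.isOpen_frc g⟩ f.continuous)
    (f.hasCompactSupport.mono fun (a : 𝓐.Arrow) ha h0 => ha (by
      change (if a.frc = g then f a else 0) = 0
      rw [show f a = 0 from h0, ite_self]))⟩

open Classical in
/-- The function on arrows that is `φ` on units and vanishes elsewhere. -/
def unitFun (φ : 𝓐.History → ℂ) (a : 𝓐.Arrow) : ℂ :=
  if a.frc = 1 ∧ a.src = a.rng then φ a.rng else 0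

theorem Arrow.isClopen_units : IsClopen {a : 𝓐.Arrow | a.frc = 1 ∧ a.src = a.rng} := by
  constructor
  · exact (Arrow.isClosed_frc 1).inter (isClosed_eq Arrow.continuous_src Arrow.continuous_rng)
  · convert Arrow.isOpen_range_ofPiece (𝓐 := 𝓐) 1 1 using 1
    ext a
    rw [Arrow.mem_range_ofPiece, frac_self, History.shift_one, History.shift_one]
    exact and_congr_right fun _ => eq_comm

/-- Functions on the space of objects as functions on the space of arrows. -/
def unitConv (φ : C_c(𝓐.History, ℂ)) : 𝓐.groupoid.ConvAlg :=
  ⟨.ofFun (unitFun φ)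
    (@continuous_ite_of_isClopen 𝓐.Arrow _ _ (fun _ => _) Arrow.isClopen_units _
      (φ.continuous.comp Arrow.continuous_rng))
    (HasCompactSupport.intro (φ.hasCompactSupport.isCompact.image Arrow.continuous_one)
      fun a ha => by
        by_contra h
        unfold unitFun at h
        split_ifs at h with h1
        · exact ha ⟨a.rng, subset_tsupport _ h, (Arrow.ext_iff_units.2 h1).symm⟩
        · exact h rfl)⟩

theorem unitConv_one (φ : C_c(𝓐.History, ℂ)) (x : 𝓐.History) :
    unitConv φ (Arrow.one x : 𝓐.Arrow) = φ x := if_pos ⟨rfl, rfl⟩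

theorem unitConv_mul_apply (φ : C_c(𝓐.History, ℂ)) (f : 𝓐.groupoid.ConvAlg) (a : 𝓐.Arrow) :
    (unitConv φ * f) a = φ a.rng * f a := by
  rw [ConvAlg.mul_apply_of_eq_zero (G := 𝓐.groupoid) (a := a) (b := Arrow.one a.rng) rfl]
  · congr 1
    · exact unitConv_one φ a.rng
    · refine congrArg f (Arrow.ext rfl ?_ rfl)
      change (1 : FracGroup P)⁻¹ * a.frc = a.frc
      rw [inv_one, _root_.one_mul]
  · intro c (hc : c.rng = a.rng) hne
    refine if_neg fun h => hne ?_
    rw [← hc]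
    exact Arrow.ext_iff_units.2 h

theorem star_unitConv (φ : C_c(𝓐.History, ℂ)) : star (unitConv φ) = unitConv (star φ) := by
  refine ConvAlg.ext fun (a : 𝓐.Arrow) => ?_
  change conj (unitFun φ (Arrow.inv a)) = unitFun (star φ) a
  unfold unitFun
  by_cases h : a.frc = 1 ∧ a.src = a.rng
  · rw [if_pos h, if_pos ⟨(congrArg (·⁻¹) h.1).trans inv_one, h.2.symm⟩]
    change conj (φ a.src) = conj (φ a.rng)
    rw [h.2]
  · rw [if_neg h, if_neg, map_zero]
    exact fun h' => h ⟨inv_eq_one.1 h'.1, h'.2.symm⟩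

theorem mul_unitConv_apply (φ : C_c(𝓐.History, ℂ)) (f : 𝓐.groupoid.ConvAlg) (a : 𝓐.Arrow) :
    (f * unitConv φ) a = f a * φ a.src := by
  have h : f * unitConv φ = star (unitConv (star φ) * star f) := by
    rw [star_mul, star_star, star_unitConv, star_star]
  rw [h]
  change conj ((unitConv (star φ) * star f) (Arrow.inv a)) = _
  rw [unitConv_mul_apply, map_mul, mul_comm]
  congr 1
  · change conj (conj (f (Arrow.inv (Arrow.inv a)))) = _
    rw [Complex.conj_conj]
    exact congrArg f (EtaleGroupoid.inv_inv (G := 𝓐.groupoid) a)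
  · exact Complex.conj_conj _

/-- The star-homomorphism from functions on objects to the convolution algebra. -/
def unitHom : C_c(𝓐.History, ℂ) →⋆ₙₐ[ℂ] 𝓐.groupoid.ConvAlg where
  toFun := unitConv
  map_smul' c φ := ConvAlg.ext fun (a : 𝓐.Arrow) => by
    change unitFun (c • φ) a = c * unitFun φ a
    unfold unitFun
    split_ifs <;> simp
  map_zero' := ConvAlg.ext fun (a : 𝓐.Arrow) => by
    change unitFun (0 : C_c(𝓐.History, ℂ)) a = 0
    unfold unitFun
    split_ifs <;> simp
  map_add' φ ψ := ConvAlg.ext fun (a : 𝓐.Arrow) => by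
    change unitFun (φ + ψ) a = unitFun φ a + unitFun ψ a
    unfold unitFun
    split_ifs <;> simp
  map_mul' φ ψ := ConvAlg.ext fun (a : 𝓐.Arrow) => by
    rw [unitConv_mul_apply]
    change unitFun (φ * ψ) a = φ a.rng * unitFun ψ a
    unfold unitFun
    split_ifs <;> simp
  map_star' φ := (star_unitConv φ).symm

end CorrespondenceAction

end Bisections

/-! ### Algebraic representations by compactly supported functions -/

noncomputable section AlgebraicRepresentations

namespace CorrespondenceAction

open FracGroup

open EtaleGroupoid (ConvAlg)

variable {P : Type*} [Monoid P] {X : Type*} [TopologicalSpace X] [T2Space X]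
  (𝓐 : CorrespondenceAction P X)

/-- A representation of the compactly supported functions in the product system in a
star-algebra, with the covariance condition in algebraic form. -/
structure CcRep (C : Type*) [NonUnitalRing C] [StarRing C] [Module ℂ C] where
  S : ∀ p, C_c(𝓐.M p, ℂ) →ₗ[ℂ] C
  S_mul_S : ∀ {p q w : P} (h : p * q = w) (ξ : C_c(𝓐.M p, ℂ)) (η : C_c(𝓐.M q, ℂ)),
    S p ξ * S q η = S w (ccProd h ξ η)
  star_S_mul_S : ∀ (p : P) (ξ η : C_c(𝓐.M p, ℂ)),
    star (S p ξ) * S p η = S 1 (ccPull 1 (ccInner ξ η))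
  cov : ∀ (p : P) (f : C_c(X, ℂ)) (n : ℕ) (α β : Fin n → C_c(𝓐.M p, ℂ)),
    IsKernel (ccPull p f) α β → S 1 (ccPull 1 f) = ∑ i, S p (α i) * star (S p (β i))

variable {𝓐}

/-- The restriction of a representation to compactly supported functions. -/
def PreRep.toCcRep {B : Type*} [NonUnitalCStarAlgebra B] (R : 𝓐.PreRep B) : 𝓐.CcRep B where
  S p := (R.S p).comp (HilbMod.ofCc (𝓐.isLocalHomeomorph_s p))
  S_mul_S {p q w} h ξ η := (R.S_mul_S h (ofCc ξ) (ofCc η)).trans (by rw [prodHilb_ofCc]; rfl)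
  star_S_mul_S p ξ η := by
    refine (R.star_S_mul_S p (ofCc ξ) (ofCc η)).trans ?_
    rw [innerC_ofCc, ← R.S_one, unitHilb_ccToC0]
    rfl
  cov p f n α β h := by
    refine Eq.trans ?_ (R.cov p f n α β h)
    rw [← R.S_one, unitHilb_ccToC0]
    rfl

/-- The product of two representations. -/
def CcRep.prod {C C' : Type*} [NonUnitalRing C] [StarRing C] [Module ℂ C] [NonUnitalRing C']
    [StarRing C'] [Module ℂ C'] (R : 𝓐.CcRep C) (R' : 𝓐.CcRep C') : 𝓐.CcRep (C × C') where
  S p := (R.S p).prod (R'.S p)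
  S_mul_S h ξ η := Prod.ext (R.S_mul_S h ξ η) (R'.S_mul_S h ξ η)
  star_S_mul_S p ξ η := Prod.ext (R.star_S_mul_S p ξ η) (R'.star_S_mul_S p ξ η)
  cov p f n α β h := by
    refine Prod.ext ?_ ?_
    · rw [Prod.fst_sum]
      exact R.cov p f n α β h
    · rw [Prod.snd_sum]
      exact R'.cov p f n α β h

section GroupoidRep

variable [RightOre P] [LocallyCompactSpace X]

theorem arrowConv_apply {p : P} (ξ : C_c(𝓐.M p, ℂ)) (a : 𝓐.Arrow) :
    arrowConv ξ a = arrowFun ξ a := rfl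

theorem arrowFun_arrowSection {p : P} (ξ : 𝓐.M p → ℂ) (x : 𝓐.History) :
    arrowFun ξ (arrowSection p x) = ξ (x.proj p) := if_pos ⟨frac_one p, rfl⟩

/-- The support of `arrowFun ξ` lies in the bisection formed by the arrows `arrowSection p x`. -/
theorem eq_arrowSection_of_ne_zero {p : P} {ξ : 𝓐.M p → ℂ} {a : 𝓐.Arrow} (h : arrowFun ξ a ≠ 0) :
    a = arrowSection p a.rng := by
  unfold arrowFun at h
  split_ifs at h with h1
  · exact Arrow.ext rfl (h1.1.trans (frac_one p).symm) h1.2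
  · exact absurd rfl h

theorem arrowConv_mul_apply {p : P} (ξ : C_c(𝓐.M p, ℂ)) (f : 𝓐.groupoid.ConvAlg) (a : 𝓐.Arrow) :
    (arrowConv ξ * f) a =
      ξ (a.rng.proj p) * f (Arrow.mul (Arrow.inv (arrowSection p a.rng)) a rfl : 𝓐.Arrow) := by
  rw [ConvAlg.mul_apply_of_eq_zero (G := 𝓐.groupoid) (a := a) (b := arrowSection p a.rng) rfl]
  · congr 1
    exact arrowFun_arrowSection ξ a.rng
  · intro c (hc : c.rng = a.rng) hne
    by_contra h
    refine hne ?_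
    rw [← hc]
    exact eq_arrowSection_of_ne_zero h

theorem arrowFun_of {p : P} (ξ : 𝓐.M p → ℂ) {a : 𝓐.Arrow} (h1 : a.frc = ι p)
    (h2 : a.src = a.rng.shift p) : arrowFun ξ a = ξ (a.rng.proj p) := if_pos ⟨h1, h2⟩

theorem unitFun_of (φ : 𝓐.History → ℂ) {a : 𝓐.Arrow} (h : a.frc = 1 ∧ a.src = a.rng) :
    unitFun φ a = φ a.rng := if_pos h

theorem unitFun_of_not (φ : 𝓐.History → ℂ) {a : 𝓐.Arrow} (h : ¬ (a.frc = 1 ∧ a.src = a.rng)) :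
    unitFun φ a = 0 := if_neg h

theorem arrowFun_of_not {p : P} (ξ : 𝓐.M p → ℂ) {a : 𝓐.Arrow}
    (h : ¬ (a.frc = ι p ∧ a.src = a.rng.shift p)) : arrowFun ξ a = 0 := if_neg h

theorem inv_frac_mul_inv_eq {p q : P} {g : FracGroup P} :
    ((frac p 1)⁻¹ * g)⁻¹ = ι q ↔ g = frac p q := by
  rw [frac_one, frac_eq, mul_inv_rev, inv_inv, inv_mul_eq_iff_eq_mul, ← mul_inv_eq_iff_eq_mul,
    eq_comm]

theorem inv_frac_mul_eq {p q w : P} (h : p * q = w) {g : FracGroup P} :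
    (frac p 1)⁻¹ * g = ι q ↔ g = ι w := by
  rw [frac_one, inv_mul_eq_iff_eq_mul, ← map_mul, h]

theorem arrowConv_mul_star_apply_of {p q : P} (ξ : C_c(𝓐.M p, ℂ)) (η : C_c(𝓐.M q, ℂ))
    {a : 𝓐.Arrow} (h1 : a.frc = frac p q) (h2 : a.rng.shift p = a.src.shift q) :
    (arrowConv ξ * star (arrowConv η)) a = ξ (a.rng.proj p) * conj (η (a.src.proj q)) :=
  (arrowConv_mul_apply ξ _ a).trans (congrArg (fun z => ξ (a.rng.proj p) * conj z)
    (arrowFun_of (a := Arrow.inv (Arrow.mul (Arrow.inv (arrowSection p a.rng)) a rfl)) η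
      (inv_frac_mul_inv_eq.2 h1) h2))

theorem arrowConv_mul_star_apply_of_not {p q : P} (ξ : C_c(𝓐.M p, ℂ)) (η : C_c(𝓐.M q, ℂ))
    {a : 𝓐.Arrow} (h : ¬ (a.frc = frac p q ∧ a.rng.shift p = a.src.shift q)) :
    (arrowConv ξ * star (arrowConv η)) a = 0 := by
  refine (arrowConv_mul_apply ξ _ a).trans ?_
  have h0 : arrowFun η (Arrow.inv (Arrow.mul (Arrow.inv (arrowSection p a.rng)) a rfl)) = 0 :=
    arrowFun_of_not η fun h' => h ⟨inv_frac_mul_inv_eq.1 h'.1, h'.2⟩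
  have h1 : star (arrowConv η) (Arrow.mul (Arrow.inv (arrowSection p a.rng)) a rfl : 𝓐.Arrow) = 0 :=
    (congrArg conj h0).trans (map_zero _)
  rw [h1, mul_zero]

theorem arrowConv_mul_arrowConv {p q w : P} (h : p * q = w) (ξ : C_c(𝓐.M p, ℂ))
    (η : C_c(𝓐.M q, ℂ)) : arrowConv ξ * arrowConv η = arrowConv (ccProd h ξ η) := by
  refine ConvAlg.ext fun (a : 𝓐.Arrow) => (arrowConv_mul_apply ξ _ a).trans ?_
  set b : 𝓐.Arrow := Arrow.mul (Arrow.inv (arrowSection p a.rng)) a rfl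
  have hb : b.src = b.rng.shift q ↔ a.src = a.rng.shift w := by
    rw [← h, ← History.shift_shift]
    exact Iff.rfl
  change ξ (a.rng.proj p) * arrowFun η b = arrowFun (ccProd h ξ η) a
  by_cases ha : a.frc = ι w ∧ a.src = a.rng.shift w
  · rw [arrowFun_of _ ha.1 ha.2, arrowFun_of η ((inv_frac_mul_eq h).2 ha.1) (hb.2 ha.2),
      ccProd_apply, a.rng.cutL_proj h, ← History.proj_shift _ h]
    rfl
  · rw [arrowFun_of_not _ ha, arrowFun_of_not η fun h' =>
      ha ⟨(inv_frac_mul_eq h).1 h'.1, hb.1 h'.2⟩, mul_zero]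

/-- Histories are extended freely: any matching `m` may be put in front of a complete history. -/
theorem exists_history {p : P} {x : 𝓐.History} {m : 𝓐.M p} (h : 𝓐.s p m = x.base) :
    ∃ u : 𝓐.History, u.proj p = m ∧ u.shift p = x := by
  have h1 := History.split_extend (t := p) ⟨(m, x), h⟩
  exact ⟨History.extend (t := p) ⟨(m, x), h⟩, congrArg (fun y => y.1.1) h1,
    congrArg (fun y => y.1.2) h1⟩

theorem history_ext {p : P} {x y : 𝓐.History} (h1 : x.proj p = y.proj p)
    (h2 : x.shift p = y.shift p) : x = y := by
  rw [← History.extend_split p x, ← History.extend_split p y]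
  congr 1
  exact Subtype.ext (Prod.ext h1 h2)

/-- The convolution sum runs over the complete histories `u` with `u.shift p = x`, and these
correspond to the points of the fibre of `s p` over the base point of `x`. -/
theorem star_arrowConv_mul_arrowConv {p : P} (ξ η : C_c(𝓐.M p, ℂ)) :
    star (arrowConv ξ) * arrowConv η = arrowConv (ccPull 1 (ccInner ξ η) : C_c(𝓐.M 1, ℂ)) := by
  refine ConvAlg.ext fun (a : 𝓐.Arrow) => ?_
  have key : ∀ z : 𝓐.groupoid.comp ⁻¹' {a}, star (arrowConv ξ) z.1.1.1 * arrowConv η z.1.1.2 ≠ 0 →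
      ∃ u : 𝓐.History, z.1.1.1 = Arrow.inv (arrowSection p u) ∧ z.1.1.2 = arrowSection p u ∧
        a = Arrow.one (u.shift p) := by
    rintro ⟨⟨⟨b, c⟩, e⟩, h⟩ hz
    have e' : b.src = c.rng := e
    have hb : arrowFun ξ (Arrow.inv b) ≠ 0 := fun h0 => left_ne_zero_of_mul hz (by
      change conj (arrowFun ξ (Arrow.inv b)) = 0
      rw [h0, map_zero])
    have hc : c = arrowSection p c.rng := eq_arrowSection_of_ne_zero (right_ne_zero_of_mul hz)
    have hb' : Arrow.inv b = arrowSection p c.rng := by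
      rw [← e']
      exact eq_arrowSection_of_ne_zero hb
    have hb2 : b = Arrow.inv (arrowSection p c.rng) := by
      rw [← hb']
      exact (EtaleGroupoid.inv_inv (G := 𝓐.groupoid) b).symm
    refine ⟨c.rng, hb2, hc, ?_⟩
    have h4 : 𝓐.groupoid.mul b c e = a := h
    have h5 : b = 𝓐.groupoid.inv c := by rw [hc]; exact hb2
    rw [← h4, EtaleGroupoid.mul_congr (G := 𝓐.groupoid) h5 rfl e (𝓐.groupoid.s_inv c),
      𝓐.groupoid.inv_mul]
    exact congrArg Arrow.one (congrArg Arrow.src hc)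
  refine (ConvAlg.mul_apply (G := 𝓐.groupoid) _ _ a).trans ?_
  rw [arrowConv_apply]
  by_cases ha : a.frc = 1 ∧ a.src = a.rng
  · have ha1 : a = Arrow.one a.rng := Arrow.ext_iff_units.2 ha
    have hR : arrowFun (ccPull 1 (ccInner ξ η) : C_c(𝓐.M 1, ℂ)) a =
        ∑' m : 𝓐.s p ⁻¹' {a.rng.base}, conj (ξ m) * η m :=
      if_pos ⟨by rw [ha.1, map_one], by rw [History.shift_one, ha.2]⟩
    rw [hR]
    choose u hu1 hu2 using fun m : 𝓐.s p ⁻¹' {a.rng.base} => exists_history (x := a.rng) m.2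
    let i : 𝓐.s p ⁻¹' {a.rng.base} → 𝓐.groupoid.comp ⁻¹' {a} := fun m =>
      ⟨⟨(Arrow.inv (arrowSection p (u m)), arrowSection p (u m)), rfl⟩, by
        refine (𝓐.groupoid.inv_mul (arrowSection p (u m))).trans ?_
        rw [ha1]
        exact congrArg Arrow.one (hu2 m)⟩
    have hi : Function.Injective i := by
      intro m m' h
      have h1 : arrowSection p (u m) = arrowSection p (u m') :=
        congrArg (fun z : 𝓐.groupoid.comp ⁻¹' {a} => z.1.1.2) h
      refine Subtype.ext ?_
      rw [← hu1 m, ← hu1 m', show u m = u m' from congrArg Arrow.rng h1]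
    refine (hi.tsum_eq (f := fun z : 𝓐.groupoid.comp ⁻¹' {a} =>
      star (arrowConv ξ) z.1.1.1 * arrowConv η z.1.1.2) ?_).symm.trans ?_
    rotate_left
    · refine tsum_congr fun m => ?_
      change conj (arrowFun ξ (Arrow.inv (Arrow.inv (arrowSection p (u m))))) *
        arrowFun η (arrowSection p (u m)) = _
      rw [show Arrow.inv (Arrow.inv (arrowSection p (u m))) = arrowSection p (u m) from
        EtaleGroupoid.inv_inv (G := 𝓐.groupoid) _, arrowFun_arrowSection, arrowFun_arrowSection,
        hu1]
    · intro z hz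
      obtain ⟨v, h1, h2, h3⟩ := key z hz
      have h4 : v.shift p = a.rng := (congrArg Arrow.rng h3).symm
      have h5 : 𝓐.s p (v.proj p) = a.rng.base := by rw [← History.base_shift, h4]
      refine ⟨⟨v.proj p, h5⟩, Subtype.ext (Subtype.ext ?_)⟩
      have h6 : u ⟨v.proj p, h5⟩ = v := history_ext (hu1 _) ((hu2 _).trans h4.symm)
      refine Prod.ext ?_ ?_
      · change Arrow.inv (arrowSection p (u ⟨v.proj p, h5⟩)) = _
        rw [h6, h1]
      · change arrowSection p (u ⟨v.proj p, h5⟩) = _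
        rw [h6, h2]
  · have hR : arrowFun (ccPull 1 (ccInner ξ η) : C_c(𝓐.M 1, ℂ)) a = 0 :=
      if_neg fun h => ha ⟨by rw [h.1, map_one], by rw [h.2, History.shift_one]⟩
    rw [hR]
    refine Eq.trans (tsum_congr fun z => ?_) tsum_zero
    by_contra hz
    obtain ⟨v, h1, h2, h3⟩ := key z hz
    exact ha (by rw [h3]; exact ⟨rfl, rfl⟩)

/-- If multiplication by `φ` is the operator `∑ i, |α i⟩⟨β i|`, then the corresponding sum in the
convolution algebra is the function `φ` on units. -/
theorem sum_arrowConv_apply {p : P} {φ : 𝓐.M p → ℂ} {n : ℕ} {α β : Fin n → C_c(𝓐.M p, ℂ)}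
    (h : IsKernel φ α β) (a : 𝓐.Arrow) :
    (∑ i, arrowConv (α i) * star (arrowConv (β i))) a = unitFun (fun x => φ (x.proj p)) a := by
  refine (ConvAlg.sum_apply (G := 𝓐.groupoid) _ _ a).trans ?_
  by_cases ha2 : a.frc = frac p p ∧ a.rng.shift p = a.src.shift p
  · refine (Finset.sum_congr rfl fun i _ =>
      arrowConv_mul_star_apply_of (α i) (β i) ha2.1 ha2.2).trans ?_
    have h1 : a.frc = 1 := ha2.1.trans (frac_self p)
    by_cases ha : a.src = a.rng
    · refine Eq.trans ?_ (unitFun_of _ ⟨h1, ha⟩).symm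
      rw [ha]
      exact h.1 _
    · refine Eq.trans ?_ (unitFun_of_not _ fun h' => ha h'.2).symm
      have hne : a.rng.proj p ≠ a.src.proj p := fun h1 => ha (history_ext h1 ha2.2).symm
      refine h.2 _ _ ?_ hne
      rw [← History.base_shift, ha2.2, History.base_shift]
  · refine (Finset.sum_eq_zero fun i _ =>
      arrowConv_mul_star_apply_of_not (α i) (β i) ha2).trans (unitFun_of_not _ fun h' => ha2 ?_).symm
    exact ⟨h'.1.trans (frac_self p).symm, by rw [h'.2]⟩

variable (𝓐) in
/-- The representation of the product system in the convolution algebra of the groupoid. -/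
def groupoidRep : 𝓐.CcRep 𝓐.groupoid.ConvAlg where
  S p :=
    { toFun := arrowConv
      map_add' := fun ξ η => ConvAlg.ext fun (a : 𝓐.Arrow) => by
        change arrowFun (ξ + η) a = arrowFun ξ a + arrowFun η a
        unfold arrowFun
        split_ifs <;> simp
      map_smul' := fun c ξ => ConvAlg.ext fun (a : 𝓐.Arrow) => by
        change arrowFun (c • ξ) a = c * arrowFun ξ a
        unfold arrowFun
        split_ifs <;> simp }
  S_mul_S h ξ η := arrowConv_mul_arrowConv h ξ η
  star_S_mul_S p ξ η := star_arrowConv_mul_arrowConv ξ η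
  cov p f n α β h := by
    refine ConvAlg.ext fun (a : 𝓐.Arrow) => ?_
    refine Eq.trans ?_ (sum_arrowConv_apply h a).symm
    change arrowFun _ a = _
    by_cases ha : a.frc = 1 ∧ a.src = a.rng
    · refine (arrowFun_of _ (ha.1.trans (map_one _).symm)
        (ha.2.trans (History.shift_one _).symm)).trans
        (Eq.trans ?_ (unitFun_of _ ha).symm)
      rw [ccPull_apply, ccPull_apply, History.r_proj, History.r_proj]
    · refine (arrowFun_of_not _ fun h' => ha ⟨h'.1.trans (map_one _),
        h'.2.trans (History.shift_one _)⟩).trans (unitFun_of_not _ ha).symm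

end GroupoidRep

end CorrespondenceAction

end AlgebraicRepresentations

/-! ### Normal forms in the algebra generated by a representation -/

noncomputable section NormalForms

namespace CorrespondenceAction

namespace CcRep

open FracGroup

variable {P : Type*} [Monoid P] {X : Type*} [TopologicalSpace X] [T2Space X]
  {𝓐 : CorrespondenceAction P X} {C : Type*} [NonUnitalRing C] [StarRing C] [Module ℂ C]
  [IsScalarTower ℂ C C] [SMulCommClass ℂ C C] [StarModule ℂ C] (R : 𝓐.CcRep C)

/-- The linear span of the elements `S p ξ * star (S q η)` for fixed `p` and `q`. -/
def spanMulStar (p q : P) : Submodule ℂ C :=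
  Submodule.span ℂ (range fun a : C_c(𝓐.M p, ℂ) × C_c(𝓐.M q, ℂ) => R.S p a.1 * star (R.S q a.2))

theorem mul_star_mem {p q : P} (ξ : C_c(𝓐.M p, ℂ)) (η : C_c(𝓐.M q, ℂ)) :
    R.S p ξ * star (R.S q η) ∈ R.spanMulStar p q := Submodule.subset_span ⟨(ξ, η), rfl⟩

variable {R}

theorem spanMulStar_induction {p q : P} {Q : C → Prop}
    (gen : ∀ (ξ : C_c(𝓐.M p, ℂ)) (η : C_c(𝓐.M q, ℂ)), Q (R.S p ξ * star (R.S q η))) (zero : Q 0)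
    (add : ∀ a b, Q a → Q b → Q (a + b)) (smul : ∀ (c : ℂ) a, Q a → Q (c • a))
    {a : C} (ha : a ∈ R.spanMulStar p q) : Q a :=
  Submodule.span_induction (by rintro _ ⟨x, rfl⟩; exact gen x.1 x.2) zero
    (fun a b _ _ => add a b) (fun c a _ => smul c a) ha

theorem star_mem_spanMulStar {p q : P} {a : C} (ha : a ∈ R.spanMulStar p q) :
    star a ∈ R.spanMulStar q p := by
  refine spanMulStar_induction (Q := fun a => star a ∈ R.spanMulStar q p) (fun ξ η => ?_) ?_
    (fun a b ha hb => ?_) (fun c a ha => ?_) ha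
  · rw [star_mul, star_star]
    exact R.mul_star_mem η ξ
  · rw [star_zero]
    exact zero_mem _
  · rw [star_add]
    exact add_mem ha hb
  · rw [star_smul]
    exact Submodule.smul_mem _ _ ha

theorem mul_mem_spanMulStar {p q r : P} {a b : C} (ha : a ∈ R.spanMulStar p q)
    (hb : b ∈ R.spanMulStar q r) : a * b ∈ R.spanMulStar p r := by
  refine spanMulStar_induction (Q := fun a => a * b ∈ R.spanMulStar p r) (fun ξ η => ?_) ?_
    (fun a b ha hb => ?_) (fun c a ha => ?_) ha
  · refine spanMulStar_induction (Q := fun b => R.S p ξ * star (R.S q η) * b ∈ R.spanMulStar p r)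
      (fun ξ' η' => ?_) ?_ (fun a b ha hb => ?_) (fun c a ha => ?_) hb
    · rw [mul_assoc, ← mul_assoc (star _), R.star_S_mul_S, ← mul_assoc, R.S_mul_S (mul_one p)]
      exact R.mul_star_mem _ _
    · rw [mul_zero]
      exact zero_mem _
    · rw [mul_add]
      exact add_mem ha hb
    · rw [mul_smul_comm]
      exact Submodule.smul_mem _ _ ha
  · rw [zero_mul]
    exact zero_mem _
  · rw [add_mul]
    exact add_mem ha hb
  · rw [smul_mul_assoc]
    exact Submodule.smul_mem _ _ ha

/-- The covariance condition rewrites `S p ξ` as a sum of elements of longer length. -/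
theorem exists_S_eq_sum [LocallyCompactSpace X] {p w : P} (t : P) (hw : p * t = w)
    (ξ : C_c(𝓐.M p, ℂ)) : ∃ (n : ℕ) (α : Fin n → C_c(𝓐.M w, ℂ)) (β : Fin n → C_c(𝓐.M t, ℂ)),
      ∀ R : 𝓐.CcRep C, R.S p ξ = ∑ i, R.S w (α i) * star (R.S t (β i)) := by
  obtain ⟨F, hF, -⟩ := exists_cc_eq_one
    (ξ.hasCompactSupport.isCompact.image (𝓐.continuous_s p))
  obtain ⟨n, α, β, h⟩ := exists_isKernel (ccPull (𝓐 := 𝓐) t F)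
  refine ⟨n, fun i => ccProd hw ξ (α i), β, fun R => ?_⟩
  have h1 : ccProd (mul_one p) ξ (ccPull 1 F) = ξ := by
    refine CompactlySupportedContinuousMap.ext fun m => ?_
    rw [ccProd_apply, ccPull_apply, r_one_cutR, 𝓐.cutL_one]
    by_cases hm : m ∈ tsupport ξ
    · rw [hF _ (mem_image_of_mem _ hm), mul_one]
    · rw [image_eq_zero_of_notMem_tsupport hm, zero_mul]
  rw [← h1, ← R.S_mul_S, h1, R.cov t F n α β h, Finset.mul_sum]
  exact Finset.sum_congr rfl fun i _ => by rw [← mul_assoc, R.S_mul_S hw]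

theorem S_mem_spanMulStar [LocallyCompactSpace X] {p w t : P} (hw : p * t = w)
    (ξ : C_c(𝓐.M p, ℂ)) : R.S p ξ ∈ R.spanMulStar w t := by
  obtain ⟨n, α, β, h⟩ := exists_S_eq_sum (C := C) t hw ξ
  rw [h R]
  exact sum_mem fun i _ => R.mul_star_mem _ _

/-- Prolongation: the spaces `spanMulStar p q` increase along common right multiples, so the elements
of a fixed degree form a directed union. -/
theorem spanMulStar_le [LocallyCompactSpace X] (p q t : P) :
    R.spanMulStar p q ≤ R.spanMulStar (p * t) (q * t) := by
  refine Submodule.span_le.2 ?_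
  rintro _ ⟨⟨ξ, η⟩, rfl⟩
  obtain ⟨n, α, β, h⟩ := exists_S_eq_sum (C := C) t rfl ξ
  change R.S p ξ * star (R.S q η) ∈ _
  rw [h R, Finset.sum_mul]
  refine sum_mem fun i _ => ?_
  rw [mul_assoc, ← star_mul, R.S_mul_S rfl]
  exact R.mul_star_mem _ _

variable (R) in
/-- The elements of degree `g`: those of `spanMulStar p q` with `g = p q⁻¹`. -/
def HasDegree [RightOre P] (g : FracGroup P) (a : C) : Prop :=
  ∃ p q, frac p q = g ∧ a ∈ R.spanMulStar p q

section Degree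

variable [RightOre P]

theorem HasDegree.zero (g : FracGroup P) : R.HasDegree g 0 := by
  obtain ⟨p, q, h⟩ := exists_eq_frac g
  exact ⟨p, q, h.symm, zero_mem _⟩

theorem HasDegree.smul {g : FracGroup P} {a : C} (c : ℂ) (ha : R.HasDegree g a) :
    R.HasDegree g (c • a) := by
  obtain ⟨p, q, h, h1⟩ := ha
  exact ⟨p, q, h, Submodule.smul_mem _ _ h1⟩

theorem HasDegree.add [LocallyCompactSpace X] {g : FracGroup P} {a b : C} (ha : R.HasDegree g a)
    (hb : R.HasDegree g b) : R.HasDegree g (a + b) := by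
  obtain ⟨p, q, h, h1⟩ := ha
  obtain ⟨p', q', h', h1'⟩ := hb
  obtain ⟨t, t', h2, h3⟩ := frac_eq_frac_iff.1 (h.trans h'.symm)
  refine ⟨p * t, q * t, (frac_mul_right p q t).trans h, add_mem (spanMulStar_le p q t h1) ?_⟩
  rw [h2, h3]
  exact spanMulStar_le p' q' t' h1'

/-- An element of degree `1` lies in `spanMulStar p p` for some `p`. -/
theorem HasDegree.exists_mem [LocallyCompactSpace X] {a : C} (ha : R.HasDegree 1 a) :
    ∃ p, a ∈ R.spanMulStar p p := by
  obtain ⟨p, q, h, h1⟩ := ha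
  obtain ⟨t, t', h2, h3⟩ := frac_eq_frac_iff.1 (h.trans (frac_self (1 : P)).symm)
  have h4 := spanMulStar_le p q t h1
  rw [h2, h3] at h4
  exact ⟨_, h4⟩

variable (R) in
/-- The star-algebra generated by a representation, in normal form. -/
def algebra : Submodule ℂ C :=
  Submodule.span ℂ {a | ∃ g, R.HasDegree g a}

theorem HasDegree.mem {g : FracGroup P} {a : C} (h : R.HasDegree g a) : a ∈ R.algebra :=
  Submodule.subset_span ⟨g, h⟩

theorem spanMulStar_le_algebra (p q : P) : R.spanMulStar p q ≤ R.algebra := fun _ h =>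
  Submodule.subset_span ⟨_, p, q, rfl, h⟩

theorem S_mem [LocallyCompactSpace X] {p : P} (ξ : C_c(𝓐.M p, ℂ)) : R.S p ξ ∈ R.algebra :=
  spanMulStar_le_algebra _ _ (S_mem_spanMulStar (mul_one p) ξ)

theorem star_mem {a : C} (ha : a ∈ R.algebra) : star a ∈ R.algebra := by
  refine Submodule.span_induction ?_ ?_ (fun a b _ _ ha hb => ?_) (fun c a _ ha => ?_) ha
  · rintro a ⟨g, p, q, h, h1⟩
    exact spanMulStar_le_algebra _ _ (star_mem_spanMulStar h1)
  · rw [star_zero]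
    exact zero_mem _
  · rw [star_add]
    exact add_mem ha hb
  · rw [star_smul]
    exact Submodule.smul_mem _ _ ha

theorem mul_mem [LocallyCompactSpace X] {a b : C} (ha : a ∈ R.algebra) (hb : b ∈ R.algebra) :
    a * b ∈ R.algebra := by
  refine Submodule.span_induction ?_ ?_ (fun a b _ _ ha hb => ?_) (fun c a _ ha => ?_) ha
  · rintro a ⟨g, p, q, -, h1⟩
    refine Submodule.span_induction ?_ ?_ (fun a b _ _ ha hb => ?_) (fun c a _ ha => ?_) hb
    · rintro b ⟨g', p', q', -, h2⟩
      obtain ⟨u, u', hu⟩ := RightOre.exists_mul_eq_mul q p'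
      have h3 := spanMulStar_le p q u h1
      have h4 := spanMulStar_le p' q' u' h2
      rw [hu] at h3
      exact spanMulStar_le_algebra _ _ (mul_mem_spanMulStar h3 h4)
    · rw [mul_zero]
      exact zero_mem _
    · rw [mul_add]
      exact add_mem ha hb
    · rw [mul_smul_comm]
      exact Submodule.smul_mem _ _ ha
  · rw [zero_mul]
    exact zero_mem _
  · rw [add_mul]
    exact add_mem ha hb
  · rw [smul_mul_assoc]
    exact Submodule.smul_mem _ _ ha

end Degree

end CcRep

end CorrespondenceAction

end NormalForms

/-! ### Functions on the space of complete histories under a representation -/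

noncomputable section UnitSpace

section Ore

variable {P : Type*} [Monoid P] [RightOre P]

/-- Finitely many elements of a right Ore monoid have a common right multiple. -/
theorem RightOre.exists_common_multiple (A : Finset P) : ∃ (w : P) (v : P → P),
    ∀ a ∈ A, a * v a = w := by
  classical
  induction A using Finset.induction_on with
  | empty => exact ⟨1, 1, by simp⟩
  | insert a A ha ih =>
    obtain ⟨w, v, h⟩ := ih
    obtain ⟨y, z, hyz⟩ := RightOre.exists_mul_eq_mul a w
    refine ⟨w * z, fun b => if b = a then y else v b * z, fun b hb => ?_⟩
    dsimp only
    by_cases hba : b = a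
    · rw [if_pos hba, hba, hyz]
    · rw [if_neg hba, ← mul_assoc, h b ((Finset.mem_insert.1 hb).resolve_left hba)]

theorem RightOre.exists_mul_eq_mul_of_finset {ι : Type*} (T : Finset ι) (p x y : ι → P)
    (h : ∀ i ∈ T, p i * x i = p i * y i) : ∃ z, ∀ i ∈ T, x i * z = y i * z := by
  classical
  induction T using Finset.induction_on with
  | empty => exact ⟨1, by simp⟩
  | insert j T hj ih =>
    obtain ⟨z, hz⟩ := ih fun i hi => h i (Finset.mem_insert_of_mem hi)
    obtain ⟨z', hz'⟩ := RightOre.exists_mul_eq_mul_of_mul_eq_mul (p j) (x j * z) (y j * z) (by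
      rw [← mul_assoc, ← mul_assoc, h j (Finset.mem_insert_self j T)])
    refine ⟨z * z', fun i hi => ?_⟩
    rw [← mul_assoc, ← mul_assoc]
    rcases Finset.mem_insert.1 hi with rfl | hi
    · exact hz'
    · rw [hz i hi]

end Ore

namespace CorrespondenceAction

open FracGroup

open EtaleGroupoid (ConvAlg)

variable {P : Type*} [Monoid P] [RightOre P] {X : Type*} [TopologicalSpace X] [T2Space X]
  {𝓐 : CorrespondenceAction P X}

/-- A point of `X` in a compact set has a complete history if some point of this set has
histories of all lengths: this is the nonemptiness of a projective limit of compact spaces. -/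
theorem exists_history_of_forall {K : Set X} (hK : IsCompact K)
    (h : ∀ t, ∃ m : 𝓐.M t, 𝓐.r t m ∈ K) : ∃ x : 𝓐.History, x.base ∈ K := by
  classical
  have h1 : IsCompact (Set.univ.pi fun p => 𝓐.r p ⁻¹' K) :=
    isCompact_univ_pi fun p => (𝓐.isProperMap_r p).isCompact_preimage hK
  obtain ⟨m, hm1, hm2⟩ := h1.inter_iInter_nonempty
    (fun c : P × P => {m : ∀ p, 𝓐.M p | 𝓐.cutL (p := c.1) (q := c.2) rfl (m (c.1 * c.2)) = m c.1})
    (fun c => isClosed_eq ((𝓐.continuous_cutL rfl).comp (continuous_apply _))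
      (continuous_apply _)) fun T => by
    obtain ⟨w, v, hv⟩ := RightOre.exists_common_multiple
      (T.image Prod.fst ∪ T.image fun c => c.1 * c.2)
    have hv1 : ∀ c ∈ T, c.1 * v c.1 = w := fun c hc => hv _
      (Finset.mem_union_left _ (Finset.mem_image_of_mem _ hc))
    have hv2 : ∀ c ∈ T, c.1 * c.2 * v (c.1 * c.2) = w := fun c hc => hv _
      (Finset.mem_union_right _ (Finset.mem_image_of_mem (fun c : P × P => c.1 * c.2) hc))
    obtain ⟨z, hz⟩ := RightOre.exists_mul_eq_mul_of_finset T Prod.fst (fun c => v c.1)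
      (fun c => c.2 * v (c.1 * c.2)) fun c hc => by
        rw [hv1 c hc, ← mul_assoc, hv2 c hc]
    obtain ⟨m, hm⟩ := h (w * z)
    choose n hn using h
    -- truncate one history of length `w * z` where possible
    refine ⟨fun a => if ha : a * (v a * z) = w * z then 𝓐.cutL ha m else n a, fun a _ => ?_,
      mem_iInter₂.2 fun c hc => ?_⟩
    · change 𝓐.r a (dite _ _ _) ∈ K
      split_ifs with ha
      · rw [𝓐.r_cutL]
        exact hm
      · exact hn a
    · have e1 : c.1 * (v c.1 * z) = w * z := by rw [← mul_assoc, hv1 c hc]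
      have e2 : c.1 * c.2 * (v (c.1 * c.2) * z) = w * z := by rw [← mul_assoc, hv2 c hc]
      change 𝓐.cutL rfl (dite _ _ _) = dite _ _ _
      rw [dif_pos e1, dif_pos e2]
      refine 𝓐.cutL_cutL rfl (b := v c.1 * z) ?_ e2 e1 m
      rw [hz c hc, mul_assoc]
  refine ⟨⟨m, fun {p q w} h => ?_⟩, hm1 1 trivial⟩
  subst h
  exact mem_iInter.1 hm2 (p, q)

namespace PreRep

variable {B : Type*} [NonUnitalCStarAlgebra B] (R : 𝓐.PreRep B)

/-- A representation kills functions that vanish at all points with a complete history. -/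
theorem S_ccPull_eq_zero (F : C_c(X, ℂ)) (hF : ∀ x : 𝓐.History, F x.base = 0) :
    R.toCcRep.S 1 (ccPull 1 F) = 0 := by
  rw [← norm_le_zero_iff]
  refine le_of_forall_pos_le_add fun ε hε => ?_
  rw [zero_add]
  have hK : IsCompact {x | ε ≤ ‖F x‖} := by
    refine F.hasCompactSupport.isCompact.of_isClosed_subset
      (isClosed_le continuous_const F.continuous.norm) fun x hx => subset_tsupport _ ?_
    intro h0
    have : ε ≤ ‖F x‖ := hx
    rw [h0, norm_zero] at this
    exact absurd hε this.not_gt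
  obtain ⟨t, ht⟩ : ∃ t, ∀ m : 𝓐.M t, ¬ ε ≤ ‖F (𝓐.r t m)‖ := by
    by_contra! h
    obtain ⟨x, hx⟩ := exists_history_of_forall hK h
    have : ε ≤ ‖F x.base‖ := hx
    rw [hF, norm_zero] at this
    exact absurd hε this.not_gt
  obtain ⟨n, α, β, h⟩ := exists_isKernel (ccPull (𝓐 := 𝓐) t F)
  rw [R.toCcRep.cov t F n α β h]
  exact R.norm_sum_ofCc_le h hε.le fun m => (not_le.1 (ht m)).le

end PreRep

namespace CcRep

variable {C : Type*} [NonUnitalRing C] [StarRing C] [Module ℂ C]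
  [IsScalarTower ℂ C C] [SMulCommClass ℂ C C] [StarModule ℂ C] {R : 𝓐.CcRep C}

/-- Compression by `S p ζ` and `S q ζ'` maps `spanMulStar p q` to functions on `X`. -/
theorem exists_star_mul_mul_eq {p q : P} {v : C} (hv : v ∈ R.spanMulStar p q)
    (ζ : C_c(𝓐.M p, ℂ)) (ζ' : C_c(𝓐.M q, ℂ)) :
    ∃ F : C_c(X, ℂ), star (R.S p ζ) * v * R.S q ζ' = R.S 1 (ccPull 1 F) := by
  refine spanMulStar_induction
    (Q := fun v => ∃ F : C_c(X, ℂ), star (R.S p ζ) * v * R.S q ζ' = R.S 1 (ccPull 1 F))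
    (fun ξ η => ⟨ccInner ζ ξ * ccInner η ζ', ?_⟩) ⟨0, ?_⟩ ?_ ?_ hv
  · rw [← mul_assoc, mul_assoc, R.star_S_mul_S, R.star_S_mul_S, R.S_mul_S (mul_one 1),
      ccProd_ccPull]
  · rw [ccPull_zero, map_zero, mul_zero, zero_mul]
  · rintro a b ⟨F, hF⟩ ⟨F', hF'⟩
    exact ⟨F + F', by rw [mul_add, add_mul, hF, hF', ccPull_add, map_add]⟩
  · rintro c a ⟨F, hF⟩
    exact ⟨c • F, by rw [mul_smul_comm, smul_mul_assoc, hF, ccPull_smul, map_smul]⟩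

/-- If all compressions of `b` vanish, then so do all products `a * b * a'` with `a` and `a'` in
`spanMulStar q p`. -/
theorem mul_mul_eq_zero {p q : P} {b : C}
    (hb : ∀ ζ ζ', star (R.S p ζ) * b * R.S q ζ' = 0) {a a' : C} (ha : a ∈ R.spanMulStar q p)
    (ha' : a' ∈ R.spanMulStar q p) : a * b * a' = 0 := by
  refine spanMulStar_induction (Q := fun a => a * b * a' = 0) (fun η ξ => ?_) ?_ ?_ ?_ ha
  · refine spanMulStar_induction (Q := fun a' => R.S q η * star (R.S p ξ) * b * a' = 0)
      (fun η' ξ' => ?_) ?_ ?_ ?_ ha'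
    · have h1 : R.S q η * star (R.S p ξ) * b * (R.S q η' * star (R.S p ξ')) =
          R.S q η * (star (R.S p ξ) * b * R.S q η') * star (R.S p ξ') := by
        simp only [mul_assoc]
      rw [h1, hb, mul_zero, zero_mul]
    · rw [mul_zero]
    · intro a b ha hb
      rw [mul_add, ha, hb, add_zero]
    · intro c a ha
      rw [mul_smul_comm, ha, smul_zero]
  · rw [zero_mul, zero_mul]
  · intro a b ha hb
    rw [add_mul, add_mul, ha, hb, add_zero]
  · intro c a ha
    rw [smul_mul_assoc, smul_mul_assoc, ha, smul_zero]

theorem snd_mem_spanMulStar {C' : Type*} [NonUnitalRing C'] [StarRing C'] [Module ℂ C']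
    [IsScalarTower ℂ C' C'] [SMulCommClass ℂ C' C'] [StarModule ℂ C'] {R' : 𝓐.CcRep C'} {p q : P}
    {v : C × C'} (hv : v ∈ (R.prod R').spanMulStar p q) : v.2 ∈ R'.spanMulStar p q :=
  spanMulStar_induction (Q := fun v : C × C' => v.2 ∈ R'.spanMulStar p q)
    (fun ξ η => R'.mul_star_mem ξ η) (zero_mem _) (fun _ _ => add_mem)
    (fun c _ => Submodule.smul_mem _ c) hv

end CcRep

end CorrespondenceAction

end UnitSpace

/-! ### The relation between convolution algebra and representation -/

noncomputable section GraphAlgebra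

namespace CorrespondenceAction

open FracGroup

open EtaleGroupoid (ConvAlg)

variable {P : Type*} [Monoid P] [RightOre P] {X : Type*} [TopologicalSpace X] [T2Space X]
  [LocallyCompactSpace X] {𝓐 : CorrespondenceAction P X}

theorem restrictFrc_of_eq {g : FracGroup P} (f : 𝓐.groupoid.ConvAlg) {a : 𝓐.Arrow}
    (h : a.frc = g) : restrictFrc g f a = f a := if_pos h

theorem restrictFrc_of_ne {g : FracGroup P} (f : 𝓐.groupoid.ConvAlg) {a : 𝓐.Arrow}
    (h : a.frc ≠ g) : restrictFrc g f a = 0 := if_neg h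

theorem restrictFrc_zero (g : FracGroup P) : restrictFrc g (0 : 𝓐.groupoid.ConvAlg) = 0 :=
  ConvAlg.ext fun (a : 𝓐.Arrow) => by
    by_cases h : a.frc = g
    · exact restrictFrc_of_eq _ h
    · exact restrictFrc_of_ne _ h

theorem restrictFrc_add (g : FracGroup P) (f f' : 𝓐.groupoid.ConvAlg) :
    restrictFrc g (f + f') = restrictFrc g f + restrictFrc g f' :=
  ConvAlg.ext fun (a : 𝓐.Arrow) => by
    change restrictFrc g (f + f') a = restrictFrc g f a + restrictFrc g f' a
    by_cases h : a.frc = g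
    · rw [restrictFrc_of_eq _ h, restrictFrc_of_eq _ h, restrictFrc_of_eq _ h]
      rfl
    · rw [restrictFrc_of_ne _ h, restrictFrc_of_ne _ h, restrictFrc_of_ne _ h, add_zero]

theorem restrictFrc_smul (g : FracGroup P) (c : ℂ) (f : 𝓐.groupoid.ConvAlg) :
    restrictFrc g (c • f) = c • restrictFrc g f :=
  ConvAlg.ext fun (a : 𝓐.Arrow) => by
    change restrictFrc g (c • f) a = c * restrictFrc g f a
    by_cases h : a.frc = g
    · rw [restrictFrc_of_eq _ h, restrictFrc_of_eq _ h]
      rfl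
    · rw [restrictFrc_of_ne _ h, restrictFrc_of_ne _ h, mul_zero]

namespace PreRep

variable {B : Type*} [NonUnitalCStarAlgebra B] (R : 𝓐.PreRep B)

instance : NonUnitalRing (𝓐.groupoid.ConvAlg × B) := Prod.instNonUnitalRing
instance : StarRing (𝓐.groupoid.ConvAlg × B) := Prod.instStarRing
instance : Module ℂ (𝓐.groupoid.ConvAlg × B) := Prod.instModule
instance : IsScalarTower ℂ (𝓐.groupoid.ConvAlg × B) (𝓐.groupoid.ConvAlg × B) := inferInstance
instance : SMulCommClass ℂ (𝓐.groupoid.ConvAlg × B) (𝓐.groupoid.ConvAlg × B) := inferInstance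
instance : StarModule ℂ (𝓐.groupoid.ConvAlg × B) := inferInstance

/-- The product of the representation in the convolution algebra with a given representation. -/
def graphRep : 𝓐.CcRep (𝓐.groupoid.ConvAlg × B) := 𝓐.groupoidRep.prod R.toCcRep

variable {R}

theorem fst_mul_star {p q : P} (ξ : C_c(𝓐.M p, ℂ)) (η : C_c(𝓐.M q, ℂ)) :
    (R.graphRep.S p ξ * star (R.graphRep.S q η)).1 = arrowConv ξ * star (arrowConv η) := rfl

theorem snd_mul_star {p q : P} (ξ : C_c(𝓐.M p, ℂ)) (η : C_c(𝓐.M q, ℂ)) :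
    (R.graphRep.S p ξ * star (R.graphRep.S q η)).2 =
      R.S p (ofCc ξ) * star (R.S q (ofCc η)) := rfl

theorem fst_apply_eq_zero {p q : P} {v : 𝓐.groupoid.ConvAlg × B}
    (hv : v ∈ R.graphRep.spanMulStar p q) {a : 𝓐.Arrow}
    (ha : ¬ (a.frc = frac p q ∧ a.rng.shift p = a.src.shift q)) : v.1 a = 0 := by
  refine CcRep.spanMulStar_induction (Q := fun v : 𝓐.groupoid.ConvAlg × B => v.1 a = 0)
    (fun ξ η => ?_) ?_ (fun v w hv hw => ?_)
    (fun c v hv => ?_) hv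
  · rw [fst_mul_star]
    exact arrowConv_mul_star_apply_of_not ξ η ha
  · rfl
  · change v.1 a + w.1 a = 0
    rw [hv, hw, add_zero]
  · change c * v.1 a = 0
    rw [hv, mul_zero]

/-- On a homogeneous part, the first component determines the second one: compressions reduce this
to functions on `X`, where `S_ccPull_eq_zero` applies, and then `star b * b * star b = 0`. -/
theorem snd_eq_zero {p q : P} {v : 𝓐.groupoid.ConvAlg × B} (hv : v ∈ R.graphRep.spanMulStar p q)
    (h0 : v.1 = 0) : v.2 = 0 := by
  have h1 := CcRep.snd_mem_spanMulStar hv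
  have h2 := CcRep.star_mem_spanMulStar h1
  refine eq_zero_of_star_mul_mul_star (CcRep.mul_mul_eq_zero (fun ζ ζ' => ?_) h2 h2)
  obtain ⟨F, hF⟩ := CcRep.exists_star_mul_mul_eq hv ζ ζ'
  have h3 : star (R.toCcRep.S p ζ) * v.2 * R.toCcRep.S q ζ' = R.toCcRep.S 1 (ccPull 1 F) :=
    congrArg Prod.snd hF
  have h4 : star (𝓐.groupoidRep.S p ζ) * v.1 * 𝓐.groupoidRep.S q ζ' = arrowConv (ccPull 1 F) :=
    congrArg Prod.fst hF
  rw [h0, mul_zero, zero_mul] at h4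
  rw [h3]
  refine R.S_ccPull_eq_zero F fun x => ?_
  have h5 : arrowFun (ccPull 1 F : C_c(𝓐.M 1, ℂ)) (arrowSection 1 x) = 0 :=
    (congrArg (fun f : 𝓐.groupoid.ConvAlg => f (arrowSection 1 x : 𝓐.Arrow)) h4).symm
  rw [arrowFun_arrowSection] at h5
  exact h5

/-- On units, first components of elements of `spanMulStar p p` are functions on `M p`. -/
theorem exists_apply_one {p : P} {v : 𝓐.groupoid.ConvAlg × B}
    (hv : v ∈ R.graphRep.spanMulStar p p) :
    ∃ a : C_c(𝓐.M p, ℂ), ∀ x : 𝓐.History, v.1 (Arrow.one x : 𝓐.Arrow) = a (x.proj p) := by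
  refine CcRep.spanMulStar_induction (Q := fun v : 𝓐.groupoid.ConvAlg × B =>
    ∃ a : C_c(𝓐.M p, ℂ), ∀ x : 𝓐.History, v.1 (Arrow.one x : 𝓐.Arrow) = a (x.proj p))
    (fun ξ η => ⟨ξ * star η, fun x => ?_⟩) ⟨0, fun x => rfl⟩ ?_ ?_ hv
  · rw [fst_mul_star]
    exact arrowConv_mul_star_apply_of (a := Arrow.one x) ξ η (frac_self p).symm rfl
  · rintro v w ⟨a, ha⟩ ⟨b, hb⟩
    exact ⟨a + b, fun x => congrArg₂ (· + ·) (ha x) (hb x)⟩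
  · rintro c v ⟨a, ha⟩
    exact ⟨c • a, fun x => congrArg (c * ·) (ha x)⟩

variable (R) in
/-- A function on `M p`, viewed as a function on units, has a lift whose second component is
controlled by the supremum norm on the whole of `M p`. -/
theorem exists_unit {p : P} (ξ : C_c(𝓐.M p, ℂ)) : ∃ v ∈ R.graphRep.spanMulStar p p,
    (∀ a : 𝓐.Arrow, v.1 a = unitFun (fun x => ξ (x.proj p)) a) ∧
    ∀ c, 0 ≤ c → (∀ m, ‖ξ m‖ ≤ c) → ‖v.2‖ ≤ c := by
  obtain ⟨n, α, β, h⟩ := exists_isKernel ξ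
  refine ⟨∑ i, R.graphRep.S p (α i) * star (R.graphRep.S p (β i)),
    sum_mem fun i _ => R.graphRep.mul_star_mem _ _, fun a => ?_, fun c hc hξ => ?_⟩
  · rw [Prod.fst_sum, Finset.sum_congr rfl fun i _ => fst_mul_star (α i) (β i)]
    exact sum_arrowConv_apply h a
  · rw [Prod.snd_sum, Finset.sum_congr rfl fun i _ => snd_mul_star (α i) (β i)]
    exact R.norm_sum_ofCc_le h hc hξ

/-- The truncation of a function at absolute value `c`. -/
theorem _root_.CompactlySupportedContinuousMap.exists_truncation {M : Type*} [TopologicalSpace M]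
    (a : C_c(M, ℂ)) {c : ℝ} (hc : 0 < c) :
    ∃ b : C_c(M, ℂ), (∀ m, ‖a m‖ ≤ c → b m = a m) ∧ ∀ m, ‖b m‖ ≤ c := by
  have hpos : ∀ m, 0 < max c ‖a m‖ := fun m => lt_max_of_lt_left hc
  refine ⟨.ofFun (fun m => ((c / max c ‖a m‖ : ℝ) : ℂ) * a m) ?_
    a.hasCompactSupport.mul_left, fun m hm => ?_, fun m => ?_⟩
  · refine (Complex.continuous_ofReal.comp ?_).mul a.continuous
    exact continuous_const.div (continuous_const.max a.continuous.norm) fun m => (hpos m).ne'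
  · change ((c / max c ‖a m‖ : ℝ) : ℂ) * a m = a m
    rw [max_eq_left hm, div_self hc.ne', Complex.ofReal_one, one_mul]
  · change ‖((c / max c ‖a m‖ : ℝ) : ℂ) * a m‖ ≤ c
    rw [norm_mul, Complex.norm_real, Real.norm_of_nonneg (div_nonneg hc.le (hpos m).le),
      div_mul_eq_mul_div, div_le_iff₀ (hpos m)]
    exact mul_le_mul_of_nonneg_left (le_max_right _ _) hc.le

/-- The first component only sees a function `a` on `M p` on the image of the space of complete
histories; truncating `a` at `c` does not change it there, and makes `exists_unit` applicable. -/
theorem norm_snd_le_of_units {p : P} {v : 𝓐.groupoid.ConvAlg × B}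
    (hv : v ∈ R.graphRep.spanMulStar p p) (hu : ∀ a : 𝓐.Arrow, v.1 a ≠ 0 → a = Arrow.one a.rng)
    {c : ℝ} (hc : 0 < c) (hvc : ∀ a : 𝓐.Arrow, ‖v.1 a‖ ≤ c) : ‖v.2‖ ≤ c := by
  obtain ⟨a, ha⟩ := exists_apply_one hv
  obtain ⟨b, hb1, hb2⟩ := a.exists_truncation hc
  obtain ⟨w, hw, hw1, hw2⟩ := R.exists_unit b
  have h1 : (v - w).1 = 0 := by
    change v.1 - w.1 = 0
    rw [sub_eq_zero]
    refine ConvAlg.ext fun (e : 𝓐.Arrow) => Eq.trans ?_ (hw1 e).symm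
    by_cases he : e.frc = 1 ∧ e.src = e.rng
    · rw [unitFun_of _ he, hb1 _ (by rw [← ha]; exact hvc _), ← ha,
        ← Arrow.ext_iff_units.2 he]
    · rw [unitFun_of_not _ he]
      by_contra h0
      exact he (Arrow.ext_iff_units.1 (hu e h0))
  have h2 : v.2 - w.2 = 0 := snd_eq_zero (sub_mem hv hw) h1
  rw [sub_eq_zero.1 h2]
  exact hw2 c hc.le hb2

theorem HasDegree.restrictFrc_self {g : FracGroup P} {v : 𝓐.groupoid.ConvAlg × B}
    (hv : R.graphRep.HasDegree g v) : restrictFrc g v.1 = v.1 := by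
  obtain ⟨p, q, h, hv⟩ := hv
  refine ConvAlg.ext fun (a : 𝓐.Arrow) => ?_
  by_cases ha : a.frc = g
  · exact restrictFrc_of_eq _ ha
  · refine (restrictFrc_of_ne _ ha).trans (fst_apply_eq_zero hv fun h' => ha ?_).symm
    exact h'.1.trans h

theorem HasDegree.restrictFrc_of_ne {g h : FracGroup P} (hne : h ≠ g) {v : 𝓐.groupoid.ConvAlg × B}
    (hv : R.graphRep.HasDegree g v) : restrictFrc h v.1 = 0 := by
  obtain ⟨p, q, h', hv⟩ := hv
  refine ConvAlg.ext fun (a : 𝓐.Arrow) => ?_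
  by_cases ha : a.frc = h
  · refine (restrictFrc_of_eq _ ha).trans (fst_apply_eq_zero hv fun h'' => hne ?_)
    rw [← ha, ← h']
    exact h''.1
  · exact CorrespondenceAction.restrictFrc_of_ne _ ha

open Classical in
/-- Decomposition into homogeneous components. -/
theorem exists_homogeneous {v : 𝓐.groupoid.ConvAlg × B} (hv : v ∈ R.graphRep.algebra) :
    ∃ w : FracGroup P →₀ 𝓐.groupoid.ConvAlg × B, (∀ g, R.graphRep.HasDegree g (w g)) ∧
      (∀ g, (w g).1 = restrictFrc g v.1) ∧ v = w.sum fun _ c => c := by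
  refine Submodule.span_induction (p := fun v _ =>
    ∃ w : FracGroup P →₀ 𝓐.groupoid.ConvAlg × B, (∀ g, R.graphRep.HasDegree g (w g)) ∧
      (∀ g, (w g).1 = restrictFrc g v.1) ∧ v = w.sum fun _ c => c) ?_ ?_ ?_ ?_ hv
  · rintro v ⟨g, hg⟩
    refine ⟨Finsupp.single g v, fun h => ?_, fun h => ?_, ?_⟩
    · by_cases hh : h = g
      · rw [hh, Finsupp.single_eq_same]
        exact hg
      · rw [Finsupp.single_eq_of_ne hh]
        exact CcRep.HasDegree.zero h
    · by_cases hh : h = g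
      · rw [hh, Finsupp.single_eq_same, HasDegree.restrictFrc_self hg]
      · rw [Finsupp.single_eq_of_ne hh, HasDegree.restrictFrc_of_ne hh hg]
        rfl
    · rw [Finsupp.sum_single_index rfl]
  · exact ⟨0, fun g => CcRep.HasDegree.zero g, fun g => (restrictFrc_zero g).symm,
      Finsupp.sum_zero_index.symm⟩
  · rintro v v' - - ⟨w, h1, h2, h3⟩ ⟨w', h1', h2', h3'⟩
    refine ⟨w + w', fun g => ?_, fun g => ?_, ?_⟩
    · rw [Finsupp.add_apply]
      exact (h1 g).add (h1' g)
    · rw [Finsupp.add_apply, Prod.fst_add, Prod.fst_add, h2, h2', restrictFrc_add]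
    · rw [Finsupp.sum_add_index' (fun _ => rfl) (fun _ _ _ => rfl), ← h3, ← h3']
  · rintro c v - ⟨w, h1, h2, h3⟩
    refine ⟨c • w, fun g => ?_, fun g => ?_, ?_⟩
    · rw [Finsupp.smul_apply]
      exact (h1 g).smul c
    · rw [Finsupp.smul_apply, Prod.smul_fst, Prod.smul_fst, h2, restrictFrc_smul]
    · rw [Finsupp.sum_smul_index' (fun _ => rfl), ← Finsupp.smul_sum, ← h3]

end PreRep

/-- A star-subalgebra of `ConvAlg × B` is a controlled relation if it is closed under restriction
to the arrows over an element of the group of fractions, if its elements over functions on units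
satisfy the norm estimate of a star-homomorphism, and if it contains elements over those functions
on units that come from the spaces `M p`. -/
structure IsControlled {B : Type*} [NonUnitalCStarAlgebra B]
    (E : Submodule ℂ (𝓐.groupoid.ConvAlg × B)) : Prop where
  star_mem : ∀ v ∈ E, star v ∈ E
  mul_mem : ∀ v ∈ E, ∀ w ∈ E, v * w ∈ E
  restrict_mem : ∀ v ∈ E, ∀ g, ∃ w ∈ E, w.1 = restrictFrc g v.1
  unit_mem : ∀ (p : P) (ξ : C_c(𝓐.M p, ℂ)), ∃ w ∈ E,
    ∀ a : 𝓐.Arrow, w.1 a = unitFun (fun x => ξ (x.proj p)) a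
  norm_snd_le : ∀ v ∈ E, (∀ a : 𝓐.Arrow, v.1 a ≠ 0 → a = Arrow.one a.rng) →
    ∀ c, 0 < c → (∀ a : 𝓐.Arrow, ‖v.1 a‖ ≤ c) → ‖v.2‖ ≤ c

/-- The relation generated by a representation is controlled. Its elements over functions on units
have degree `1`, because their other homogeneous components vanish in both coordinates. -/
theorem PreRep.isControlled {B : Type*} [NonUnitalCStarAlgebra B] (R : 𝓐.PreRep B) :
    IsControlled R.graphRep.algebra where
  star_mem _ := CcRep.star_mem
  mul_mem _ hv _ := CcRep.mul_mem hv
  restrict_mem v hv g := by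
    obtain ⟨w, h1, h2, -⟩ := exists_homogeneous hv
    exact ⟨w g, (h1 g).mem, h2 g⟩
  unit_mem p ξ := by
    obtain ⟨v, h1, h2, -⟩ := R.exists_unit ξ
    exact ⟨v, CcRep.spanMulStar_le_algebra _ _ h1, h2⟩
  norm_snd_le v hv hu c hc hvc := by
    obtain ⟨w, h1, h2, h3⟩ := exists_homogeneous hv
    have h4 : ∀ g, g ≠ 1 → w g = 0 := by
      intro g hg
      have h5 : (w g).1 = 0 := by
        rw [h2]
        refine ConvAlg.ext fun (a : 𝓐.Arrow) => ?_
        by_cases ha : a.frc = g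
        · refine (restrictFrc_of_eq _ ha).trans ?_
          by_contra h0
          exact hg (ha.symm.trans (Arrow.ext_iff_units.1 (hu a h0)).1)
        · exact restrictFrc_of_ne _ ha
      obtain ⟨p, q, -, h6⟩ := h1 g
      exact Prod.ext h5 (snd_eq_zero h6 h5)
    have h5 : v = w 1 := by
      rw [h3]
      exact Finset.sum_eq_single 1 (fun g _ hg => h4 g hg) fun h => Finsupp.notMem_support_iff.1 h
    obtain ⟨p, h6⟩ := (h1 1).exists_mem
    rw [← h5] at h6
    exact norm_snd_le_of_units h6 hu hc hvc

end CorrespondenceAction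

end GraphAlgebra

/-! ### Norm estimates for functions supported in a compact set -/

noncomputable section NormEstimate

universe w

namespace CorrespondenceAction

open FracGroup

open EtaleGroupoid (ConvAlg)

variable {P : Type*} [Monoid P] [RightOre P] {X : Type*} [TopologicalSpace X] [T2Space X]
  [LocallyCompactSpace X] {𝓐 : CorrespondenceAction P X}

theorem Arrow.range_ofPiece_subset (p q t : P) :
    range (Arrow.ofPiece (𝓐 := 𝓐) p q) ⊆ range (Arrow.ofPiece (𝓐 := 𝓐) (p * t) (q * t)) := by
  intro a ha
  rw [Arrow.mem_range_ofPiece] at ha ⊢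
  refine ⟨ha.1.trans (frac_mul_right p q t).symm, ?_⟩
  rw [← History.shift_shift, ha.2, History.shift_shift]

/-- The sets of arrows `range (ofPiece p q)` for fixed `p q⁻¹` are directed, so a compact set of
arrows over one element of the group of fractions lies in one of them. -/
theorem Arrow.exists_subset_range_ofPiece {K : Set 𝓐.Arrow} (hK : IsCompact K) {g : FracGroup P}
    (hg : ∀ a ∈ K, a.frc = g) : ∃ p q, frac p q = g ∧ K ⊆ range (Arrow.ofPiece (𝓐 := 𝓐) p q) := by
  obtain ⟨p₀, q₀, h₀⟩ := exists_eq_frac g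
  have : Nonempty {pq : P × P // frac pq.1 pq.2 = g} := ⟨⟨(p₀, q₀), h₀.symm⟩⟩
  obtain ⟨⟨pq, h⟩, hpq⟩ := hK.elim_directed_cover
    (fun pq : {pq : P × P // frac pq.1 pq.2 = g} => range (Arrow.ofPiece (𝓐 := 𝓐) pq.1.1 pq.1.2))
    (fun pq => Arrow.isOpen_range_ofPiece _ _) (fun a ha => by
      obtain ⟨p, q, h1, h2⟩ := a.exists_frac
      exact mem_iUnion.2 ⟨⟨(p, q), h1.symm.trans (hg a ha)⟩, Arrow.mem_range_ofPiece.2 ⟨h1, h2⟩⟩)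
    (by
      rintro ⟨⟨p, q⟩, h⟩ ⟨⟨p', q'⟩, h'⟩
      obtain ⟨t, t', h1, h2⟩ := frac_eq_frac_iff.1 (h.trans h'.symm)
      refine ⟨⟨(p * t, q * t), (frac_mul_right p q t).trans h⟩,
        Arrow.range_ofPiece_subset p q t, ?_⟩
      change range (Arrow.ofPiece p' q') ⊆ range (Arrow.ofPiece (p * t) (q * t))
      rw [h1, h2]
      exact Arrow.range_ofPiece_subset p' q' t')
  exact ⟨pq.1, pq.2, h, hpq⟩

/-- A function supported in a compact set is the sum of finitely many of its restrictions to the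
arrows over an element of the group of fractions. -/
theorem exists_sum_restrictFrc {K : Set 𝓐.Arrow} (hK : IsCompact K) :
    ∃ T : Finset (FracGroup P), ∀ f : 𝓐.groupoid.ConvAlg, (∀ a : 𝓐.Arrow, f a ≠ 0 → a ∈ K) →
      ∑ g ∈ T, restrictFrc g f = f := by
  obtain ⟨T, hT⟩ := hK.elim_finite_subcover (fun g : FracGroup P => {a : 𝓐.Arrow | a.frc = g})
    Arrow.isOpen_frc fun a _ => mem_iUnion.2 ⟨a.frc, rfl⟩
  refine ⟨T, fun f hf => ConvAlg.ext fun (a : 𝓐.Arrow) => ?_⟩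
  refine (ConvAlg.sum_apply (G := 𝓐.groupoid) _ _ a).trans ?_
  by_cases ha : a.frc ∈ T
  · rw [Finset.sum_eq_single_of_mem a.frc ha fun g _ hg => restrictFrc_of_ne _ hg.symm]
    exact restrictFrc_of_eq _ rfl
  · have h0 : f a = 0 := by
      by_contra h0
      obtain ⟨g, hg, hag⟩ := mem_iUnion₂.1 (hT (hf a h0))
      exact ha ((show a.frc = g from hag) ▸ hg)
    refine (Finset.sum_eq_zero fun g hg => restrictFrc_of_ne _ ?_).trans h0.symm
    rintro rfl
    exact ha hg

/-- The composite of a compactly supported function on `M p` with the projection from the space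
of complete histories. -/
def ccProj (p : P) (ξ : C_c(𝓐.M p, ℂ)) : C_c(𝓐.History, ℂ) :=
  .ofFun (fun x => ξ (x.proj p)) (ξ.continuous.comp (History.continuous_proj p))
    (HasCompactSupport.intro (History.isCompact_preimage_proj ξ.hasCompactSupport.isCompact)
      fun _ hx => image_eq_zero_of_notMem_tsupport hx)

namespace IsControlled

variable {B : Type*} [NonUnitalCStarAlgebra B] {E : Submodule ℂ (𝓐.groupoid.ConvAlg × B)}
  (hE : IsControlled E)

include hE

theorem snd_eq_zero {v : 𝓐.groupoid.ConvAlg × B} (hv : v ∈ E) (h : v.1 = 0) : v.2 = 0 := by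
  rw [← norm_le_zero_iff]
  refine le_of_forall_pos_le_add fun ε hε => ?_
  rw [zero_add]
  have h0 : ∀ a : 𝓐.Arrow, v.1 a = 0 := fun a => by rw [h]; rfl
  exact hE.norm_snd_le v hv (fun a ha => absurd (h0 a) ha) ε hε fun a => by
    rw [h0 a, norm_zero]
    exact hε.le

theorem snd_eq_of_fst_eq {v w : 𝓐.groupoid.ConvAlg × B} (hv : v ∈ E) (hw : w ∈ E)
    (h : v.1 = w.1) : v.2 = w.2 :=
  sub_eq_zero.1 (hE.snd_eq_zero (sub_mem hv hw) (sub_eq_zero.2 h))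

theorem exists_unitConv (p : P) (ξ : C_c(𝓐.M p, ℂ)) :
    ∃ w ∈ E, w.1 = unitConv (ccProj p ξ) := by
  obtain ⟨w, h1, h2⟩ := hE.unit_mem p ξ
  exact ⟨w, h1, ConvAlg.ext fun (a : 𝓐.Arrow) => h2 a⟩

/-- For functions supported on a bisection the estimate follows from that on units by the
C⋆-identity. -/
theorem norm_snd_le_of_bisection {v : 𝓐.groupoid.ConvAlg × B} (hv : v ∈ E)
    (hr : ∀ a b : 𝓐.Arrow, v.1 a ≠ 0 → v.1 b ≠ 0 → a.rng = b.rng → a = b)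
    (hs : ∀ a b : 𝓐.Arrow, v.1 a ≠ 0 → v.1 b ≠ 0 → a.src = b.src → a = b) {c : ℝ} (hc : 0 < c)
    (hvc : ∀ a : 𝓐.Arrow, ‖v.1 a‖ ≤ c) : ‖v.2‖ ≤ c := by
  obtain ⟨h1, h2⟩ := EtaleGroupoid.ConvAlg.star_mul_self_of_bisection (G := 𝓐.groupoid) hr hs hvc
  have h3 : ‖star v.2 * v.2‖ ≤ c ^ 2 := hE.norm_snd_le (star v * v)
    (hE.mul_mem _ (hE.star_mem v hv) _ hv) h1 (c ^ 2) (by positivity) h2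
  rw [CStarRing.norm_star_mul_self, ← sq] at h3
  exact (pow_le_pow_iff_left₀ (norm_nonneg _) hc.le two_ne_zero).1 h3

omit hE

/-- Partitions of unity along `s p` and `s q` cut a function on `range (ofPiece p q)` into functions
that are supported on bisections.  Their number only depends on the compact set. -/
theorem exists_norm_snd_le_of_piece {K : Set 𝓐.Arrow} (hK : IsCompact K) {p q : P}
    (hpq : K ⊆ range (Arrow.ofPiece (𝓐 := 𝓐) p q)) : ∃ C : ℝ, 0 ≤ C ∧
      ∀ {B : Type w} [NonUnitalCStarAlgebra B] {E : Submodule ℂ (𝓐.groupoid.ConvAlg × B)},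
      IsControlled E → ∀ v ∈ E, (∀ a : 𝓐.Arrow, v.1 a ≠ 0 → a ∈ K) → ∀ c, 0 < c →
      (∀ a : 𝓐.Arrow, ‖v.1 a‖ ≤ c) → ‖v.2‖ ≤ C * c := by
  obtain ⟨n, β, β1, β2, β3⟩ := (𝓐.isLocalHomeomorph_s p).exists_partition
    (hK.image ((History.continuous_proj p).comp Arrow.continuous_rng))
  obtain ⟨m, γ, γ1, γ2, γ3⟩ := (𝓐.isLocalHomeomorph_s q).exists_partition
    (hK.image ((History.continuous_proj q).comp Arrow.continuous_src))
  refine ⟨n * m, by positivity, fun hE v hv hvK c hc hvc => ?_⟩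
  choose u hu hu1 using fun i => hE.exists_unitConv p (β i * star (β i))
  choose w hw hw1 using fun j => hE.exists_unitConv q (γ j * star (γ j))
  have hval : ∀ i j (a : 𝓐.Arrow), (u i * v * w j).1 a =
      (β i (a.rng.proj p) * conj (β i (a.rng.proj p))) * v.1 a *
        (γ j (a.src.proj q) * conj (γ j (a.src.proj q))) := by
    intro i j a
    change ((u i).1 * v.1 * (w j).1) a = _
    rw [hu1, hw1, mul_unitConv_apply, unitConv_mul_apply]
    rfl
  have hmem : ∀ i j, u i * v * w j ∈ _ := fun i j =>
    hE.mul_mem _ (hE.mul_mem _ (hu i) _ hv) _ (hw j)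
  have hne : ∀ i j (a : 𝓐.Arrow), (u i * v * w j).1 a ≠ 0 → β i (a.rng.proj p) ≠ 0 ∧
      γ j (a.src.proj q) ≠ 0 ∧ a.frc = frac p q ∧ a.rng.shift p = a.src.shift q := by
    intro i j a ha
    rw [hval] at ha
    have h1 := left_ne_zero_of_mul ha
    exact ⟨left_ne_zero_of_mul (left_ne_zero_of_mul h1),
      left_ne_zero_of_mul (right_ne_zero_of_mul ha),
      Arrow.mem_range_ofPiece.1 (hpq (hvK a (right_ne_zero_of_mul h1)))⟩
  have hle : ∀ z : ℂ, ‖z‖ ≤ 1 → ‖z * conj z‖ ≤ 1 := fun z hz => by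
    rw [norm_mul, RCLike.norm_conj]
    exact mul_le_one₀ hz (norm_nonneg _) hz
  have hbound : ∀ i j, ‖(u i * v * w j).2‖ ≤ c := by
    intro i j
    refine hE.norm_snd_le_of_bisection (hmem i j) (fun a b ha hb hab => ?_)
      (fun a b ha hb hab => ?_) hc fun a => ?_
    · obtain ⟨-, h2, h3, h4⟩ := hne i j a ha
      obtain ⟨-, h2', h3', h4'⟩ := hne i j b hb
      have h5 : a.src.shift q = b.src.shift q := by rw [← h4, ← h4', hab]
      refine Arrow.ext hab (h3.trans h3'.symm) (history_ext (γ3 j _ _ h2 h2' ?_) h5)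
      rw [← History.base_shift, ← History.base_shift, h5]
    · obtain ⟨h2, -, h3, h4⟩ := hne i j a ha
      obtain ⟨h2', -, h3', h4'⟩ := hne i j b hb
      have h5 : a.rng.shift p = b.rng.shift p := by rw [h4, h4', hab]
      refine Arrow.ext (history_ext (β3 i _ _ h2 h2' ?_) h5) (h3.trans h3'.symm) hab
      rw [← History.base_shift, ← History.base_shift, h5]
    · rw [hval, norm_mul, norm_mul]
      have h1 := hle _ (β2 i (a.rng.proj p))
      have h2 := hle _ (γ2 j (a.src.proj q))
      refine (mul_le_of_le_one_right (by positivity) h2).trans ?_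
      exact (mul_le_of_le_one_left (norm_nonneg _) h1).trans (hvc a)
  have hsum : v.2 = (∑ i, ∑ j, u i * v * w j).2 := by
    refine hE.snd_eq_of_fst_eq hv (sum_mem fun i _ => sum_mem fun j _ => hmem i j) ?_
    refine ConvAlg.ext fun (a : 𝓐.Arrow) => ?_
    have h1 : (∑ i, ∑ j, u i * v * w j).1 a = ∑ i, ∑ j, (u i * v * w j).1 a := by
      rw [Prod.fst_sum]
      refine (ConvAlg.sum_apply (G := 𝓐.groupoid) _ _ a).trans
        (Finset.sum_congr rfl fun i _ => ?_)
      rw [Prod.fst_sum]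
      exact ConvAlg.sum_apply (G := 𝓐.groupoid) _ _ a
    refine Eq.trans ?_ h1.symm
    simp only [hval]
    by_cases ha : v.1 a = 0
    · simp only [ha, mul_zero, zero_mul, Finset.sum_const_zero]
    · have haK := hvK a ha
      simp only [← Finset.mul_sum, ← Finset.sum_mul]
      rw [β1 (a.rng.proj p) ⟨a, haK, rfl⟩, γ1 (a.src.proj q) ⟨a, haK, rfl⟩, one_mul, mul_one]
  rw [hsum, Prod.snd_sum]
  calc ‖∑ i, (∑ j, u i * v * w j).2‖ ≤ ∑ i : Fin n, ∑ j : Fin m, c := by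
        refine (norm_sum_le _ _).trans (Finset.sum_le_sum fun i _ => ?_)
        rw [Prod.snd_sum]
        exact (norm_sum_le _ _).trans (Finset.sum_le_sum fun j _ => hbound i j)
    _ = n * m * c := by simp [mul_assoc]

/-- The supremum norm of functions supported in a fixed compact set controls the norm in `B`. -/
theorem exists_norm_snd_le {K : Set 𝓐.Arrow} (hK : IsCompact K) : ∃ C : ℝ, 0 ≤ C ∧
      ∀ {B : Type w} [NonUnitalCStarAlgebra B] {E : Submodule ℂ (𝓐.groupoid.ConvAlg × B)},
      IsControlled E → ∀ v ∈ E, (∀ a : 𝓐.Arrow, v.1 a ≠ 0 → a ∈ K) → ∀ c, 0 < c →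
      (∀ a : 𝓐.Arrow, ‖v.1 a‖ ≤ c) → ‖v.2‖ ≤ C * c := by
  obtain ⟨T, hT⟩ := exists_sum_restrictFrc hK
  have h1 : ∀ g : FracGroup P, ∃ C : ℝ, 0 ≤ C ∧
      ∀ {B : Type w} [NonUnitalCStarAlgebra B] {E : Submodule ℂ (𝓐.groupoid.ConvAlg × B)},
      IsControlled E → ∀ v ∈ E, (∀ a : 𝓐.Arrow, v.1 a ≠ 0 → a ∈ K ∩ {a | a.frc = g}) → ∀ c, 0 < c →
      (∀ a : 𝓐.Arrow, ‖v.1 a‖ ≤ c) → ‖v.2‖ ≤ C * c := by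
    intro g
    obtain ⟨p, q, -, hpq⟩ := Arrow.exists_subset_range_ofPiece
      (hK.inter_right (Arrow.isClosed_frc g)) fun a ha => ha.2
    exact exists_norm_snd_le_of_piece (hK.inter_right (Arrow.isClosed_frc g)) hpq
  choose C hC0 hC using h1
  refine ⟨∑ g ∈ T, C g, Finset.sum_nonneg fun g _ => hC0 g,
    fun {B} _ {E} hE v hv hvK c hc hvc => ?_⟩
  choose w hw hw1 using hE.restrict_mem v hv
  have hsum : v.2 = (∑ g ∈ T, w g).2 := by
    refine hE.snd_eq_of_fst_eq hv (sum_mem fun g _ => hw g) ?_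
    rw [Prod.fst_sum, Finset.sum_congr rfl fun g _ => hw1 g, hT _ hvK]
  rw [hsum, Prod.snd_sum, Finset.sum_mul]
  refine (norm_sum_le _ _).trans (Finset.sum_le_sum fun g _ => ?_)
  refine hC g hE (w g) (hw g) (fun a ha => ?_) c hc fun a => ?_
  · rw [hw1] at ha
    by_cases hag : a.frc = g
    · rw [restrictFrc_of_eq _ hag] at ha
      exact ⟨hvK a ha, hag⟩
    · exact absurd (restrictFrc_of_ne _ hag) ha
  · rw [hw1]
    by_cases hag : a.frc = g
    · rw [restrictFrc_of_eq _ hag]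
      exact hvc a
    · rw [restrictFrc_of_ne _ hag, norm_zero]
      exact hc.le

end IsControlled

end CorrespondenceAction

end NormEstimate

/-! ### The full groupoid C⋆-algebra -/

noncomputable section FullCStar

namespace CorrespondenceAction

open FracGroup

open EtaleGroupoid (ConvAlg)

variable {P : Type*} [Monoid P] [RightOre P] {X : Type*} [TopologicalSpace X] [T2Space X]
  [LocallyCompactSpace X] {𝓐 : CorrespondenceAction P X}

theorem exists_eq_unitConv (f : 𝓐.groupoid.ConvAlg)
    (hf : ∀ a : 𝓐.Arrow, f a ≠ 0 → a = Arrow.one a.rng) :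
    ∃ φ : C_c(𝓐.History, ℂ), f = unitConv φ ∧ ∀ x, φ x = f (Arrow.one x : 𝓐.Arrow) := by
  refine ⟨.ofFun (fun x => f (Arrow.one x : 𝓐.Arrow)) (f.continuous.comp Arrow.continuous_one)
    (HasCompactSupport.intro (f.hasCompactSupport.isCompact.image Arrow.continuous_rng)
      fun x hx => ?_), ConvAlg.ext fun (a : 𝓐.Arrow) => ?_, fun x => rfl⟩
  · by_contra h
    exact hx ⟨Arrow.one x, subset_tsupport _ h, rfl⟩
  · by_cases ha : a.frc = 1 ∧ a.src = a.rng
    · refine Eq.trans ?_ (unitFun_of _ ha).symm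
      exact congrArg f (Arrow.ext_iff_units.2 ha)
    · refine Eq.trans ?_ (unitFun_of_not _ ha).symm
      by_contra h0
      exact ha (Arrow.ext_iff_units.1 (hf a h0))

variable {B : Type*} [NonUnitalCStarAlgebra B]

theorem norm_map_le_of_units (j : 𝓐.groupoid.ConvAlg →⋆ₙₐ[ℂ] B) (f : 𝓐.groupoid.ConvAlg)
    (hf : ∀ a : 𝓐.Arrow, f a ≠ 0 → a = Arrow.one a.rng) {c : ℝ} (hc : 0 ≤ c)
    (hfc : ∀ a : 𝓐.Arrow, ‖f a‖ ≤ c) : ‖j f‖ ≤ c := by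
  obtain ⟨φ, rfl, hφ⟩ := exists_eq_unitConv f hf
  exact norm_map_cc_le (j.comp unitHom) φ hc fun x => by
    rw [hφ]
    exact hfc _

/-- The graph of a star-homomorphism on the convolution algebra. -/
def graph (j : 𝓐.groupoid.ConvAlg →⋆ₙₐ[ℂ] B) : Submodule ℂ (𝓐.groupoid.ConvAlg × B) where
  carrier := {v | v.2 = j v.1}
  zero_mem' := (map_zero j).symm
  add_mem' {v w} hv hw := by
    change v.2 + w.2 = j (v.1 + w.1)
    rw [map_add, ← show v.2 = j v.1 from hv, ← show w.2 = j w.1 from hw]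
  smul_mem' c v hv := by
    change c • v.2 = j (c • v.1)
    rw [map_smul, ← show v.2 = j v.1 from hv]

theorem isControlled_graph (j : 𝓐.groupoid.ConvAlg →⋆ₙₐ[ℂ] B) : IsControlled (graph j) where
  star_mem v hv := by
    change star v.2 = j (star v.1)
    rw [map_star, ← show v.2 = j v.1 from hv]
  mul_mem v hv w hw := by
    change v.2 * w.2 = j (v.1 * w.1)
    rw [map_mul, ← show v.2 = j v.1 from hv, ← show w.2 = j w.1 from hw]
  restrict_mem v _ g := ⟨(restrictFrc g v.1, j (restrictFrc g v.1)), rfl, rfl⟩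
  unit_mem p ξ := ⟨(unitConv (ccProj p ξ), j (unitConv (ccProj p ξ))), rfl, fun _ => rfl⟩
  norm_snd_le v hv hu c hc hvc := by
    rw [show v.2 = j v.1 from hv]
    exact norm_map_le_of_units j v.1 hu hc.le hvc

/-- All C⋆-seminorms on the convolution algebra are bounded at `f`, so that their supremum is a
norm estimate for every representation and not the default value of `CStarSeminorm.sup`. -/
theorem exists_seminorm_le (f : 𝓐.groupoid.ConvAlg) :
    ∃ C, ∀ N ∈ (univ : Set (CStarSeminorm 𝓐.groupoid.ConvAlg)), N f ≤ C := by
  obtain ⟨C, -, h⟩ := IsControlled.exists_norm_snd_le (𝓐 := 𝓐) f.hasCompactSupport.isCompact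
  obtain ⟨c, hc⟩ := f.hasCompactSupport.exists_bound_of_continuous f.continuous
  refine ⟨C * (max c 1), fun N _ => ?_⟩
  rw [← N.norm_toCompletion]
  exact h (isControlled_graph N.toCompletion) (f, N.toCompletion f) rfl
    (fun a ha => subset_tsupport _ ha) _ (lt_max_of_lt_right one_pos)
    fun a => (hc a).trans (le_max_left _ _)

theorem norm_le_seminorm (j : 𝓐.groupoid.ConvAlg →⋆ₙₐ[ℂ] B) (f : 𝓐.groupoid.ConvAlg) :
    ‖j f‖ ≤ CStarSeminorm.sup univ f :=
  CStarSeminorm.le_sup exists_seminorm_le (mem_univ (CStarSeminorm.pullback j)) f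

end CorrespondenceAction

end FullCStar

/-! ### Density of the image of the product system -/

noncomputable section Density

theorem exists_cc_separating {M : Type*} [TopologicalSpace M] [T2Space M] [LocallyCompactSpace M]
    {m m' : M} (h : m ≠ m') : ∃ ξ : C_c(M, ℂ), ξ m ≠ ξ m' := by
  obtain ⟨g, hg1, hg0, hgc, -⟩ := exists_continuous_one_zero_of_isCompact
    (isCompact_singleton (x := m)) (isClosed_singleton (x := m')) (disjoint_singleton.2 h)
  refine ⟨.ofFun (fun x => (g x : ℂ)) (Complex.continuous_ofReal.comp g.continuous)
    (hgc.comp_left (g := fun x : ℝ => (x : ℂ)) (by simp)), ?_⟩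
  change (g m : ℂ) ≠ (g m' : ℂ)
  rw [hg1 rfl, hg0 rfl]
  simp

namespace CorrespondenceAction

open FracGroup

open EtaleGroupoid (ConvAlg)

variable {P : Type*} [Monoid P] [RightOre P] {X : Type*} [TopologicalSpace X] [T2Space X]
  [LocallyCompactSpace X] {𝓐 : CorrespondenceAction P X}
  {B : Type*} [NonUnitalCStarAlgebra B]

/-- The functions on arrows whose pointwise product with the first component of any element
of `E` is again the first component of an element of `E`, and likewise for their conjugates. -/
def IsMultiplier (E : Submodule ℂ (𝓐.groupoid.ConvAlg × B)) (h : 𝓐.Arrow → ℂ) : Prop :=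
  (∀ v ∈ E, ∃ w ∈ E, ∀ a : 𝓐.Arrow, w.1 a = h a * v.1 a) ∧
    ∀ v ∈ E, ∃ w ∈ E, ∀ a : 𝓐.Arrow, w.1 a = conj (h a) * v.1 a

variable {E : Submodule ℂ (𝓐.groupoid.ConvAlg × B)}

theorem IsControlled.isMultiplier_rng (hE : IsControlled E) (p : P) (ξ : C_c(𝓐.M p, ℂ)) :
    IsMultiplier E fun a => ξ (a.rng.proj p) := by
  have key : ∀ ξ : C_c(𝓐.M p, ℂ), ∀ v ∈ E, ∃ w ∈ E, ∀ a : 𝓐.Arrow,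
      w.1 a = ξ (a.rng.proj p) * v.1 a := by
    intro ξ v hv
    obtain ⟨u, hu, hu1⟩ := hE.exists_unitConv p ξ
    refine ⟨u * v, hE.mul_mem _ hu _ hv, fun a => ?_⟩
    change (u.1 * v.1) a = _
    rw [hu1]
    exact unitConv_mul_apply _ _ a
  exact ⟨key ξ, key (star ξ)⟩

theorem IsControlled.isMultiplier_src (hE : IsControlled E) (p : P) (ξ : C_c(𝓐.M p, ℂ)) :
    IsMultiplier E fun a => ξ (a.src.proj p) := by
  have key : ∀ ξ : C_c(𝓐.M p, ℂ), ∀ v ∈ E, ∃ w ∈ E, ∀ a : 𝓐.Arrow,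
      w.1 a = ξ (a.src.proj p) * v.1 a := by
    intro ξ v hv
    obtain ⟨u, hu, hu1⟩ := hE.exists_unitConv p ξ
    refine ⟨v * u, hE.mul_mem _ hv _ hu, fun a => ?_⟩
    change (v.1 * u.1) a = _
    rw [hu1]
    exact (mul_unitConv_apply _ _ a).trans (mul_comm _ _)
  exact ⟨key ξ, key (star ξ)⟩

variable (E) in
/-- The restrictions of multipliers to a set of arrows. -/
def multiplierAlgebra (K : Set 𝓐.Arrow) : StarSubalgebra ℂ C(K, ℂ) where
  carrier := {k | ∃ h, IsMultiplier E h ∧ ∀ a : K, k a = h a}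
  mul_mem' := by
    rintro k k' ⟨h, hh, hk⟩ ⟨h', hh', hk'⟩
    refine ⟨fun a => h a * h' a, ⟨fun v hv => ?_, fun v hv => ?_⟩, fun a => ?_⟩
    · obtain ⟨w, hw, hw1⟩ := hh'.1 v hv
      obtain ⟨w', hw', hw1'⟩ := hh.1 w hw
      exact ⟨w', hw', fun a => by rw [hw1', hw1, mul_assoc]⟩
    · obtain ⟨w, hw, hw1⟩ := hh'.2 v hv
      obtain ⟨w', hw', hw1'⟩ := hh.2 w hw
      exact ⟨w', hw', fun a => by rw [hw1', hw1, map_mul, mul_assoc]⟩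
    · rw [ContinuousMap.mul_apply, hk, hk']
  add_mem' := by
    rintro k k' ⟨h, hh, hk⟩ ⟨h', hh', hk'⟩
    refine ⟨fun a => h a + h' a, ⟨fun v hv => ?_, fun v hv => ?_⟩, fun a => ?_⟩
    · obtain ⟨w, hw, hw1⟩ := hh.1 v hv
      obtain ⟨w', hw', hw1'⟩ := hh'.1 v hv
      refine ⟨w + w', add_mem hw hw', fun a => ?_⟩
      change w.1 a + w'.1 a = _
      rw [hw1', hw1, add_mul]
    · obtain ⟨w, hw, hw1⟩ := hh.2 v hv
      obtain ⟨w', hw', hw1'⟩ := hh'.2 v hv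
      refine ⟨w + w', add_mem hw hw', fun a => ?_⟩
      change w.1 a + w'.1 a = _
      rw [hw1', hw1, map_add, add_mul]
    · rw [ContinuousMap.add_apply, hk, hk']
  algebraMap_mem' c := ⟨fun _ => c, ⟨fun v hv => ⟨c • v, E.smul_mem c hv, fun _ => rfl⟩,
    fun v hv => ⟨conj c • v, E.smul_mem _ hv, fun _ => rfl⟩⟩, fun _ => rfl⟩
  star_mem' := by
    rintro k ⟨h, hh, hk⟩
    refine ⟨fun a => conj (h a), ⟨hh.2, fun v hv => ?_⟩, fun a => ?_⟩
    · obtain ⟨w, hw, hw1⟩ := hh.1 v hv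
      exact ⟨w, hw, fun a => by rw [hw1, Complex.conj_conj]⟩
    · exact congrArg conj (hk a)

/-- By the Stone–Weierstrass theorem: over one element of the group of fractions, range and source
separate arrows, and functions on the spaces `M p` separate complete histories. -/
theorem IsControlled.exists_multiplier (hE : IsControlled E) {K : Set 𝓐.Arrow} (hK : IsCompact K)
    {g : FracGroup P} (hKg : ∀ a ∈ K, a.frc = g) (f : C(K, ℂ)) {ε : ℝ} (hε : 0 < ε) :
    ∃ h, IsMultiplier E h ∧ ∀ a : K, ‖f a - h a‖ ≤ ε := by
  have : CompactSpace K := isCompact_iff_compactSpace.1 hK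
  have h1 := ContinuousMap.starSubalgebra_topologicalClosure_eq_top_of_separatesPoints
    (multiplierAlgebra E K) (by
      rintro ⟨a, ha⟩ ⟨b, hb⟩ hne
      by_cases hr : a.rng = b.rng
      · have hs : a.src ≠ b.src := fun hs => hne (Subtype.ext
          (Arrow.ext hr ((hKg a ha).trans (hKg b hb).symm) hs))
        obtain ⟨p, hp⟩ : ∃ p, a.src.proj p ≠ b.src.proj p := by
          by_contra! h
          exact hs (History.ext h)
        obtain ⟨ξ, hξ⟩ := exists_cc_separating hp
        exact ⟨_, ⟨⟨fun a : K => ξ (a.1.src.proj p), ξ.continuous.comp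
          ((History.continuous_proj p).comp
            (Arrow.continuous_src.comp continuous_subtype_val))⟩,
          ⟨_, hE.isMultiplier_src p ξ, fun _ => rfl⟩, rfl⟩, hξ⟩
      · obtain ⟨p, hp⟩ : ∃ p, a.rng.proj p ≠ b.rng.proj p := by
          by_contra! h
          exact hr (History.ext h)
        obtain ⟨ξ, hξ⟩ := exists_cc_separating hp
        exact ⟨_, ⟨⟨fun a : K => ξ (a.1.rng.proj p), ξ.continuous.comp
          ((History.continuous_proj p).comp
            (Arrow.continuous_rng.comp continuous_subtype_val))⟩,
          ⟨_, hE.isMultiplier_rng p ξ, fun _ => rfl⟩, rfl⟩, hξ⟩)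
  have h2 : f ∈ (multiplierAlgebra E K).topologicalClosure := by
    rw [h1]
    trivial
  obtain ⟨k, ⟨h, hh, hk⟩, hfk⟩ := Metric.mem_closure_iff.1 h2 ε hε
  refine ⟨h, hh, fun a => ?_⟩
  rw [← hk, ← dist_eq_norm]
  exact (ContinuousMap.dist_apply_le_dist a).trans hfk.le

theorem mem_of_add_apply_ne_zero {f f' : 𝓐.groupoid.ConvAlg} {a : 𝓐.Arrow} {K K' : Set 𝓐.Arrow}
    (h : f a ≠ 0 → a ∈ K) (h' : f' a ≠ 0 → a ∈ K') (hne : (f + f') a ≠ 0) : a ∈ K ∪ K' := by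
  by_contra hn
  rw [mem_union, not_or] at hn
  refine hne ?_
  change f a + f' a = 0
  rw [not_not.1 fun h0 => hn.1 (h h0), not_not.1 fun h0 => hn.2 (h' h0), add_zero]

theorem mem_of_sub_apply_ne_zero {f f' : 𝓐.groupoid.ConvAlg} {a : 𝓐.Arrow} {K : Set 𝓐.Arrow}
    (h : f a ≠ 0 → a ∈ K) (h' : f' a ≠ 0 → a ∈ K) (hne : (f - f') a ≠ 0) : a ∈ K := by
  by_contra hn
  refine hne ?_
  change f a - f' a = 0
  rw [not_not.1 fun h0 => hn (h h0), not_not.1 fun h0 => hn (h' h0), sub_zero]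

/-- The function `f` can be approximated uniformly, with a fixed compact support, by first
components of elements of `E`. -/
def IsApproximable (E : Submodule ℂ (𝓐.groupoid.ConvAlg × B)) (f : 𝓐.groupoid.ConvAlg) : Prop :=
  ∃ K : Set 𝓐.Arrow, IsCompact K ∧ (∀ a : 𝓐.Arrow, f a ≠ 0 → a ∈ K) ∧ ∀ ε : ℝ, 0 < ε →
    ∃ v ∈ E, (∀ a : 𝓐.Arrow, v.1 a ≠ 0 → a ∈ K) ∧ ∀ a : 𝓐.Arrow, ‖f a - v.1 a‖ ≤ ε

theorem IsApproximable.zero : IsApproximable E 0 :=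
  ⟨∅, isCompact_empty, fun a h => absurd rfl h, fun ε hε => ⟨0, zero_mem _, fun a h =>
    absurd rfl h, fun a => by
      change ‖(0 : ℂ) - 0‖ ≤ ε
      rw [sub_zero, norm_zero]
      exact hε.le⟩⟩

theorem IsApproximable.add {f f' : 𝓐.groupoid.ConvAlg} (hf : IsApproximable E f)
    (hf' : IsApproximable E f') : IsApproximable E (f + f') := by
  obtain ⟨K, hK, h1, h2⟩ := hf
  obtain ⟨K', hK', h1', h2'⟩ := hf'
  refine ⟨K ∪ K', hK.union hK', fun a => mem_of_add_apply_ne_zero (h1 a) (h1' a), fun ε hε => ?_⟩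
  obtain ⟨v, hv, h3, h4⟩ := h2 (ε / 2) (half_pos hε)
  obtain ⟨v', hv', h3', h4'⟩ := h2' (ε / 2) (half_pos hε)
  refine ⟨v + v', add_mem hv hv', fun a => mem_of_add_apply_ne_zero (h3 a) (h3' a), fun a => ?_⟩
  change ‖f a + f' a - (v.1 a + v'.1 a)‖ ≤ ε
  rw [add_sub_add_comm]
  exact (norm_add_le _ _).trans ((add_le_add (h4 a) (h4' a)).trans (add_halves ε).le)

/-- There is `v` in the relation whose first component is `1` on the support of `f`; multiply it by
multipliers that approximate `f`. -/
theorem isApproximable_of_frc (R : 𝓐.PreRep B) {f : 𝓐.groupoid.ConvAlg} {g : FracGroup P}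
    (hf : ∀ a : 𝓐.Arrow, f a ≠ 0 → a.frc = g) : IsApproximable R.graphRep.algebra f := by
  have hL : IsCompact (tsupport f : Set 𝓐.Arrow) := f.hasCompactSupport.isCompact
  have hLg : ∀ a ∈ (tsupport f : Set 𝓐.Arrow), a.frc = g := fun a ha =>
    closure_minimal (s := Function.support f) (t := {a : 𝓐.Arrow | a.frc = g}) hf
      (Arrow.isClosed_frc g) ha
  obtain ⟨p, q, hpq, hLpq⟩ := Arrow.exists_subset_range_ofPiece hL hLg
  obtain ⟨χ, hχ, -⟩ := exists_cc_eq_one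
    (hL.image ((History.continuous_proj p).comp Arrow.continuous_rng))
  obtain ⟨κ, hκ, -⟩ := exists_cc_eq_one
    (hL.image ((History.continuous_proj q).comp Arrow.continuous_src))
  obtain ⟨v, hv, hv1⟩ : ∃ v ∈ R.graphRep.spanMulStar p q,
      v.1 = arrowConv χ * star (arrowConv κ) := ⟨_, R.graphRep.mul_star_mem χ κ, rfl⟩
  have hK : IsCompact (tsupport v.1 : Set 𝓐.Arrow) := v.1.hasCompactSupport.isCompact
  have hvg : ∀ a : 𝓐.Arrow, v.1 a ≠ 0 → a.frc = g := fun a ha => by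
    by_contra h
    exact ha (PreRep.fst_apply_eq_zero hv fun h' => h (h'.1.trans hpq))
  have hKg : ∀ a ∈ (tsupport v.1 : Set 𝓐.Arrow), a.frc = g := fun a ha =>
    closure_minimal (s := Function.support v.1) (t := {a : 𝓐.Arrow | a.frc = g}) hvg
      (Arrow.isClosed_frc g) ha
  have hv2 : ∀ a : 𝓐.Arrow, f a ≠ 0 → v.1 a = 1 := by
    intro a ha
    have ha' : a ∈ (tsupport f : Set 𝓐.Arrow) := subset_tsupport _ ha
    obtain ⟨h1, h2⟩ := Arrow.mem_range_ofPiece.1 (hLpq ha')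
    rw [hv1]
    refine (arrowConv_mul_star_apply_of χ κ h1 h2).trans ?_
    rw [hχ (a.rng.proj p) ⟨a, ha', rfl⟩, hκ (a.src.proj q) ⟨a, ha', rfl⟩, map_one, mul_one]
  have hvf : ∀ a : 𝓐.Arrow, f a * v.1 a = f a := fun a => by
    by_cases ha : f a = 0
    · rw [ha, zero_mul]
    · rw [hv2 a ha, mul_one]
  have hvK : ∀ a : 𝓐.Arrow, v.1 a ≠ 0 → a ∈ (tsupport v.1 : Set 𝓐.Arrow) :=
    fun a ha => subset_tsupport _ ha
  obtain ⟨c, hc⟩ := v.1.hasCompactSupport.exists_bound_of_continuous v.1.continuous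
  refine ⟨tsupport v.1, hK, fun a ha => hvK a (by rw [hv2 a ha]; exact one_ne_zero),
    fun ε hε => ?_⟩
  have hc0 : 0 < max c 1 := lt_max_of_lt_right one_pos
  obtain ⟨h, hh, hfh⟩ := R.isControlled.exists_multiplier hK hKg
    ⟨fun a => f a.1, f.continuous.comp continuous_subtype_val⟩ (div_pos hε hc0)
  obtain ⟨w, hw, hw1⟩ := hh.1 v (CcRep.spanMulStar_le_algebra _ _ hv)
  refine ⟨w, hw, fun a ha => hvK a fun h0 => ha (by rw [hw1, h0, mul_zero]), fun a => ?_⟩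
  rw [hw1, ← hvf a, ← sub_mul, norm_mul]
  by_cases ha : v.1 a = 0
  · rw [ha, norm_zero, mul_zero]
    exact hε.le
  · have h1 : ‖f a - h a‖ ≤ ε / max c 1 := hfh ⟨a, hvK a ha⟩
    refine (mul_le_mul h1 ((hc a).trans (le_max_left c 1)) (norm_nonneg _)
      (div_pos hε hc0).le).trans ?_
    rw [div_mul_cancel₀ _ hc0.ne']

/-- The first components of the relation generated by a representation are dense in the
convolution algebra, for uniform convergence with supports in a fixed compact set. -/
theorem isApproximable (R : 𝓐.PreRep B) (f : 𝓐.groupoid.ConvAlg) :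
    IsApproximable R.graphRep.algebra f := by
  obtain ⟨T, hT⟩ := exists_sum_restrictFrc (𝓐 := 𝓐) f.hasCompactSupport.isCompact
  rw [← hT f fun a ha => subset_tsupport _ ha]
  refine Finset.sum_induction _ (IsApproximable R.graphRep.algebra) (fun _ _ => .add) .zero
    fun g _ => isApproximable_of_frc R (g := g) fun a ha => ?_
  by_contra h
  exact ha (restrictFrc_of_ne _ h)

end CorrespondenceAction

end Density

/-! ### Extension of a representation to the convolution algebra -/

noncomputable section Extension

namespace EtaleGroupoid.ConvAlg

universe u v

variable {G : EtaleGroupoid.{u, v}}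

theorem exists_of_mul_apply_ne_zero {h h' : G.ConvAlg} {a : G.Arr} (ha : (h * h') a ≠ 0) :
    ∃ p : G.Comp, G.comp p = a ∧ h p.1.1 ≠ 0 ∧ h' p.1.2 ≠ 0 := by
  rw [mul_apply] at ha
  by_contra! hn
  refine ha (Eq.trans (tsum_congr fun p => ?_) tsum_zero)
  by_cases h0 : h p.1.1.1 = 0
  · rw [h0, zero_mul]
  · rw [hn p.1 p.2 h0, mul_zero]

/-- Convolution is separately continuous for uniform convergence with controlled supports: the
number of factorisations into arrows from given compact sets is bounded. -/
theorem exists_norm_mul_apply_le {K K' : Set G.Arr} (hK : IsCompact K) (hK' : IsCompact K') :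
    ∃ D : ℝ, 0 ≤ D ∧ ∀ (h h' : G.ConvAlg) (c c' : ℝ), (∀ a, h a ≠ 0 → a ∈ K) →
      (∀ a, h' a ≠ 0 → a ∈ K') → (∀ a, ‖h a‖ ≤ c) → (∀ a, ‖h' a‖ ≤ c') →
      ∀ a, ‖(h * h') a‖ ≤ D * (c * c') := by
  obtain ⟨χ, hχ, -⟩ := exists_cc_eq_one hK
  obtain ⟨χ', hχ', -⟩ := exists_cc_eq_one hK'
  let k : G.ConvAlg := ⟨χ * star χ⟩
  let k' : G.ConvAlg := ⟨χ' * star χ'⟩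
  have hk : ∀ x, k x = ((‖χ x‖ ^ 2 : ℝ) : ℂ) := fun x => by
    rw [Complex.ofReal_pow]
    exact Complex.mul_conj' (χ x)
  have hk' : ∀ x, k' x = ((‖χ' x‖ ^ 2 : ℝ) : ℂ) := fun x => by
    rw [Complex.ofReal_pow]
    exact Complex.mul_conj' (χ' x)
  obtain ⟨D, hD⟩ := (k * k').hasCompactSupport.exists_bound_of_continuous (k * k').continuous
  refine ⟨max D 0, le_max_right _ _, fun h h' c c' h1 h2 hc hc' a => ?_⟩
  have hc0 : 0 ≤ c := (norm_nonneg _).trans (hc a)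
  have hc0' : 0 ≤ c' := (norm_nonneg _).trans (hc' a)
  have hs : Summable fun p : G.comp ⁻¹' {a} => ‖χ p.1.1.1‖ ^ 2 * ‖χ' p.1.1.2‖ ^ 2 := by
    refine (summable_tensor k k' a).norm.congr fun p => ?_
    rw [hk, hk', ← Complex.ofReal_mul, Complex.norm_real, Real.norm_of_nonneg (by positivity)]
  have h3 : ∑' p : G.comp ⁻¹' {a}, ‖χ p.1.1.1‖ ^ 2 * ‖χ' p.1.1.2‖ ^ 2 ≤ max D 0 := by
    have h4 : ((∑' p : G.comp ⁻¹' {a}, ‖χ p.1.1.1‖ ^ 2 * ‖χ' p.1.1.2‖ ^ 2 : ℝ) : ℂ) =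
        (k * k') a := by
      rw [Complex.ofReal_tsum, mul_apply]
      exact tsum_congr fun p => by rw [hk, hk', Complex.ofReal_mul]
    have h5 := hD a
    rw [← h4, Complex.norm_real, Real.norm_eq_abs] at h5
    exact (le_abs_self _).trans (h5.trans (le_max_left _ _))
  have h6 : ∀ p : G.comp ⁻¹' {a}, ‖h p.1.1.1 * h' p.1.1.2‖ ≤
      ‖χ p.1.1.1‖ ^ 2 * ‖χ' p.1.1.2‖ ^ 2 * (c * c') := by
    intro p
    by_cases h0 : h p.1.1.1 * h' p.1.1.2 = 0
    · rw [h0, norm_zero]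
      positivity
    · rw [hχ _ (h1 _ (left_ne_zero_of_mul h0)), hχ' _ (h2 _ (right_ne_zero_of_mul h0)),
        norm_one, one_pow, _root_.one_mul, _root_.one_mul, norm_mul]
      exact mul_le_mul (hc _) (hc' _) (norm_nonneg _) hc0
  rw [mul_apply]
  refine (tsum_of_norm_bounded (hs.mul_right (c * c')).hasSum h6).trans ?_
  rw [tsum_mul_right]
  exact mul_le_mul_of_nonneg_right h3 (mul_nonneg hc0 hc0')

end EtaleGroupoid.ConvAlg

namespace CorrespondenceAction

open FracGroup

open EtaleGroupoid (ConvAlg)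

variable {P : Type*} [Monoid P] [RightOre P] {X : Type*} [TopologicalSpace X] [T2Space X]
  [LocallyCompactSpace X] {𝓐 : CorrespondenceAction P X}
  {B : Type*} [NonUnitalCStarAlgebra B]

/-- The pair `(f, b)` is a limit of elements of `E`, where the first components have supports in a
fixed compact set and converge uniformly. -/
def IsLimit (E : Submodule ℂ (𝓐.groupoid.ConvAlg × B)) (f : 𝓐.groupoid.ConvAlg) (b : B) : Prop :=
  ∃ K : Set 𝓐.Arrow, IsCompact K ∧ (∀ a : 𝓐.Arrow, f a ≠ 0 → a ∈ K) ∧ ∀ ε : ℝ, 0 < ε →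
    ∃ v ∈ E, (∀ a : 𝓐.Arrow, v.1 a ≠ 0 → a ∈ K) ∧ (∀ a : 𝓐.Arrow, ‖f a - v.1 a‖ ≤ ε) ∧
      ‖b - v.2‖ ≤ ε

namespace IsLimit

variable {E : Submodule ℂ (𝓐.groupoid.ConvAlg × B)} {f f' : 𝓐.groupoid.ConvAlg} {b b' : B}

theorem of_mem {v : 𝓐.groupoid.ConvAlg × B} (hv : v ∈ E) : IsLimit E v.1 v.2 :=
  ⟨tsupport v.1, v.1.hasCompactSupport.isCompact, fun a ha => subset_tsupport _ ha, fun ε hε =>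
    ⟨v, hv, fun a ha => subset_tsupport _ ha, fun a => by
      rw [sub_self, norm_zero]
      exact hε.le, by
      rw [sub_self, norm_zero]
      exact hε.le⟩⟩

theorem add (h : IsLimit E f b) (h' : IsLimit E f' b') : IsLimit E (f + f') (b + b') := by
  obtain ⟨K, hK, h1, h2⟩ := h
  obtain ⟨K', hK', h1', h2'⟩ := h'
  refine ⟨K ∪ K', hK.union hK', fun a => mem_of_add_apply_ne_zero (h1 a) (h1' a), fun ε hε => ?_⟩
  obtain ⟨v, hv, h3, h4, h5⟩ := h2 (ε / 2) (half_pos hε)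
  obtain ⟨v', hv', h3', h4', h5'⟩ := h2' (ε / 2) (half_pos hε)
  refine ⟨v + v', add_mem hv hv', fun a => mem_of_add_apply_ne_zero (h3 a) (h3' a), fun a => ?_, ?_⟩
  · change ‖f a + f' a - (v.1 a + v'.1 a)‖ ≤ ε
    rw [add_sub_add_comm]
    exact (norm_add_le _ _).trans ((add_le_add (h4 a) (h4' a)).trans (add_halves ε).le)
  · change ‖b + b' - (v.2 + v'.2)‖ ≤ ε
    rw [add_sub_add_comm]
    exact (norm_add_le _ _).trans ((add_le_add h5 h5').trans (add_halves ε).le)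

theorem smul (c : ℂ) (h : IsLimit E f b) : IsLimit E (c • f) (c • b) := by
  obtain ⟨K, hK, h1, h2⟩ := h
  refine ⟨K, hK, fun a ha => h1 a (right_ne_zero_of_mul ha), fun ε hε => ?_⟩
  have hc : 0 < ‖c‖ + 1 := by positivity
  obtain ⟨v, hv, h3, h4, h5⟩ := h2 (ε / (‖c‖ + 1)) (div_pos hε hc)
  refine ⟨c • v, E.smul_mem c hv, fun a ha => h3 a (right_ne_zero_of_mul ha), fun a => ?_, ?_⟩
  · change ‖c * f a - c * v.1 a‖ ≤ ε
    rw [← mul_sub, norm_mul]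
    refine (mul_le_mul (le_add_of_nonneg_right zero_le_one) (h4 a) (norm_nonneg _) hc.le).trans ?_
    rw [mul_div_cancel₀ _ hc.ne']
  · change ‖c • b - c • v.2‖ ≤ ε
    rw [← smul_sub, norm_smul]
    refine (mul_le_mul (le_add_of_nonneg_right zero_le_one) h5 (norm_nonneg _) hc.le).trans ?_
    rw [mul_div_cancel₀ _ hc.ne']

theorem star (hE : IsControlled E) (h : IsLimit E f b) :
    IsLimit E (Star.star f) (Star.star b) := by
  obtain ⟨K, hK, h1, h2⟩ := h
  have aux : ∀ (f : 𝓐.groupoid.ConvAlg), (∀ a : 𝓐.Arrow, f a ≠ 0 → a ∈ K) → ∀ a : 𝓐.Arrow,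
      Star.star f a ≠ 0 → a ∈ Arrow.inv '' K := by
    intro f hf a ha
    refine ⟨Arrow.inv a, hf _ fun h0 => ha ?_, EtaleGroupoid.inv_inv (G := 𝓐.groupoid) a⟩
    change conj (f (Arrow.inv a)) = 0
    rw [h0, map_zero]
  refine ⟨Arrow.inv '' K, hK.image Arrow.continuous_inv, aux f h1, fun ε hε => ?_⟩
  obtain ⟨v, hv, h3, h4, h5⟩ := h2 ε hε
  refine ⟨Star.star v, hE.star_mem v hv, aux v.1 h3, fun a => ?_, ?_⟩
  · change ‖conj (f (Arrow.inv a)) - conj (v.1 (Arrow.inv a))‖ ≤ ε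
    rw [← map_sub, RCLike.norm_conj]
    exact h4 _
  · change ‖Star.star b - Star.star v.2‖ ≤ ε
    rw [← star_sub, norm_star]
    exact h5

theorem mul (hE : IsControlled E) (h : IsLimit E f b) (h' : IsLimit E f' b') :
    IsLimit E (f * f') (b * b') := by
  obtain ⟨K, hK, h1, h2⟩ := h
  obtain ⟨K', hK', h1', h2'⟩ := h'
  obtain ⟨D, hD0, hD⟩ :=
    EtaleGroupoid.ConvAlg.exists_norm_mul_apply_le (G := 𝓐.groupoid) hK hK'
  obtain ⟨c, hc⟩ := f.hasCompactSupport.exists_bound_of_continuous f.continuous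
  obtain ⟨c', hc'⟩ := f'.hasCompactSupport.exists_bound_of_continuous f'.continuous
  let L : Set 𝓐.Arrow := 𝓐.groupoid.comp '' (Subtype.val ⁻¹' (K ×ˢ K'))
  have hL : IsCompact L :=
    ((EtaleGroupoid.isClosed_comp (G := 𝓐.groupoid)).isClosedEmbedding_subtypeVal.isCompact_preimage
      (hK.prod hK')).image EtaleGroupoid.continuous_comp
  have aux : ∀ (f f' : 𝓐.groupoid.ConvAlg), (∀ a : 𝓐.Arrow, f a ≠ 0 → a ∈ K) →
      (∀ a : 𝓐.Arrow, f' a ≠ 0 → a ∈ K') → ∀ a : 𝓐.Arrow, (f * f') a ≠ 0 → a ∈ L := by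
    intro f f' hf hf' a ha
    obtain ⟨p, hp, hp1, hp2⟩ :=
      EtaleGroupoid.ConvAlg.exists_of_mul_apply_ne_zero (G := 𝓐.groupoid) ha
    exact ⟨p, ⟨hf _ hp1, hf' _ hp2⟩, hp⟩
  refine ⟨L, hL, aux f f' h1 h1', fun ε hε => ?_⟩
  have hM : 0 < D * (|c'| + (|c| + 1)) + (‖b'‖ + (‖b‖ + 1)) := by positivity
  obtain ⟨δ, hδ, hδ1, hδε⟩ : ∃ δ : ℝ, 0 < δ ∧ δ ≤ 1 ∧
      δ * (D * (|c'| + (|c| + 1)) + (‖b'‖ + (‖b‖ + 1))) ≤ ε :=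
    ⟨min 1 (ε / _), lt_min one_pos (div_pos hε hM), min_le_left _ _, by
      rw [← le_div_iff₀ hM]
      exact min_le_right _ _⟩
  obtain ⟨v, hv, h3, h4, h5⟩ := h2 δ hδ
  obtain ⟨v', hv', h3', h4', h5'⟩ := h2' δ hδ
  refine ⟨v * v', hE.mul_mem _ hv _ hv', aux _ _ h3 h3', fun a => ?_, ?_⟩
  · have e1 : f * f' - v.1 * v'.1 = (f - v.1) * f' + v.1 * (f' - v'.1) := by
      rw [sub_mul, mul_sub, sub_add_sub_cancel]
    have e2 := hD (f - v.1) f' δ |c'| (fun a => mem_of_sub_apply_ne_zero (h1 a) (h3 a)) h1' h4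
      (fun a => (hc' a).trans (le_abs_self _)) a
    have e3 := hD v.1 (f' - v'.1) (|c| + 1) δ h3
      (fun a => mem_of_sub_apply_ne_zero (h1' a) (h3' a)) (fun a => by
      have : ‖v.1 a‖ ≤ ‖f a‖ + ‖f a - v.1 a‖ := by
        rw [← norm_neg (f a - v.1 a), neg_sub]
        exact norm_le_insert' _ _
      exact this.trans (add_le_add ((hc a).trans (le_abs_self _)) ((h4 a).trans hδ1))) h4' a
    change ‖(f * f' - v.1 * v'.1) a‖ ≤ ε
    rw [e1]
    change ‖((f - v.1) * f') a + (v.1 * (f' - v'.1)) a‖ ≤ ε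
    refine (norm_add_le _ _).trans ((add_le_add e2 e3).trans (le_trans ?_ hδε))
    have : 0 ≤ δ * (‖b'‖ + (‖b‖ + 1)) := by positivity
    linarith
  · have e1 : b * b' - v.2 * v'.2 = (b - v.2) * b' + v.2 * (b' - v'.2) := by
      rw [sub_mul, mul_sub, sub_add_sub_cancel]
    change ‖b * b' - v.2 * v'.2‖ ≤ ε
    rw [e1]
    have e2 : ‖v.2‖ ≤ ‖b‖ + 1 := by
      refine (norm_le_insert' v.2 b).trans (add_le_add le_rfl ?_)
      rw [norm_sub_rev]
      exact h5.trans hδ1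
    have e3 : ‖(b - v.2) * b'‖ ≤ δ * ‖b'‖ :=
      (norm_mul_le _ _).trans (mul_le_mul_of_nonneg_right h5 (norm_nonneg _))
    have e4 : ‖v.2 * (b' - v'.2)‖ ≤ (‖b‖ + 1) * δ :=
      (norm_mul_le _ _).trans (mul_le_mul e2 h5' (norm_nonneg _) (by positivity))
    refine (norm_add_le _ _).trans ((add_le_add e3 e4).trans (le_trans ?_ hδε))
    have : 0 ≤ δ * (D * (|c'| + (|c| + 1))) := by positivity
    linarith

theorem eq_zero (hE : IsControlled E) (h : IsLimit E 0 b) : b = 0 := by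
  obtain ⟨K, hK, -, h2⟩ := h
  obtain ⟨C, hC0, hC⟩ := IsControlled.exists_norm_snd_le (𝓐 := 𝓐) hK
  rw [← norm_le_zero_iff]
  refine le_of_forall_pos_le_add fun ε hε => ?_
  rw [zero_add]
  have h0 : 0 < 1 + C := by positivity
  obtain ⟨v, hv, h3, h4, h5⟩ := h2 (ε / (1 + C)) (div_pos hε h0)
  have h6 := hC hE v hv h3 _ (div_pos hε h0) fun a => by
    have := h4 a
    change ‖0 - v.1 a‖ ≤ _ at this
    rwa [zero_sub, norm_neg] at this
  refine (norm_le_insert' b v.2).trans ((add_le_add h6 h5).trans (le_of_eq ?_))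
  field_simp
  ring

/-- A controlled relation is closable. -/
theorem unique (hE : IsControlled E) (h : IsLimit E f b) (h' : IsLimit E f b') : b = b' := by
  have h1 := h.add (h'.smul (-1))
  rw [neg_one_smul, neg_one_smul, ← sub_eq_add_neg, ← sub_eq_add_neg, sub_self] at h1
  exact sub_eq_zero.1 (h1.eq_zero hE)

theorem exists_of_isApproximable (hE : IsControlled E) (hf : IsApproximable E f) :
    ∃ b, IsLimit E f b := by
  obtain ⟨K, hK, h1, h2⟩ := hf
  obtain ⟨C, hC0, hC⟩ := IsControlled.exists_norm_snd_le (𝓐 := 𝓐) hK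
  obtain ⟨u, -, hu, hu0⟩ := exists_seq_strictAnti_tendsto (0 : ℝ)
  choose v hv h3 h4 using fun n => h2 (u n) (hu n)
  have h5 : ∀ n m, ‖(v n).2 - (v m).2‖ ≤ C * (u n + u m) := fun n m =>
    hC hE (v n - v m) (sub_mem (hv n) (hv m)) (fun a =>
      mem_of_sub_apply_ne_zero (h3 n a) (h3 m a))
      _ (add_pos (hu n) (hu m)) fun a => by
        change ‖(v n).1 a - (v m).1 a‖ ≤ _
        rw [← sub_sub_sub_cancel_left _ _ (f a), add_comm]
        exact (norm_sub_le _ _).trans (add_le_add (h4 m a) (h4 n a))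
  have h6 : CauchySeq fun n => (v n).2 := by
    rw [Metric.cauchySeq_iff]
    intro ε hε
    have h0 : 0 < C + 1 := by positivity
    obtain ⟨N, hN⟩ := (hu0.eventually_lt_const (div_pos (half_pos hε) h0)).exists_forall_of_atTop
    refine ⟨N, fun m hm n hn => ?_⟩
    rw [dist_eq_norm]
    have h7 := hN m hm
    have h8 := hN n hn
    rw [lt_div_iff₀ h0] at h7 h8
    have := h5 m n
    nlinarith [hu m, hu n]
  obtain ⟨b, hb⟩ := cauchySeq_tendsto_of_complete h6
  refine ⟨b, K, hK, h1, fun ε hε => ?_⟩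
  obtain ⟨n, hn1, hn2⟩ := ((hu0.eventually_le_const hε).and
    (hb.eventually (Metric.closedBall_mem_nhds b hε))).exists
  refine ⟨v n, hv n, h3 n, fun a => (h4 n a).trans hn1, ?_⟩
  rw [← dist_eq_norm, dist_comm]
  exact hn2

end IsLimit

namespace PreRep

variable (R : 𝓐.PreRep B)

theorem exists_isLimit (f : 𝓐.groupoid.ConvAlg) : ∃ b, IsLimit R.graphRep.algebra f b :=
  IsLimit.exists_of_isApproximable R.isControlled (isApproximable R f)

/-- The star-homomorphism on the convolution algebra induced by a representation. -/
def convHom : 𝓐.groupoid.ConvAlg →⋆ₙₐ[ℂ] B :=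
  have h := fun f => (R.exists_isLimit f).choose_spec
  { toFun := fun f => (R.exists_isLimit f).choose
    map_smul' := fun c f => (h (c • f)).unique R.isControlled ((h f).smul c)
    map_zero' := (h 0).eq_zero R.isControlled
    map_add' := fun f g => (h (f + g)).unique R.isControlled ((h f).add (h g))
    map_mul' := fun f g => (h (f * g)).unique R.isControlled ((h f).mul R.isControlled (h g))
    map_star' := fun f => (h (star f)).unique R.isControlled ((h f).star R.isControlled) }

theorem convHom_arrowConv {p : P} (ξ : C_c(𝓐.M p, ℂ)) :
    R.convHom (arrowConv ξ) = R.S p (ofCc ξ) :=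
  IsLimit.unique R.isControlled (R.exists_isLimit _).choose_spec
    (IsLimit.of_mem (CcRep.S_mem (R := R.graphRep) ξ))

end PreRep

end CorrespondenceAction

end Extension

/-! ### Extension of representations to the Hilbert modules -/

noncomputable section HilbertModuleExtension

namespace HilbMod

variable {M X : Type*} [TopologicalSpace M] [T2Space M] [LocallyCompactSpace M]
  [TopologicalSpace X] [T2Space X] {s : M → X} {hs : IsLocalHomeomorph s}

theorem innerC_sub_left (ξ ξ' η : HilbMod hs) :
    innerC (ξ - ξ') η = innerC ξ η - innerC ξ' η := by
  ext x
  change innerC (ξ - ξ') η x = innerC ξ η x - innerC ξ' η x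
  rw [innerC_eq, innerC_eq, innerC_eq, ← inner_sub_left]
  rfl

theorem innerC_sub_right (ξ η η' : HilbMod hs) :
    innerC ξ (η - η') = innerC ξ η - innerC ξ η' := by
  ext x
  change innerC ξ (η - η') x = innerC ξ η x - innerC ξ η' x
  rw [innerC_eq, innerC_eq, innerC_eq, ← inner_sub_right]
  rfl

theorem continuous_innerC_left (η : HilbMod hs) : Continuous fun ξ : HilbMod hs => innerC ξ η := by
  refine (LipschitzWith.of_dist_le_mul (K := ‖η‖₊) fun ξ ξ' => ?_).continuous
  rw [dist_eq_norm, dist_eq_norm, ← innerC_sub_left, mul_comm]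
  exact norm_innerC_le _ _

theorem continuous_innerC_right (ξ : HilbMod hs) : Continuous fun η : HilbMod hs => innerC ξ η := by
  refine (LipschitzWith.of_dist_le_mul (K := ‖ξ‖₊) fun η η' => ?_).continuous
  rw [dist_eq_norm, dist_eq_norm, ← innerC_sub_right]
  exact norm_innerC_le _ _

end HilbMod

namespace CorrespondenceAction

variable {P : Type*} [Monoid P] {X : Type*} [TopologicalSpace X] [T2Space X]
  {𝓐 : CorrespondenceAction P X}

theorem continuous_prodHilb_left {p q w : P} (h : p * q = w) (η : 𝓐.Hilb q) :
    Continuous fun ξ : 𝓐.Hilb p => prodHilb h ξ η :=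
  Continuous.subtype_mk
    (((FibreFamily.prod (t := 𝓐.s w) (𝓐.s_cutL h) (𝓐.s_cutR h)
      (isClosedEmbedding_cut h).injective).continuous.clm_apply continuous_const).comp
        continuous_subtype_val) _

theorem continuous_prodHilb_right {p q w : P} (h : p * q = w) (ξ : 𝓐.Hilb p) :
    Continuous fun η : 𝓐.Hilb q => prodHilb h ξ η :=
  Continuous.subtype_mk
    (((FibreFamily.prod (t := 𝓐.s w) (𝓐.s_cutL h) (𝓐.s_cutR h)
      (isClosedEmbedding_cut h).injective) ξ.1).continuous.comp continuous_subtype_val) _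

theorem unitHilb_add (f g : C₀(X, ℂ)) :
    (unitHilb (f + g) : 𝓐.Hilb 1) = unitHilb f + unitHilb g := HilbMod.ext fun _ => rfl

theorem unitHilb_sub (f g : C₀(X, ℂ)) :
    (unitHilb (f - g) : 𝓐.Hilb 1) = unitHilb f - unitHilb g := HilbMod.ext fun _ => rfl

theorem unitHilb_smul (c : ℂ) (f : C₀(X, ℂ)) :
    (unitHilb (c • f) : 𝓐.Hilb 1) = c • unitHilb f := HilbMod.ext fun _ => rfl

theorem unitHilb_zero : (unitHilb 0 : 𝓐.Hilb 1) = 0 := HilbMod.ext fun _ => rfl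

theorem prodHilb_unitHilb_unitHilb (f g : C₀(X, ℂ)) :
    prodHilb (mul_one 1) (unitHilb f) (unitHilb g) = (unitHilb (f * g) : 𝓐.Hilb 1) :=
  HilbMod.ext fun m => by
    rw [prodHilb_unitHilb_right, HilbMod.act_apply, unitHilb_apply, unitHilb_apply,
      𝓐.r_one_eq_s_one]
    exact mul_comm _ _

theorem norm_unitHilb_le (f : C₀(X, ℂ)) : ‖(unitHilb f : 𝓐.Hilb 1)‖ ≤ ‖f‖ :=
  FibreFamily.norm_le (HilbMod.sqBound_injective (norm_nonneg f) injective_s_one fun m =>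
    HilbMod.norm_c0_apply_le f _)

theorem continuous_unitHilb : Continuous (unitHilb : C₀(X, ℂ) → 𝓐.Hilb 1) := by
  refine (LipschitzWith.of_dist_le_mul (K := 1) fun f g => ?_).continuous
  rw [dist_eq_norm, dist_eq_norm, ← unitHilb_sub, NNReal.coe_one, one_mul]
  exact norm_unitHilb_le _

theorem denseRange_ccToC0 [LocallyCompactSpace X] :
    DenseRange (ccToC0 : C_c(X, ℂ) → C₀(X, ℂ)) := by
  intro f
  refine Metric.mem_closure_iff.2 fun ε hε => ?_
  obtain ⟨g, hg⟩ := exists_ccToC0_approx f (half_pos hε)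
  refine ⟨ccToC0 g, ⟨g, rfl⟩, ?_⟩
  rw [dist_comm, dist_eq_norm]
  exact hg.trans_lt (half_lt_self hε)

theorem ccInner_ccPull (f g : C_c(X, ℂ)) :
    ccInner (ccPull 1 f : C_c(𝓐.M 1, ℂ)) (ccPull 1 g) = star f * g := by
  refine CompactlySupportedContinuousMap.ext fun x => ?_
  obtain ⟨m, rfl⟩ := 𝓐.isHomeomorph_r_one.surjective x
  have hm : 𝓐.s 1 m = 𝓐.r 1 m := by rw [𝓐.r_one_eq_s_one]
  rw [ccInner_apply, tsum_eq_single (⟨m, hm⟩ : 𝓐.s 1 ⁻¹' {𝓐.r 1 m})]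
  · rfl
  · rintro ⟨m', hm'⟩ hne
    exact absurd (Subtype.ext (injective_s_one ((show 𝓐.s 1 m' = _ from hm').trans hm.symm))) hne

namespace CcRep

/-- The composite of a representation with a star-homomorphism. -/
def map {C D : Type*} [NonUnitalRing C] [StarRing C] [Module ℂ C] [NonUnitalRing D] [StarRing D]
    [Module ℂ D] (R : 𝓐.CcRep C) (j : C →⋆ₙₐ[ℂ] D) : 𝓐.CcRep D where
  S p := (j : C →ₗ[ℂ] D).comp (R.S p)
  S_mul_S h ξ η := (map_mul j _ _).symm.trans (congrArg j (R.S_mul_S h ξ η))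
  star_S_mul_S p ξ η := by
    change star (j (R.S p ξ)) * j (R.S p η) = j (R.S 1 _)
    rw [← map_star, ← map_mul, R.star_S_mul_S]
  cov p f n α β h := by
    change j (R.S 1 _) = ∑ i, j (R.S p (α i)) * star (j (R.S p (β i)))
    rw [R.cov p f n α β h, map_sum]
    exact Finset.sum_congr rfl fun i _ => by rw [map_mul, map_star]

variable [LocallyCompactSpace X] {B : Type*} [NonUnitalCStarAlgebra B] (R : 𝓐.CcRep B)

/-- The restriction of a representation to functions on `X`. -/
def ccHom : C_c(X, ℂ) →⋆ₙₐ[ℂ] B where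
  toFun f := R.S 1 (ccPull 1 f)
  map_smul' c f := by rw [ccPull_smul, map_smul]; rfl
  map_zero' := by rw [ccPull_zero, map_zero]
  map_add' f g := by rw [ccPull_add, map_add]
  map_mul' f g := by rw [R.S_mul_S (mul_one 1), ccProd_ccPull]
  map_star' f := by
    obtain ⟨F, hF, -⟩ := exists_cc_eq_one f.hasCompactSupport.isCompact
    have h1 : star f * F = star f := CompactlySupportedContinuousMap.ext fun x => by
      by_cases hx : x ∈ tsupport f
      · rw [CompactlySupportedContinuousMap.mul_apply, hF x hx, mul_one]
      · have : star f x = 0 := by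
          change conj (f x) = 0
          rw [image_eq_zero_of_notMem_tsupport hx, map_zero]
        rw [CompactlySupportedContinuousMap.mul_apply, this, zero_mul]
    have h2 : star F * f = f := by
      rw [mul_comm, ← star_star f, ← star_star (star (star f) * star F)]
      exact congrArg star ((star_mul' _ _).trans (by rw [star_star, star_star, h1]))
    have h3 : star (R.S 1 (ccPull 1 f)) * R.S 1 (ccPull 1 F) = R.S 1 (ccPull 1 (star f)) := by
      rw [R.star_S_mul_S, ccInner_ccPull, h1]
    have h4 : star (R.S 1 (ccPull 1 F)) * R.S 1 (ccPull 1 f) = R.S 1 (ccPull 1 f) := by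
      rw [R.star_S_mul_S, ccInner_ccPull, h2]
    calc R.S 1 (ccPull 1 (star f)) = star (star (R.S 1 (ccPull 1 F)) * R.S 1 (ccPull 1 f)) := by
          rw [star_mul, star_star, h3]
      _ = star (R.S 1 (ccPull 1 f)) := by rw [h4]

theorem norm_S_le {p : P} (ξ : C_c(𝓐.M p, ℂ)) : ‖R.S p ξ‖ ≤ 1 * ‖(ofCc ξ : 𝓐.Hilb p)‖ := by
  rw [one_mul]
  have h1 : ‖R.ccHom (ccInner ξ ξ)‖ ≤ ‖(ofCc ξ : 𝓐.Hilb p)‖ ^ 2 :=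
    norm_map_cc_le R.ccHom _ (by positivity) fun x => by
      rw [← ccToC0_apply, ← innerC_ofCc, sq]
      exact (HilbMod.norm_c0_apply_le _ x).trans (HilbMod.norm_innerC_le _ _)
  have h2 : star (R.S p ξ) * R.S p ξ = R.ccHom (ccInner ξ ξ) := R.star_S_mul_S p ξ ξ
  rw [← h2, CStarRing.norm_star_mul_self, ← sq] at h1
  exact (pow_le_pow_iff_left₀ (norm_nonneg _) (norm_nonneg _) two_ne_zero).1 h1

/-- The continuous extension of a representation to the Hilbert modules. -/
def extendS (p : P) : 𝓐.Hilb p →L[ℂ] B :=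
  (R.S p).extendOfNorm (HilbMod.ofCc (𝓐.isLocalHomeomorph_s p))

theorem extendS_ofCc {p : P} (ξ : C_c(𝓐.M p, ℂ)) : R.extendS p (ofCc ξ) = R.S p ξ :=
  LinearMap.extendOfNorm_eq (denseRange_ofCc p) ⟨1, R.norm_S_le⟩ ξ

theorem extendS_mul {p q w : P} (h : p * q = w) (ξ : 𝓐.Hilb p) (η : 𝓐.Hilb q) :
    R.extendS p ξ * R.extendS q η = R.extendS w (prodHilb h ξ η) := by
  refine (denseRange_ofCc p).induction_on (p := fun ξ : 𝓐.Hilb p =>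
    R.extendS p ξ * R.extendS q η = R.extendS w (prodHilb h ξ η)) ξ
    (isClosed_eq ((R.extendS p).continuous.mul continuous_const)
      ((R.extendS w).continuous.comp (continuous_prodHilb_left h η))) fun ξ => ?_
  refine (denseRange_ofCc q).induction_on (p := fun η : 𝓐.Hilb q =>
    R.extendS p (ofCc ξ) * R.extendS q η = R.extendS w (prodHilb h (ofCc ξ) η)) η
    (isClosed_eq (continuous_const.mul (R.extendS q).continuous)
      ((R.extendS w).continuous.comp (continuous_prodHilb_right h _))) fun η => ?_
  change R.extendS p (ofCc ξ) * R.extendS q (ofCc η) = R.extendS w (prodHilb h (ofCc ξ) (ofCc η))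
  rw [prodHilb_ofCc, extendS_ofCc, extendS_ofCc, extendS_ofCc, R.S_mul_S]

theorem star_extendS_mul (p : P) (ξ η : 𝓐.Hilb p) :
    star (R.extendS p ξ) * R.extendS p η = R.extendS 1 (unitHilb (HilbMod.innerC ξ η)) := by
  refine (denseRange_ofCc p).induction_on (p := fun ξ : 𝓐.Hilb p =>
    star (R.extendS p ξ) * R.extendS p η = R.extendS 1 (unitHilb (HilbMod.innerC ξ η))) ξ
    (isClosed_eq ((R.extendS p).continuous.star.mul continuous_const)
      ((R.extendS 1).continuous.comp
        (continuous_unitHilb.comp (HilbMod.continuous_innerC_left η)))) fun ξ => ?_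
  refine (denseRange_ofCc p).induction_on (p := fun η : 𝓐.Hilb p =>
    star (R.extendS p (ofCc ξ)) * R.extendS p η =
      R.extendS 1 (unitHilb (HilbMod.innerC (ofCc ξ) η))) η
    (isClosed_eq (continuous_const.mul (R.extendS p).continuous)
      ((R.extendS 1).continuous.comp
        (continuous_unitHilb.comp (HilbMod.continuous_innerC_right _)))) fun η => ?_
  change star (R.extendS p (ofCc ξ)) * R.extendS p (ofCc η) =
    R.extendS 1 (unitHilb (HilbMod.innerC (ofCc ξ) (ofCc η)))
  rw [innerC_ofCc, unitHilb_ccToC0, extendS_ofCc, extendS_ofCc, extendS_ofCc, R.star_S_mul_S]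

/-- A representation of the compactly supported functions in a C⋆-algebra extends to the
completions. -/
def toPreRep : 𝓐.PreRep B where
  π :=
    { toFun := fun f => R.extendS 1 (unitHilb f)
      map_smul' := fun c f => by rw [unitHilb_smul, map_smul]; rfl
      map_zero' := by rw [unitHilb_zero, map_zero]
      map_add' := fun f g => by rw [unitHilb_add, map_add]
      map_mul' := fun f g => by rw [R.extendS_mul (mul_one 1), prodHilb_unitHilb_unitHilb]
      map_star' := fun f => by
        refine denseRange_ccToC0.induction_on (p := fun f =>
          R.extendS 1 (unitHilb (star f)) = star (R.extendS 1 (unitHilb f))) f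
          (isClosed_eq ((R.extendS 1).continuous.comp (continuous_unitHilb.comp continuous_star))
            ((R.extendS 1).continuous.comp continuous_unitHilb).star) fun f => ?_
        change R.extendS 1 (unitHilb (ccToC0 (star f))) = _
        rw [unitHilb_ccToC0, unitHilb_ccToC0, extendS_ofCc, extendS_ofCc]
        exact map_star R.ccHom f }
  S p := R.extendS p
  S_one f := rfl
  star_S_mul_S p ξ η := R.star_extendS_mul p ξ η
  S_mul_S h ξ η := R.extendS_mul h ξ η
  cov p f n α β h := by
    change R.extendS 1 (unitHilb (ccToC0 f)) =
      ∑ i, R.extendS p (ofCc (α i)) * star (R.extendS p (ofCc (β i)))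
    rw [unitHilb_ccToC0, extendS_ofCc, R.cov p f n α β h]
    exact Finset.sum_congr rfl fun i _ => by rw [extendS_ofCc, extendS_ofCc]

theorem toPreRep_S_ofCc {p : P} (ξ : C_c(𝓐.M p, ℂ)) : R.toPreRep.S p (ofCc ξ) = R.S p ξ :=
  R.extendS_ofCc ξ

end CcRep

end CorrespondenceAction

end HilbertModuleExtension

/-! ### The isomorphism -/

noncomputable section Isomorphism

theorem continuous_starHom {A B : Type*} [NonUnitalCStarAlgebra A] [NonUnitalCStarAlgebra B]
    (j : A →⋆ₙₐ[ℂ] B) : Continuous j :=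
  AddMonoidHomClass.continuous_of_bound j 1 fun x => by
    rw [one_mul]
    exact NonUnitalStarAlgHom.norm_apply_le j x

theorem CStarSeminorm.toCompletion_eq_iff {A : Type*} [NonUnitalRing A] [StarRing A] [Module ℂ A]
    [IsScalarTower ℂ A A] [SMulCommClass ℂ A A] [StarModule ℂ A] (N : CStarSeminorm A) {a b : A} :
    N.toCompletion a = N.toCompletion b ↔ N (a - b) = 0 := by
  rw [← sub_eq_zero, ← map_sub, ← norm_eq_zero, N.norm_toCompletion]

namespace CorrespondenceAction

variable {P : Type*} [Monoid P] {X : Type*} [TopologicalSpace X] [T2Space X]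
  {𝓐 : CorrespondenceAction P X}

/-- A star-homomorphism `τ` on a star-algebra that is marked by the Hilbert modules of the product
system gives a representation if the kernel of `τ` contains every element that is killed by a
given family of star-homomorphisms which come from representations. -/
def PreRep.ofHom {A C I : Type*} [NonUnitalRing A] [StarRing A] [Module ℂ A]
    [NonUnitalCStarAlgebra C] {B : I → Type*} [∀ i, NonUnitalCStarAlgebra (B i)]
    (τ : A →⋆ₙₐ[ℂ] C) (s : ∀ p, 𝓐.Hilb p → A) (R : ∀ i, 𝓐.PreRep (B i))
    (ρ : ∀ i, A →⋆ₙₐ[ℂ] B i) (hρ : ∀ i p ξ, ρ i (s p ξ) = (R i).S p ξ)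
    (h : ∀ a b, (∀ i, ρ i a = ρ i b) → τ a = τ b) : 𝓐.PreRep C where
  π :=
    { toFun := fun f => τ (s 1 (unitHilb f))
      map_smul' := fun c f => (h _ (c • s 1 (unitHilb f)) fun i => by
        rw [map_smul, hρ, hρ, (R i).S_one, (R i).S_one, map_smul]).trans (map_smul τ c _)
      map_zero' := (h _ 0 fun i => by
        rw [hρ, (R i).S_one, map_zero, map_zero]).trans (map_zero τ)
      map_add' := fun f g => (h _ (s 1 (unitHilb f) + s 1 (unitHilb g)) fun i => by
        rw [map_add, hρ, hρ, hρ, (R i).S_one, (R i).S_one, (R i).S_one, map_add]).trans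
          (map_add τ _ _)
      map_mul' := fun f g => (h _ (s 1 (unitHilb f) * s 1 (unitHilb g)) fun i => by
        rw [map_mul, hρ, hρ, hρ, (R i).S_one, (R i).S_one, (R i).S_one, map_mul]).trans
          (map_mul τ _ _)
      map_star' := fun f => (h _ (star (s 1 (unitHilb f))) fun i => by
        rw [map_star, hρ, hρ, (R i).S_one, (R i).S_one, map_star]).trans (map_star τ _) }
  S p :=
    { toFun := fun ξ => τ (s p ξ)
      map_add' := fun ξ η => (h _ (s p ξ + s p η) fun i => by
        rw [map_add, hρ, hρ, hρ, map_add]).trans (map_add τ _ _)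
      map_smul' := fun c ξ => (h _ (c • s p ξ) fun i => by
        rw [map_smul, hρ, hρ, map_smul]).trans (map_smul τ c _) }
  S_one f := rfl
  star_S_mul_S p ξ η := by
    change star (τ (s p ξ)) * τ (s p η) = τ (s 1 _)
    rw [← map_star, ← map_mul]
    exact h _ _ fun i => by
      rw [map_mul, map_star, hρ, hρ, hρ, (R i).S_one, (R i).star_S_mul_S]
  S_mul_S {p q w} hw ξ η := by
    change τ (s p ξ) * τ (s q η) = τ (s w _)
    rw [← map_mul]
    exact h _ _ fun i => by rw [map_mul, hρ, hρ, hρ, (R i).S_mul_S]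
  cov p f n α β hk := by
    change τ (s 1 _) = ∑ i, τ (s p (ofCc (α i))) * star (τ (s p (ofCc (β i))))
    have h1 : ∑ i, τ (s p (ofCc (α i))) * star (τ (s p (ofCc (β i)))) =
        τ (∑ i, s p (ofCc (α i)) * star (s p (ofCc (β i)))) := by
      rw [map_sum]
      exact Finset.sum_congr rfl fun i _ => by rw [map_mul, map_star]
    rw [h1]
    refine h _ _ fun j => ?_
    rw [map_sum, hρ, (R j).S_one, (R j).cov p f n α β hk]
    exact Finset.sum_congr rfl fun i _ => by rw [map_mul, map_star, hρ, hρ]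

/-- The zero representation. -/
def PreRep.zero (B : Type*) [NonUnitalCStarAlgebra B] : 𝓐.PreRep B where
  π := 0
  S _ := 0
  S_one _ := rfl
  star_S_mul_S _ _ _ := mul_zero _
  S_mul_S _ _ _ := mul_zero _
  cov p f n α β _ := (Finset.sum_eq_zero fun i _ => zero_mul _).symm

section Universal

variable [LocallyCompactSpace X]

theorem covariantSeminorms_nonempty : 𝓐.covariantSeminorms.Nonempty :=
  ⟨0, (PreRep.zero _).toCovariantRep, fun p ξ => by
    have h : ‖(0 : CStarSeminorm (FreeStarAlgebra (Σ p, 𝓐.Hilb p))).toCompletion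
        (FreeStarAlgebra.gen ⟨p, ξ⟩)‖ = 0 := CStarSeminorm.norm_toCompletion _
    exact (norm_eq_zero.1 h).symm⟩

/-- The seminorms of covariant representations are bounded at each element, because representations
are contractive on generators. -/
theorem exists_covariantSeminorm_le (a : FreeStarAlgebra (Σ p, 𝓐.Hilb p)) :
    ∃ C, ∀ N ∈ 𝓐.covariantSeminorms, N a ≤ C := by
  induction a using FreeStarAlgebra.induction_on with
  | gen x =>
    refine ⟨‖x.2‖, ?_⟩
    rintro N ⟨R, hR⟩
    rw [← N.norm_toCompletion, ← hR x.1 x.2]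
    exact R.toPreRep.norm_S_le x.2
  | star a ha =>
    obtain ⟨C, hC⟩ := ha
    exact ⟨C, fun N hN => (N.star_eq a).le.trans (hC N hN)⟩
  | zero => exact ⟨0, fun N _ => (map_zero N.toSeminorm).le⟩
  | add a b ha hb =>
    obtain ⟨C, hC⟩ := ha
    obtain ⟨D, hD⟩ := hb
    exact ⟨C + D, fun N hN => (map_add_le_add N.toSeminorm a b).trans
      (add_le_add (hC N hN) (hD N hN))⟩
  | mul a b ha hb =>
    obtain ⟨C, hC⟩ := ha
    obtain ⟨D, hD⟩ := hb
    exact ⟨C * D, fun N hN => (N.mul_le a b).trans (mul_le_mul (hC N hN) (hD N hN)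
      (apply_nonneg N.toSeminorm _) ((apply_nonneg N.toSeminorm _).trans (hC N hN)))⟩
  | smul c a ha =>
    obtain ⟨C, hC⟩ := ha
    exact ⟨‖c‖ * C, fun N hN => (map_smul_eq_mul N.toSeminorm c a).le.trans
      (mul_le_mul_of_nonneg_left (hC N hN) (norm_nonneg c))⟩

variable (𝓐) in
/-- The universal representation in the Cuntz–Pimsner algebra. -/
def universalRep : 𝓐.PreRep 𝓐.CuntzPimsner :=
  PreRep.ofHom (I := 𝓐.covariantSeminorms) (B := fun N => N.1.Completion)
    (CStarSeminorm.sup 𝓐.covariantSeminorms).toCompletion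
    (fun p ξ => FreeStarAlgebra.gen ⟨p, ξ⟩) (fun N => N.2.choose.toPreRep) (fun N => N.1.toCompletion)
    (fun N p ξ => (N.2.choose_spec p ξ).symm) fun a b h => by
      refine (CStarSeminorm.toCompletion_eq_iff _).2 (le_antisymm
        (CStarSeminorm.sup_le covariantSeminorms_nonempty exists_covariantSeminorm_le
          fun N hN => ?_) (apply_nonneg (CStarSeminorm.toSeminorm _) _))
      exact (N.toCompletion_eq_iff.1 (h ⟨N, hN⟩)).le

theorem universalRep_S {p : P} (ξ : 𝓐.Hilb p) : 𝓐.universalRep.S p ξ = toCuntzPimsner p ξ := rfl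

namespace PreRep

variable {B : Type*} [NonUnitalCStarAlgebra B] (R : 𝓐.PreRep B)

/-- The star-homomorphism on the free star-algebra given by a representation. -/
def freeHom : FreeStarAlgebra (Σ p, 𝓐.Hilb p) →⋆ₙₐ[ℂ] B := FreeStarAlgebra.lift fun x => R.S x.1 x.2

theorem freeHom_gen (p : P) (ξ : 𝓐.Hilb p) : R.freeHom (FreeStarAlgebra.gen ⟨p, ξ⟩) = R.S p ξ :=
  FreeStarAlgebra.lift_gen _ _

theorem pullback_freeHom_mem : CStarSeminorm.pullback R.freeHom ∈ 𝓐.covariantSeminorms :=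
  ⟨(PreRep.ofHom (I := Unit) (CStarSeminorm.pullback R.freeHom).toCompletion
    (fun p ξ => FreeStarAlgebra.gen ⟨p, ξ⟩) (fun _ => R)
    (fun _ => R.freeHom) (fun _ p ξ => R.freeHom_gen p ξ) fun a b h => by
      refine (CStarSeminorm.toCompletion_eq_iff _).2 ?_
      rw [CStarSeminorm.pullback_apply, map_sub, h (), sub_self, norm_zero]).toCovariantRep,
    fun _ _ => rfl⟩

/-- The universal property of the Cuntz–Pimsner algebra. -/
def cuntzPimsnerHom : 𝓐.CuntzPimsner →⋆ₙₐ[ℂ] B :=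
  CStarSeminorm.extend R.freeHom fun a =>
    CStarSeminorm.le_sup exists_covariantSeminorm_le R.pullback_freeHom_mem a

theorem continuous_cuntzPimsnerHom : Continuous R.cuntzPimsnerHom :=
  CStarSeminorm.continuous_extend _ _

theorem cuntzPimsnerHom_apply {p : P} (ξ : 𝓐.Hilb p) :
    R.cuntzPimsnerHom (toCuntzPimsner p ξ) = R.S p ξ :=
  (CStarSeminorm.extend_toCompletion _ _ _).trans (R.freeHom_gen p ξ)

end PreRep

/-- Star-homomorphisms on the Cuntz–Pimsner algebra are determined by their values on
compactly supported functions. -/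
theorem cuntzPimsner_hom_ext {B : Type*} [NonUnitalCStarAlgebra B] {j k : 𝓐.CuntzPimsner →⋆ₙₐ[ℂ] B}
    (h : ∀ (p : P) (ξ : C_c(𝓐.M p, ℂ)), j (toCuntzPimsner p (ofCc ξ)) = k (toCuntzPimsner p (ofCc ξ)))
    (x : 𝓐.CuntzPimsner) : j x = k x := by
  have hj : Continuous j := continuous_starHom j
  have hk : Continuous k := continuous_starHom k
  have h1 : ∀ (p : P) (ξ : 𝓐.Hilb p), j (toCuntzPimsner p ξ) = k (toCuntzPimsner p ξ) :=
    fun p ξ => (denseRange_ofCc p).induction_on (p := fun ξ : 𝓐.Hilb p =>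
      j (toCuntzPimsner p ξ) = k (toCuntzPimsner p ξ)) ξ
      (isClosed_eq (hj.comp (𝓐.universalRep.continuous_S p))
        (hk.comp (𝓐.universalRep.continuous_S p))) (h p)
  have h2 := FreeStarAlgebra.hom_ext
    (j.comp (CStarSeminorm.sup 𝓐.covariantSeminorms).toCompletion)
    (k.comp (CStarSeminorm.sup 𝓐.covariantSeminorms).toCompletion) fun x => h1 x.1 x.2
  exact CStarSeminorm.denseRange_toCompletion.induction_on (p := fun x => j x = k x) x
    (isClosed_eq hj hk) h2

end Universal

section Groupoid

variable [RightOre P] [LocallyCompactSpace X]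

/-- A star-homomorphism on the convolution algebra that agrees with a representation on the functions
`arrowConv ξ` has a graph that contains the relation generated by the representation. -/
theorem PreRep.algebra_le_graph {B : Type*} [NonUnitalCStarAlgebra B] (R : 𝓐.PreRep B)
    {j : 𝓐.groupoid.ConvAlg →⋆ₙₐ[ℂ] B}
    (hj : ∀ (p : P) (ξ : C_c(𝓐.M p, ℂ)), j (arrowConv ξ) = R.S p (ofCc ξ)) :
    R.graphRep.algebra ≤ graph j := by
  refine Submodule.span_le.2 ?_
  rintro v ⟨g, p, q, -, hv⟩
  refine CcRep.spanMulStar_induction (Q := fun v => v ∈ graph j) (fun ξ η => ?_) (zero_mem _)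
    (fun _ _ => add_mem) (fun c _ => Submodule.smul_mem _ c) hv
  change (R.graphRep.S p ξ * star (R.graphRep.S q η)).2 =
    j (R.graphRep.S p ξ * star (R.graphRep.S q η)).1
  rw [fst_mul_star, snd_mul_star, map_mul, map_star, hj, hj]

/-- A star-homomorphism on the convolution algebra is determined by its values on the
functions `arrowConv ξ`. -/
theorem PreRep.eq_convHom {B : Type*} [NonUnitalCStarAlgebra B] (R : 𝓐.PreRep B)
    {j : 𝓐.groupoid.ConvAlg →⋆ₙₐ[ℂ] B}
    (hj : ∀ (p : P) (ξ : C_c(𝓐.M p, ℂ)), j (arrowConv ξ) = R.S p (ofCc ξ))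
    (f : 𝓐.groupoid.ConvAlg) : j f = R.convHom f := by
  obtain ⟨K, hK, h1, h2⟩ := (R.exists_isLimit f).choose_spec
  have h3 : IsLimit (graph j) f (R.convHom f) := ⟨K, hK, h1, fun ε hε => by
    obtain ⟨v, hv, h⟩ := h2 ε hε
    exact ⟨v, R.algebra_le_graph hj hv, h⟩⟩
  exact (IsLimit.of_mem (E := graph j) (v := (f, j f)) rfl).unique (isControlled_graph j) h3

variable (𝓐) in
/-- The representation of the product system in the groupoid C⋆-algebra. -/
def cstarRep : 𝓐.PreRep 𝓐.groupoid.CStar := (𝓐.groupoidRep.map 𝓐.groupoid.toCStar).toPreRep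

theorem cstarRep_S_ofCc {p : P} (ξ : C_c(𝓐.M p, ℂ)) :
    𝓐.cstarRep.S p (ofCc ξ) = 𝓐.groupoid.toCStar (arrowConv ξ) :=
  CcRep.toPreRep_S_ofCc _ ξ

variable (𝓐) in
/-- The star-homomorphism from the groupoid C⋆-algebra to the Cuntz–Pimsner algebra. -/
def fromCStar : 𝓐.groupoid.CStar →⋆ₙₐ[ℂ] 𝓐.CuntzPimsner :=
  CStarSeminorm.extend 𝓐.universalRep.convHom fun f => norm_le_seminorm _ f

theorem fromCStar_toCStar (f : 𝓐.groupoid.ConvAlg) :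
    𝓐.fromCStar (𝓐.groupoid.toCStar f) = 𝓐.universalRep.convHom f :=
  CStarSeminorm.extend_toCompletion _ _ _

theorem fromCStar_cuntzPimsnerHom (x : 𝓐.CuntzPimsner) :
    𝓐.fromCStar (𝓐.cstarRep.cuntzPimsnerHom x) = x := by
  refine cuntzPimsner_hom_ext (j := 𝓐.fromCStar.comp 𝓐.cstarRep.cuntzPimsnerHom)
    (k := NonUnitalStarAlgHom.id ℂ _) (fun p ξ => ?_) x
  change 𝓐.fromCStar (𝓐.cstarRep.cuntzPimsnerHom (toCuntzPimsner p (ofCc ξ))) =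
    toCuntzPimsner p (ofCc ξ)
  rw [PreRep.cuntzPimsnerHom_apply, cstarRep_S_ofCc, fromCStar_toCStar, PreRep.convHom_arrowConv,
    universalRep_S]

/-- Both `cuntzPimsnerHom ∘ convHom` and `toCStar` are star-homomorphisms on the convolution algebra
that map `arrowConv ξ` to `cstarRep.S p ξ`. -/
theorem cuntzPimsnerHom_fromCStar (y : 𝓐.groupoid.CStar) :
    𝓐.cstarRep.cuntzPimsnerHom (𝓐.fromCStar y) = y := by
  have h1 : ∀ f : 𝓐.groupoid.ConvAlg,
      𝓐.cstarRep.cuntzPimsnerHom (𝓐.universalRep.convHom f) = 𝓐.groupoid.toCStar f := fun f =>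
    (𝓐.cstarRep.eq_convHom (j := 𝓐.cstarRep.cuntzPimsnerHom.comp 𝓐.universalRep.convHom)
      (fun p ξ => by
        change 𝓐.cstarRep.cuntzPimsnerHom (𝓐.universalRep.convHom (arrowConv ξ)) = _
        rw [PreRep.convHom_arrowConv, universalRep_S, PreRep.cuntzPimsnerHom_apply]) f).trans
      (𝓐.cstarRep.eq_convHom (j := 𝓐.groupoid.toCStar)
        (fun p ξ => (cstarRep_S_ofCc ξ).symm) f).symm
  refine CStarSeminorm.denseRange_toCompletion.induction_on
    (p := fun y => 𝓐.cstarRep.cuntzPimsnerHom (𝓐.fromCStar y) = y) y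
    (isClosed_eq (𝓐.cstarRep.continuous_cuntzPimsnerHom.comp (continuous_starHom 𝓐.fromCStar))
      continuous_id) fun f => ?_
  exact (congrArg 𝓐.cstarRep.cuntzPimsnerHom (fromCStar_toCStar f)).trans (h1 f)

variable (𝓐) in
/-- The isomorphism between the Cuntz–Pimsner algebra and the groupoid C⋆-algebra. -/
def cuntzPimsnerEquiv : 𝓐.CuntzPimsner ≃⋆ₐ[ℂ] 𝓐.groupoid.CStar where
  toFun := 𝓐.cstarRep.cuntzPimsnerHom
  invFun := 𝓐.fromCStar
  left_inv := fromCStar_cuntzPimsnerHom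
  right_inv := cuntzPimsnerHom_fromCStar
  map_mul' := map_mul _
  map_add' := map_add _
  map_star' := map_star _
  map_smul' := map_smul _

end Groupoid

end CorrespondenceAction

end Isomorphism

theorem mainTheorem6 {P : Type*} [Monoid P] [RightOre P] {X : Type*} [TopologicalSpace X]
    [T2Space X] [LocallyCompactSpace X] (𝓐 : CorrespondenceAction P X) :
    ∃! Φ : 𝓐.CuntzPimsner ≃⋆ₐ[ℂ] 𝓐.groupoid.CStar,
      ∀ (p : P) (ξ : C_c(𝓐.M p, ℂ)),
        Φ (CorrespondenceAction.toCuntzPimsner p (CorrespondenceAction.ofCc ξ)) =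
          𝓐.groupoid.toCStar (CorrespondenceAction.arrowConv ξ) := by
  have h : ∀ (p : P) (ξ : C_c(𝓐.M p, ℂ)),
      𝓐.cuntzPimsnerEquiv (CorrespondenceAction.toCuntzPimsner p (CorrespondenceAction.ofCc ξ)) =
        𝓐.groupoid.toCStar (CorrespondenceAction.arrowConv ξ) := fun p ξ =>
    (𝓐.cstarRep.cuntzPimsnerHom_apply _).trans (CorrespondenceAction.cstarRep_S_ofCc ξ)
  refine ⟨𝓐.cuntzPimsnerEquiv, h, fun Φ hΦ => DFunLike.ext _ _ fun x => ?_⟩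
  exact CorrespondenceAction.cuntzPimsner_hom_ext
    (j := (Φ : 𝓐.CuntzPimsner →⋆ₙₐ[ℂ] 𝓐.groupoid.CStar))
    (k := (𝓐.cuntzPimsnerEquiv : 𝓐.CuntzPimsner →⋆ₙₐ[ℂ] 𝓐.groupoid.CStar))
    (fun p ξ => (hΦ p ξ).trans (h p ξ).symm) x
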